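/- Let $L,T\ge 1$. The $L$-by-$T$ grid is the directed graph with vertices $v_{l,t}$ ($1\le l\le L$, $1\le t\le T$; $l$ is the row, $t$ the column) and with the downward arcs $(v_{l,t},v_{l+1,t})$, $l\le L-1$, and the forward arcs $(v_{l,t},v_{l,t+1})$, $t\le T-1$. An instance of the minimum-concave-cost flow problem in the grid (MFG) consists of integer supplies $b_v$ with $\sum_v b_v=0$, capacities $U_a\in\{0,1,2,\dots\}\cup\{\infty\}$, and functions $c_a:\mathbb R\to\mathbb R$, one for each arc $a$, each concave on $\{x\in\mathbb R: 0\le x\le U_a\}$. The task is to find a vector $x=(x_a)_a$ of real numbers that minimizes $\sum_a c_a(x_a)$ subject to $$\sum_{a\in\delta^+(v)}x_a-\sum_{a\in\delta^-(v)}x_a=b_v\quad\text{for every vertex }v,\qquad 0\le x_a\le U_a\quad\text{for every arc }a,$$ where $\delta^+(v)$ and $\delta^-(v)$ are the sets of arcs that leave and enter $v$, or to report that no such vector exists. A source is a vertex with $b_v>0$, a sink is a vertex with $b_v<0$. The capacitated problem (C-MFG) consists of the instances in which at least one arc has a finite capacity. The model of computation is the real random access machine, in which each arithmetic operation on, and each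 comparison of, (exactly stored) real numbers takes one step, together with an oracle that, given an arc $a$ and a real number $x$, returns $c_a(x)$ in one step. **Statement.** The C-MFG with a constant number $L$ of rows, a constant bound $K$ on the number of distinct finite capacities, and all sources and sinks in at most two rows is polynomially solvable: for all fixed $L$ and $K$ there are a program of the real random access machine and a polynomial $p$ such that for every $T$ and every instance of the C-MFG in the $L$-by-$T$ grid with $|\{U_a : U_a<\infty\}|\le K$, and with some two (possibly equal) rows that contain all sources and all sinks, the program halts after at most $p(T)$ steps and outputs an optimal flow, or reports correctly that there is no feasible flow. -/

import Mathlib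

/-! The real random access machine with a cost oracle. -/

namespace RealRAM

/-- The memory: index registers `idx 0, idx 1, …` holding natural numbers (used for addresses and
loop counters) and real registers `real 0, real 1, …`, each holding a real number exactly. There is
no operation that turns the content of a real register into an index (no rounding). -/
@[ext]
structure State where
  idx : ℕ → ℕ
  real : ℕ → ℝ

/-- The elementary instructions. `d`, `a`, `b` are fixed register numbers; `iload`, `istore`,
`rload`, `rstore` address a register indirectly, through the content of an index register. -/
inductive Instr where
  | iconst (d n : ℕ)
  | icopy (d a : ℕ)
  | iadd (d a b : ℕ)
  | isub (d a b : ℕ)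
  | imul (d a b : ℕ)
  | iload (d a : ℕ)
  | istore (a b : ℕ)
  | rcast (d a : ℕ)
  | rcopy (d a : ℕ)
  | radd (d a b : ℕ)
  | rsub (d a b : ℕ)
  | rmul (d a b : ℕ)
  | rdiv (d a b : ℕ)
  | rload (d a : ℕ)
  | rstore (a b : ℕ)
  | query (d a b : ℕ)

namespace State

def setIdx (s : State) (d v : ℕ) : State := { s with idx := Function.update s.idx d v }

noncomputable def setReal (s : State) (d : ℕ) (v : ℝ) : State :=
  { s with real := Function.update s.real d v }

end State

/-- The effect of one instruction. `oracle e x` is the answer to the query "cost of sending the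
amount `x` over arc number `e`". -/
noncomputable def Instr.apply (oracle : ℕ → ℝ → ℝ) (s : State) : Instr → State
  | iconst d n => s.setIdx d n
  | icopy d a => s.setIdx d (s.idx a)
  | iadd d a b => s.setIdx d (s.idx a + s.idx b)
  | isub d a b => s.setIdx d (s.idx a - s.idx b)
  | imul d a b => s.setIdx d (s.idx a * s.idx b)
  | iload d a => s.setIdx d (s.idx (s.idx a))
  | istore a b => s.setIdx (s.idx a) (s.idx b)
  | rcast d a => s.setReal d (s.idx a : ℝ)
  | rcopy d a => s.setReal d (s.real a)
  | radd d a b => s.setReal d (s.real a + s.real b)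
  | rsub d a b => s.setReal d (s.real a - s.real b)
  | rmul d a b => s.setReal d (s.real a * s.real b)
  | rdiv d a b => s.setReal d (s.real a / s.real b)
  | rload d a => s.setReal d (s.real (s.idx a))
  | rstore a b => s.setReal (s.idx a) (s.real b)
  | query d a b => s.setReal d (oracle (s.idx a) (s.real b))

/-- The tests a program may branch on: comparisons of two index or two real registers. -/
inductive Test where
  | ilt (a b : ℕ)
  | ile (a b : ℕ)
  | rlt (a b : ℕ)
  | rle (a b : ℕ)

def Test.Holds (s : State) : Test → Prop
  | ilt a b => s.idx a < s.idx b
  | ile a b => s.idx a ≤ s.idx b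
  | rlt a b => s.real a < s.real b
  | rle a b => s.real a ≤ s.real b

/-- A program is a finite text built from instructions by sequencing, branching and looping. -/
inductive Prog where
  | instr (i : Instr)
  | seq (p q : Prog)
  | ite (c : Test) (p q : Prog)
  | loop (c : Test) (p : Prog)

/-- `Exec oracle p s n s'`: started in state `s`, program `p` halts in state `s'` after exactly
`n` steps. Every executed instruction (an oracle query included) and every evaluated test is one
step. -/
inductive Exec (oracle : ℕ → ℝ → ℝ) : Prog → State → ℕ → State → Prop where
  | instr (i : Instr) (s : State) : Exec oracle (.instr i) s 1 (i.apply oracle s)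
  | seq {p q : Prog} {s s' s'' : State} {m n : ℕ} :
      Exec oracle p s m s' → Exec oracle q s' n s'' → Exec oracle (.seq p q) s (m + n) s''
  | iteTrue {c : Test} {p q : Prog} {s s' : State} {n : ℕ} :
      c.Holds s → Exec oracle p s n s' → Exec oracle (.ite c p q) s (1 + n) s'
  | iteFalse {c : Test} {p q : Prog} {s s' : State} {n : ℕ} :
      ¬ c.Holds s → Exec oracle q s n s' → Exec oracle (.ite c p q) s (1 + n) s'
  | loopTrue {c : Test} {p : Prog} {s s' s'' : State} {m n : ℕ} :
      c.Holds s → Exec oracle p s m s' → Exec oracle (.loop c p) s' n s'' →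
        Exec oracle (.loop c p) s (1 + m + n) s''
  | loopFalse {c : Test} {p : Prog} {s : State} :
      ¬ c.Holds s → Exec oracle (.loop c p) s 1 s

end RealRAM

/-! The minimum-concave-cost flow problem in the `L`-by-`T` grid. -/

/-- Vertices of the grid: (row, column), counted from zero. -/
abbrev GridVertex (L T : ℕ) : Type := Fin L × Fin T

/-- Arcs of the grid, as pairs (tail, head): downward arcs (to the next row in the same column)
and forward arcs (to the next column in the same row). -/
abbrev GridArc (L T : ℕ) : Type :=
  { e : GridVertex L T × GridVertex L T //
    ((e.1.1 : ℕ) + 1 = e.2.1 ∧ e.1.2 = e.2.2) ∨ (e.1.1 = e.2.1 ∧ (e.1.2 : ℕ) + 1 = e.2.2) }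

namespace GridArc

variable {L T : ℕ}

abbrev tail (a : GridArc L T) : GridVertex L T := a.1.1

abbrev head (a : GridArc L T) : GridVertex L T := a.1.2

end GridArc

/-- The admissible flow values on an arc of capacity `u`: the interval `[0, u]`, or `[0, ∞)` if
`u = ⊤`. -/
def capInterval (u : ℕ∞) : Set ℝ := {x | 0 ≤ x ∧ ∀ k : ℕ, u = k → x ≤ k}

/-- An instance of the minimum-concave-cost flow problem. The cost functions need to be concave
only on the admissible flow values, so fixed charges are allowed. -/
structure MFG (L T : ℕ) where
  supply : GridVertex L T → ℤ
  cap : GridArc L T → ℕ∞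
  cost : GridArc L T → ℝ → ℝ
  sum_supply : ∑ v, supply v = 0
  concave : ∀ a, ConcaveOn ℝ (capInterval (cap a)) (cost a)

/-- The number of a vertex: columns one after the other, from top to bottom. -/
def vertexNumber {L T : ℕ} (v : GridVertex L T) : ℕ := L * v.2 + v.1

/-- The number of an arc: `2i` for the downward and `2i + 1` for the forward arc leaving vertex
number `i`. -/
def arcNumber {L T : ℕ} (a : GridArc L T) : ℕ :=
  2 * vertexNumber a.tail + if a.tail.1 = a.head.1 then 1 else 0

theorem vertexNumber_injective (L T : ℕ) :
    Function.Injective (vertexNumber : GridVertex L T → ℕ) := by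
  rintro ⟨l, t⟩ ⟨l', t'⟩ h
  simp only [vertexNumber] at h
  have hl := l.isLt
  have hl' := l'.isLt
  have hL : 0 < L := by omega
  have h1 : (l : ℕ) = l' := by
    have := congrArg (· % L) h
    simpa [Nat.mul_add_mod, Nat.mod_eq_of_lt hl, Nat.mod_eq_of_lt hl'] using this
  have h2 : (t : ℕ) = t' := by
    rw [h1] at h
    exact Nat.eq_of_mul_eq_mul_left hL (Nat.add_right_cancel h)
  exact Prod.ext (Fin.ext h1) (Fin.ext h2)

theorem arcNumber_injective (L T : ℕ) :
    Function.Injective (arcNumber : GridArc L T → ℕ) := by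
  rintro ⟨⟨u, v⟩, h⟩ ⟨⟨u', v'⟩, h'⟩ e
  replace e : (2 * vertexNumber u + if u.1 = v.1 then 1 else 0) =
      2 * vertexNumber u' + if u'.1 = v'.1 then 1 else 0 := e
  simp only at h h'
  have hu : u = u' := by
    apply vertexNumber_injective
    by_cases h1 : u.1 = v.1 <;> by_cases h2 : u'.1 = v'.1 <;>
      simp only [h1, h2, if_true, if_false] at e <;> omega
  subst hu
  have hrow : u.1 = v.1 ↔ u.1 = v'.1 := by
    by_cases h1 : u.1 = v.1 <;> by_cases h2 : u.1 = v'.1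
    · exact iff_of_true h1 h2
    · rw [if_pos h1, if_neg h2] at e
      omega
    · rw [if_neg h1, if_pos h2] at e
      omega
    · exact iff_of_false h1 h2
  have hv : v = v' := by
    simp only [Fin.ext_iff] at h h' hrow
    refine Prod.ext (Fin.ext ?_) (Fin.ext ?_) <;> omega
  subst hv
  rfl

namespace MFG

variable {L T : ℕ}

/-- Flow conservation (outflow minus inflow equals the supply) and the capacity constraints. -/
def IsFeasible (I : MFG L T) (x : GridArc L T → ℝ) : Prop :=
  (∀ v, ∑ a with a.tail = v, x a - ∑ a with a.head = v, x a = (I.supply v : ℝ)) ∧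
    ∀ a, x a ∈ capInterval (I.cap a)

def totalCost (I : MFG L T) (x : GridArc L T → ℝ) : ℝ := ∑ a, I.cost a (x a)

def IsOptimal (I : MFG L T) (x : GridArc L T → ℝ) : Prop :=
  I.IsFeasible x ∧ ∀ y, I.IsFeasible y → I.totalCost x ≤ I.totalCost y

/-- At least one arc has a finite capacity. -/
def IsCapacitated (I : MFG L T) : Prop := ∃ a, I.cap a < ⊤

/-- The number of distinct finite arc capacities. -/
noncomputable def numCapacities (I : MFG L T) : ℕ := {u : ℕ∞ | u < ⊤ ∧ ∃ a, I.cap a = u}.ncard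

/-- All sources (positive supply) and all sinks (negative supply) lie in two (possibly equal)
rows. -/
def TerminalsInTwoRows (I : MFG L T) : Prop :=
  ∃ r₁ r₂ : Fin L, ∀ v : GridVertex L T, I.supply v ≠ 0 → v.1 = r₁ ∨ v.1 = r₂

/-- The cost oracle: returns `c_a(x)`, given the number of the arc `a` and the value `x` (and `0`
for a number that is not the number of an arc). -/
noncomputable def oracle (I : MFG L T) (e : ℕ) (x : ℝ) : ℝ :=
  Function.extend arcNumber (fun a => I.cost a x) 0 e

/-- The initial memory. Index registers `0` and `1` hold `L` and `T`, and register `2 + e` holds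
`1` if arc number `e` exists and has a finite capacity. Real register `i < L * T` holds the supply
of vertex number `i`, and register `L * T + e` holds the capacity of arc number `e`, if this arc
exists and has a finite capacity. All other registers hold `0`. -/
noncomputable def input (I : MFG L T) : RealRAM.State where
  idx r :=
    if r = 0 then L
    else if r = 1 then T
    else Function.extend arcNumber (fun a => if I.cap a < ⊤ then 1 else 0) 0 (r - 2)
  real r :=
    if r < L * T then Function.extend vertexNumber (fun v => (I.supply v : ℝ)) 0 r
    else Function.extend arcNumber (fun a => ((I.cap a).toNat : ℝ)) 0 (r - L * T)

/-- A correct final memory: either index register `0` holds `1` and the real registers with the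
numbers of the arcs hold an optimal flow, or index register `0` holds `0` and there is no feasible
flow. -/
def IsSolvedBy (I : MFG L T) (s : RealRAM.State) : Prop :=
  (s.idx 0 = 1 ∧ I.IsOptimal fun a => s.real (arcNumber a)) ∨
    (s.idx 0 = 0 ∧ ∀ x, ¬ I.IsFeasible x)

end MFG

/-! The grid is planar, so a flow is described by a stream function `φ` on the corners of the dual
grid: `φ l t` is the total flow on the first `t` arcs that enter row `l` from above. The flow on a
downward arc is the difference of `φ` at two neighbouring corners of one row; the flow on a forward
arc is such a difference across two rows plus a partial row sum of supplies. Conservation then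
becomes automatic, and only boundary conditions on `φ` remain (`IsStream`).

Call an arc free if its flow is strictly between its bounds. If a set of interior corners is bounded
by free arcs only, `φ` can be shifted on this set in both directions until some arc stops being
free. By concavity of the costs one of the two directions is not more expensive
(`exists_stream_of_region`). Hence some flow that costs no more has the property that every corner
is joined, across arcs that are not free, to a corner outside the strip between the two terminal
rows or at its left or right end (`exists_stream_reachable`).

Because the terminals lie in two rows, `φ` vanishes above and below the strip. After a change of `φ`
there by partial row sums (`innerStream`), every flow in the strip is a pure difference, and
crossing an arc that is not free changes the value by `0` or by plus or minus a capacity. So every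
value of `φ` is `0` or a signed partial row sum, plus an integer combination of the at most `K`
finite capacities with coefficients bounded by the number of corners (`IsFeasible.exists_isNear`).
For fixed `L` and `K` there are polynomially many such values, and so polynomially many possible
columns of `φ`.

The costs and constraints of the arcs that leave one column of vertices involve only two consecutive
columns of `φ`. The problem is thus a shortest path problem in a layered graph with polynomially
many nodes, solved by a dynamic program from right to left. Every path found gives a feasible flow,
whether or not it has this special form; every feasible flow is matched by a path that costs no more
(`Represents.isSolvedBy`).

The remaining work is to run this on the machine. Expressions, tests and memory transformations are
compiled compositionally with polynomial time bounds (`IComp`, `RComp`, `BComp`, `CComp`). Candidate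
values and column states are numbered by integers, whose digits encode the coefficients and
addresses, so no rounding of reals is needed. -/

namespace RealRAM

/-! ### Time-bounded execution of programs. -/

/-- `Runs O P s b Q`: started in `s`, the program `P` halts after at most `b` steps in a state that
satisfies `Q`. -/
def Runs (O : ℕ → ℝ → ℝ) (P : Prog) (s : State) (b : ℕ) (Q : State → Prop) : Prop :=
  ∃ n s', Exec O P s n s' ∧ n ≤ b ∧ Q s'

namespace Runs

variable {O : ℕ → ℝ → ℝ} {P P' : Prog} {s : State} {b b' : ℕ} {Q Q' : State → Prop} {c : Test}

theorem mono (h : Runs O P s b Q) (hb : b ≤ b') (hQ : ∀ s', Q s' → Q' s') : Runs O P s b' Q' := by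
  obtain ⟨n, s', h1, h2, h3⟩ := h
  exact ⟨n, s', h1, h2.trans hb, hQ _ h3⟩

theorem instr {i : Instr} (h : Q (i.apply O s)) : Runs O (.instr i) s 1 Q :=
  ⟨1, _, .instr i s, le_rfl, h⟩

theorem seq (h : Runs O P s b fun s' => Runs O P' s' b' Q) : Runs O (.seq P P') s (b + b') Q := by
  obtain ⟨n, s', h1, h2, m, s'', h3, h4, h5⟩ := h
  exact ⟨n + m, s'', .seq h1 h3, by omega, h5⟩

theorem ite (h : c.Holds s → Runs O P s b Q) (h' : ¬ c.Holds s → Runs O P' s b' Q) :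
    Runs O (.ite c P P') s (1 + b + b') Q := by
  by_cases hc : c.Holds s
  · obtain ⟨n, s', h1, h2, h3⟩ := h hc
    exact ⟨1 + n, s', .iteTrue hc h1, by omega, h3⟩
  · obtain ⟨n, s', h1, h2, h3⟩ := h' hc
    exact ⟨1 + n, s', .iteFalse hc h1, by omega, h3⟩

/-- The invariant is indexed by the number of completed rounds and decides the test, so the number
of rounds is exactly `N`. Each round costs one test and at most `b` steps, and the last test fails.
-/
theorem loop (inv : ℕ → State → Prop) (N : ℕ)
    (hstep : ∀ j < N, ∀ s, inv j s → c.Holds s ∧ Runs O P s b (inv (j + 1)))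
    (hend : ∀ s, inv N s → ¬ c.Holds s) (h0 : inv 0 s) :
    Runs O (.loop c P) s (N * (b + 1) + 1) (inv N) := by
  suffices H : ∀ m ≤ N, ∀ s, inv (N - m) s →
      Runs O (.loop c P) s (m * (b + 1) + 1) (inv N) from
    H N le_rfl s (by simpa using h0)
  intro m
  induction m with
  | zero =>
    intro _ s hs
    exact ⟨1, s, .loopFalse (hend s hs), by simp, hs⟩
  | succ m ih =>
    intro hm s hs
    obtain ⟨hc, n, s', h1, h2, h3⟩ := hstep (N - (m + 1)) (by omega) s hs
    rw [show N - (m + 1) + 1 = N - m by omega] at h3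
    obtain ⟨n', s'', h4, h5, h6⟩ := ih (by omega) s' h3
    exact ⟨1 + n + n', s'', .loopTrue hc h1 h4, by rw [Nat.succ_mul]; omega, h6⟩

end Runs

@[simp] theorem State.setIdx_idx (s : State) (d v r : ℕ) :
    (s.setIdx d v).idx r = if r = d then v else s.idx r := by
  simp [State.setIdx, Function.update_apply]

@[simp] theorem State.setIdx_real (s : State) (d v : ℕ) : (s.setIdx d v).real = s.real := rfl

@[simp] theorem State.setReal_real (s : State) (d : ℕ) (v : ℝ) (r : ℕ) :
    (s.setReal d v).real r = if r = d then v else s.real r := by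
  simp [State.setReal, Function.update_apply]

@[simp] theorem State.setReal_idx (s : State) (d : ℕ) (v : ℝ) : (s.setReal d v).idx = s.idx := rfl

/-! ### Memory layout and the compilation of expressions. -/

/-- What a program sees besides its memory: the number of columns and the oracle. -/
structure Ctx where
  T : ℕ
  oracle : ℕ → ℝ → ℝ

/-- A memory of eight index arrays and eight real arrays. Array `i 0` serves as a list of
variables. -/
structure Mem where
  i : Fin 8 → ℕ → ℕ
  r : Fin 8 → ℕ → ℝ

namespace Mem

def setI (h : Mem) (a : Fin 8) (k v : ℕ) : Mem :=
  { h with i := Function.update h.i a (Function.update (h.i a) k v) }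

noncomputable def setR (h : Mem) (a : Fin 8) (k : ℕ) (v : ℝ) : Mem :=
  { h with r := Function.update h.r a (Function.update (h.r a) k v) }

@[simp] theorem setI_r (h : Mem) (a : Fin 8) (k v : ℕ) : (h.setI a k v).r = h.r := rfl

@[simp] theorem setR_i (h : Mem) (a : Fin 8) (k : ℕ) (v : ℝ) : (h.setR a k v).i = h.i := rfl

theorem setI_i (h : Mem) (a : Fin 8) (k v : ℕ) (b : Fin 8) :
    (h.setI a k v).i b = if b = a then Function.update (h.i a) k v else h.i b := by
  simp only [setI, Function.update_apply]

theorem setR_r (h : Mem) (a : Fin 8) (k : ℕ) (v : ℝ) (b : Fin 8) :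
    (h.setR a k v).r b = if b = a then Function.update (h.r a) k v else h.r b := by
  simp only [setR, Function.update_apply]

end Mem

/-- The index registers used for the memory: multiples of `2 * L`, in sixteen classes. -/
def cell (L : ℕ) (c : Fin 16) (k : ℕ) : ℕ := 2 * L * (16 * (k + 1) + c)

def arrayClass (a : Fin 8) : Fin 16 := Fin.castLE (by norm_num) a

@[simp] theorem arrayClass_inj (a b : Fin 8) : arrayClass a = arrayClass b ↔ a = b := by
  simp [arrayClass, Fin.ext_iff]

@[simp] theorem arrayClass_val (a : Fin 8) : (arrayClass a : ℕ) = a := rfl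

theorem arrayClass_ne (a : Fin 8) (c : Fin 16) (hc : 8 ≤ (c : ℕ)) : arrayClass a ≠ c := by
  intro h
  have := congrArg Fin.val h
  simp at this
  omega

@[simp] theorem arrayClass_ne_tmp (a : Fin 8) : arrayClass a ≠ 8 := arrayClass_ne a 8 (by decide)
@[simp] theorem arrayClass_ne_cnt (a : Fin 8) : arrayClass a ≠ 9 := arrayClass_ne a 9 (by decide)
@[simp] theorem arrayClass_ne_bnd (a : Fin 8) : arrayClass a ≠ 10 := arrayClass_ne a 10 (by decide)
@[simp] theorem arrayClass_ne_par (a : Fin 8) : arrayClass a ≠ 11 := arrayClass_ne a 11 (by decide)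

@[simp] theorem cell_inj {L : ℕ} [NeZero L] (c c' : Fin 16) (k k' : ℕ) :
    cell L c k = cell L c' k' ↔ c = c' ∧ k = k' := by
  constructor
  · intro h
    have hL : 0 < 2 * L := by have := NeZero.pos L; omega
    have h1 := Nat.eq_of_mul_eq_mul_left hL h
    have := c.isLt
    have := c'.isLt
    exact ⟨Fin.ext (by omega), by omega⟩
  · rintro ⟨rfl, rfl⟩
    rfl

abbrev tmp (L k : ℕ) : ℕ := cell L 8 k
abbrev cnt (L k : ℕ) : ℕ := cell L 9 k
abbrev bnd (L k : ℕ) : ℕ := cell L 10 k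

/-- The real registers for intermediate results. -/
def rtmp (k : ℕ) : ℕ := 16 * k

/-- The real registers for the arrays of the memory; `B` exceeds the numbers of the input
registers. -/
def rcell (B : ℕ) (a : Fin 8) (k : ℕ) : ℕ := 16 * (k + B) + a + 1

@[simp] theorem rtmp_inj (k k' : ℕ) : rtmp k = rtmp k' ↔ k = k' := by simp [rtmp]

@[simp] theorem rcell_inj (B : ℕ) (a a' : Fin 8) (k k' : ℕ) :
    rcell B a k = rcell B a' k' ↔ a = a' ∧ k = k' := by
  have := a.isLt
  have := a'.isLt
  simp only [rcell, Fin.ext_iff]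
  omega

@[simp] theorem rcell_ne_rtmp (B : ℕ) (a : Fin 8) (k k' : ℕ) : rcell B a k ≠ rtmp k' := by
  have := a.isLt
  simp only [rcell, rtmp]
  omega

/-- The state `s` of the machine represents the memory `h`. -/
structure Enc (L T : ℕ) (h : Mem) (s : State) : Prop where
  i : ∀ a k, s.idx (cell L (arrayClass a) k) = h.i a k
  par : s.idx (cell L 11 0) = T
  base : s.idx (cell L 11 1) = 3 * (L * T)
  r : ∀ a k, s.real (rcell (3 * (L * T)) a k) = h.r a k

/-- Only registers for intermediate results, with numbers at least `d`, have changed. -/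
structure Frame (L d : ℕ) (s s' : State) : Prop where
  idx : ∀ r, (∀ k, d ≤ k → r ≠ tmp L k) → s'.idx r = s.idx r
  real : ∀ r, (∀ k, d ≤ k → r ≠ rtmp k) → s'.real r = s.real r

theorem Frame.trans {L d d' : ℕ} {s s' s'' : State} (h : Frame L d s s') (h' : Frame L d' s' s'')
    (hd : d ≤ d') : Frame L d s s'' :=
  ⟨fun r hr => (h'.idx r fun k hk => hr k (hd.trans hk)).trans (h.idx r hr),
    fun r hr => (h'.real r fun k hk => hr k (hd.trans hk)).trans (h.real r hr)⟩

theorem Frame.refl (L d : ℕ) (s : State) : Frame L d s s := ⟨fun _ _ => rfl, fun _ _ => rfl⟩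

theorem Frame.setIdx {L d : ℕ} {s s' : State} (h : Frame L d s s') {k : ℕ} (hk : d ≤ k) (v : ℕ) :
    Frame L d s (s'.setIdx (tmp L k) v) :=
  ⟨fun r hr => by simpa [hr k hk] using h.idx r hr, fun r hr => h.real r hr⟩

theorem Frame.setReal {L d : ℕ} {s s' : State} (h : Frame L d s s') {k : ℕ} (hk : d ≤ k) (v : ℝ) :
    Frame L d s (s'.setReal (rtmp k) v) :=
  ⟨fun r hr => h.idx r hr, fun r hr => by simpa [hr k hk] using h.real r hr⟩

section

variable {L : ℕ}

theorem Frame.rtmp_eq {d : ℕ} {s s' : State} (h : Frame L d s s') {k : ℕ} (hk : k < d) :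
    s'.real (rtmp k) = s.real (rtmp k) :=
  h.real _ fun k' hk' => by simp; omega

variable (L) in
/-- `f` is evaluated by a program in polynomial time. -/
def IComp (f : Ctx → Mem → ℕ) : Prop :=
  ∀ d, ∃ (P : Prog) (p : Polynomial ℕ), ∀ c h s, Enc L c.T h s →
    Runs c.oracle P s (p.eval c.T) fun s' => Frame L d s s' ∧ s'.idx (tmp L d) = f c h

variable (L) in
/-- The real-valued `f` is evaluated by a program in polynomial time. -/
def RComp (f : Ctx → Mem → ℝ) : Prop :=
  ∀ d, ∃ (P : Prog) (p : Polynomial ℕ), ∀ c h s, Enc L c.T h s →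
    Runs c.oracle P s (p.eval c.T) fun s' => Frame L d s s' ∧ s'.real (rtmp d) = f c h

variable (L) in
/-- `f` is decided by a program in polynomial time. -/
def BComp (f : Ctx → Mem → Prop) : Prop :=
  ∀ d, ∃ (P : Prog) (p : Polynomial ℕ), ∀ c h s, Enc L c.T h s →
    Runs c.oracle P s (p.eval c.T) fun s' => Frame L d s s' ∧
      (f c h → s'.idx (tmp L d) = 1) ∧ (¬ f c h → s'.idx (tmp L d) = 0)

variable (L) in
/-- The transformation `F` of the memory is carried out by a program in polynomial time. -/
def CComp (F : Ctx → Mem → Mem) : Prop :=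
  ∀ d, ∃ (P : Prog) (p : Polynomial ℕ), ∀ c h s, Enc L c.T h s →
    Runs c.oracle P s (p.eval c.T) fun s' => Enc L c.T (F c h) s' ∧
      ∀ k < d, s'.idx (cnt L k) = s.idx (cnt L k) ∧ s'.idx (bnd L k) = s.idx (bnd L k)

theorem IComp.const (n : ℕ) : IComp L fun _ _ => n := fun d =>
  ⟨.instr (.iconst (tmp L d) n), 1, fun c h s _ => by
    simpa using Runs.instr ⟨(Frame.refl L d s).setIdx le_rfl _, by simp [Instr.apply]⟩⟩

theorem IComp.par : IComp L fun c _ => c.T := fun d =>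
  ⟨.instr (.icopy (tmp L d) (cell L 11 0)), 1, fun c h s he => by
    simpa using Runs.instr ⟨(Frame.refl L d s).setIdx le_rfl _, by simp [Instr.apply, he.par]⟩⟩

theorem RComp.cast {f : Ctx → Mem → ℕ} (hf : IComp L f) : RComp L fun c h => (f c h : ℝ) := by
  intro d
  obtain ⟨P, p, hP⟩ := hf d
  refine ⟨.seq P (.instr (.rcast (rtmp d) (tmp L d))), p + 1, fun c h s he => ?_⟩
  simp only [Polynomial.eval_add, Polynomial.eval_one]
  refine ((hP c h s he).mono le_rfl ?_).seq
  rintro s1 ⟨hf1, h1⟩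
  exact Runs.instr ⟨hf1.setReal le_rfl _, by simp [Instr.apply, h1]⟩

theorem BComp.congr {f g : Ctx → Mem → Prop} (hf : BComp L f) (h : ∀ c m, f c m ↔ g c m) :
    BComp L g := by
  have : f = g := by
    funext c m
    exact propext (h c m)
  exact this ▸ hf

variable [NeZero L]

theorem Frame.tmp_eq {d : ℕ} {s s' : State} (h : Frame L d s s') {k : ℕ} (hk : k < d) :
    s'.idx (tmp L k) = s.idx (tmp L k) :=
  h.idx _ fun k' hk' => by simp; omega

theorem Frame.cell_eq {d : ℕ} {s s' : State} (h : Frame L d s s') {c : Fin 16} (hc : c ≠ 8)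
    (k : ℕ) : s'.idx (cell L c k) = s.idx (cell L c k) :=
  h.idx _ fun k' _ => by simp [hc]

theorem Enc.of_frame {T d : ℕ} {h : Mem} {s s' : State} (he : Enc L T h s) (hf : Frame L d s s') :
    Enc L T h s' where
  i a k := (hf.cell_eq (by simp) k).trans (he.i a k)
  par := (hf.cell_eq (by decide) 0).trans he.par
  base := (hf.cell_eq (by decide) 1).trans he.base
  r a k := (hf.real _ (by simp)).trans (he.r a k)

/-- The temporaries work as a stack: the second operand is evaluated at level `d + 1`, so it cannot
overwrite the first one, which waits in temporary `d`. -/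
theorem IComp.bin {f g : Ctx → Mem → ℕ} (hf : IComp L f) (hg : IComp L g)
    (i : ℕ → ℕ → ℕ → Instr) (op : ℕ → ℕ → ℕ)
    (hi : ∀ O s d a b, (i d a b).apply O s = s.setIdx d (op (s.idx a) (s.idx b))) :
    IComp L fun c h => op (f c h) (g c h) := by
  intro d
  obtain ⟨P, p, hP⟩ := hf d
  obtain ⟨P', p', hP'⟩ := hg (d + 1)
  refine ⟨.seq P (.seq P' (.instr (i (tmp L d) (tmp L d) (tmp L (d + 1))))), p + (p' + 1),
    fun c h s he => ?_⟩
  simp only [Polynomial.eval_add, Polynomial.eval_one]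
  refine ((hP c h s he).mono le_rfl ?_).seq
  rintro s1 ⟨hf1, h1⟩
  refine ((hP' c h s1 (he.of_frame hf1)).mono le_rfl ?_).seq
  rintro s2 ⟨hf2, h2⟩
  refine Runs.instr ?_
  rw [hi]
  refine ⟨(hf1.trans hf2 (by omega)).setIdx le_rfl _, ?_⟩
  simp [h2, ← h1, hf2.tmp_eq (Nat.lt_succ_self d)]

theorem IComp.add {f g : Ctx → Mem → ℕ} (hf : IComp L f) (hg : IComp L g) :
    IComp L fun c h => f c h + g c h := hf.bin hg .iadd (· + ·) fun _ _ _ _ _ => rfl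

theorem IComp.sub {f g : Ctx → Mem → ℕ} (hf : IComp L f) (hg : IComp L g) :
    IComp L fun c h => f c h - g c h := hf.bin hg .isub (· - ·) fun _ _ _ _ _ => rfl

theorem IComp.mul {f g : Ctx → Mem → ℕ} (hf : IComp L f) (hg : IComp L g) :
    IComp L fun c h => f c h * g c h := hf.bin hg .imul (· * ·) fun _ _ _ _ _ => rfl

theorem IComp.pow {f : Ctx → Mem → ℕ} (hf : IComp L f) (n : ℕ) : IComp L fun c h => f c h ^ n := by
  induction n with
  | zero => simpa using IComp.const 1
  | succ n ih => simpa only [pow_succ] using ih.mul hf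

theorem IComp.load {f : Ctx → Mem → ℕ} (a : Fin 8) (hf : IComp L f) :
    IComp L fun c h => h.i a (f c h) := by
  intro d
  obtain ⟨P, p, hP⟩ := ((hf.mul (.const (32 * L))).add (.const (2 * L * (16 + a)))) d
  refine ⟨.seq P (.instr (.iload (tmp L d) (tmp L d))), p + 1, fun c h s he => ?_⟩
  simp only [Polynomial.eval_add, Polynomial.eval_one]
  refine ((hP c h s he).mono le_rfl ?_).seq
  rintro s1 ⟨hf1, h1⟩
  refine Runs.instr ⟨hf1.setIdx le_rfl _, ?_⟩
  have := (he.of_frame hf1).i a (f c h)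
  simp only [Instr.apply, State.setIdx_idx, if_true, h1, ← this]
  congr 1
  simp only [cell, arrayClass_val]
  ring

theorem RComp.load {f : Ctx → Mem → ℕ} (a : Fin 8) (hf : IComp L f) :
    RComp L fun c h => h.r a (f c h) := by
  intro d
  obtain ⟨P, p, hP⟩ := (((hf.add ((IComp.const (3 * L)).mul .par)).mul (.const 16)).add
    (.const (a + 1))) d
  refine ⟨.seq P (.instr (.rload (rtmp d) (tmp L d))), p + 1, fun c h s he => ?_⟩
  simp only [Polynomial.eval_add, Polynomial.eval_one]
  refine ((hP c h s he).mono le_rfl ?_).seq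
  rintro s1 ⟨hf1, h1⟩
  refine Runs.instr ⟨hf1.setReal le_rfl _, ?_⟩
  have := (he.of_frame hf1).r a (f c h)
  simp only [Instr.apply, State.setReal_real, if_true, h1, ← this]
  congr 1
  simp only [rcell]
  ring

theorem RComp.bin {f g : Ctx → Mem → ℝ} (hf : RComp L f) (hg : RComp L g)
    (i : ℕ → ℕ → ℕ → Instr) (op : ℝ → ℝ → ℝ)
    (hi : ∀ O s d a b, (i d a b).apply O s = s.setReal d (op (s.real a) (s.real b))) :
    RComp L fun c h => op (f c h) (g c h) := by
  intro d
  obtain ⟨P, p, hP⟩ := hf d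
  obtain ⟨P', p', hP'⟩ := hg (d + 1)
  refine ⟨.seq P (.seq P' (.instr (i (rtmp d) (rtmp d) (rtmp (d + 1))))), p + (p' + 1),
    fun c h s he => ?_⟩
  simp only [Polynomial.eval_add, Polynomial.eval_one]
  refine ((hP c h s he).mono le_rfl ?_).seq
  rintro s1 ⟨hf1, h1⟩
  refine ((hP' c h s1 (he.of_frame hf1)).mono le_rfl ?_).seq
  rintro s2 ⟨hf2, h2⟩
  refine Runs.instr ?_
  rw [hi]
  refine ⟨(hf1.trans hf2 (by omega)).setReal le_rfl _, ?_⟩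
  simp [h2, ← h1, hf2.rtmp_eq (Nat.lt_succ_self d)]

theorem RComp.add {f g : Ctx → Mem → ℝ} (hf : RComp L f) (hg : RComp L g) :
    RComp L fun c h => f c h + g c h := hf.bin hg .radd (· + ·) fun _ _ _ _ _ => rfl

theorem RComp.sub {f g : Ctx → Mem → ℝ} (hf : RComp L f) (hg : RComp L g) :
    RComp L fun c h => f c h - g c h := hf.bin hg .rsub (· - ·) fun _ _ _ _ _ => rfl

theorem RComp.mul {f g : Ctx → Mem → ℝ} (hf : RComp L f) (hg : RComp L g) :
    RComp L fun c h => f c h * g c h := hf.bin hg .rmul (· * ·) fun _ _ _ _ _ => rfl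

theorem RComp.zero : RComp L fun _ _ => 0 := by
  simpa using RComp.cast (IComp.const (L := L) 0)

theorem RComp.sum (n : ℕ) {f : ℕ → Ctx → Mem → ℝ} (hf : ∀ l, RComp L (f l)) :
    RComp L fun c h => ∑ l ∈ Finset.range n, f l c h := by
  induction n with
  | zero => simpa using RComp.zero
  | succ n ih => simpa only [Finset.sum_range_succ] using ih.add (hf n)

theorem RComp.query {f : Ctx → Mem → ℕ} {g : Ctx → Mem → ℝ} (hf : IComp L f) (hg : RComp L g) :
    RComp L fun c h => c.oracle (f c h) (g c h) := by
  intro d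
  obtain ⟨P, p, hP⟩ := hf d
  obtain ⟨P', p', hP'⟩ := hg (d + 1)
  refine ⟨.seq P (.seq P' (.instr (.query (rtmp d) (tmp L d) (rtmp (d + 1))))), p + (p' + 1),
    fun c h s he => ?_⟩
  simp only [Polynomial.eval_add, Polynomial.eval_one]
  refine ((hP c h s he).mono le_rfl ?_).seq
  rintro s1 ⟨hf1, h1⟩
  refine ((hP' c h s1 (he.of_frame hf1)).mono le_rfl ?_).seq
  rintro s2 ⟨hf2, h2⟩
  refine Runs.instr ⟨(hf1.trans hf2 (by omega)).setReal le_rfl _, ?_⟩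
  simp [Instr.apply, h2, ← h1, hf2.tmp_eq (Nat.lt_succ_self d)]

theorem BComp.le {f g : Ctx → Mem → ℕ} (hf : IComp L f) (hg : IComp L g) :
    BComp L fun c h => f c h ≤ g c h := by
  intro d
  -- Subtraction of indices is truncated: `1 - (f - g)` is `1` if `f ≤ g` and `0` otherwise.
  obtain ⟨P, p, hP⟩ := ((IComp.const 1).sub (hf.sub hg)) d
  refine ⟨P, p, fun c h s he => (hP c h s he).mono le_rfl ?_⟩
  rintro s1 ⟨hf1, h1⟩
  simp only at h1
  exact ⟨hf1, fun h => by omega, fun h => by omega⟩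

theorem BComp.rle {f g : Ctx → Mem → ℝ} (hf : RComp L f) (hg : RComp L g) :
    BComp L fun c h => f c h ≤ g c h := by
  intro d
  obtain ⟨P, p, hP⟩ := hf d
  obtain ⟨P', p', hP'⟩ := hg (d + 1)
  refine ⟨.seq P (.seq P' (.ite (.rle (rtmp d) (rtmp (d + 1))) (.instr (.iconst (tmp L d) 1))
    (.instr (.iconst (tmp L d) 0)))), p + (p' + (1 + 1 + 1)), fun c h s he => ?_⟩
  simp only [Polynomial.eval_add, Polynomial.eval_one]
  refine ((hP c h s he).mono le_rfl ?_).seq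
  rintro s1 ⟨hf1, h1⟩
  refine ((hP' c h s1 (he.of_frame hf1)).mono le_rfl ?_).seq
  rintro s2 ⟨hf2, h2⟩
  have h3 := hf2.rtmp_eq (Nat.lt_succ_self d)
  refine Runs.ite (fun hc => Runs.instr ⟨(hf1.trans hf2 (by omega)).setIdx le_rfl _, ?_⟩)
    (fun hc => Runs.instr ⟨(hf1.trans hf2 (by omega)).setIdx le_rfl _, ?_⟩) <;>
  · simp only [Test.Holds, h3, h1, h2] at hc
    simp [Instr.apply, hc]

theorem BComp.not {f : Ctx → Mem → Prop} (hf : BComp L f) : BComp L fun c h => ¬ f c h := by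
  intro d
  obtain ⟨P, p, hP⟩ := hf (d + 1)
  refine ⟨.seq P (.seq (.instr (.iconst (tmp L d) 1))
    (.instr (.isub (tmp L d) (tmp L d) (tmp L (d + 1))))), p + (1 + 1), fun c h s he => ?_⟩
  simp only [Polynomial.eval_add, Polynomial.eval_one]
  refine ((hP c h s he).mono le_rfl ?_).seq
  rintro s1 ⟨hf1, h1, h2⟩
  refine Runs.seq (Runs.instr (Runs.instr ⟨?_, ?_, ?_⟩))
  · exact (((Frame.refl L d s).trans hf1 (by omega)).setIdx le_rfl _).setIdx le_rfl _
  · intro h3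
    simp [Instr.apply, h2 h3]
  · intro h3
    simp [Instr.apply, h1 (not_not.1 h3)]

theorem BComp.and {f g : Ctx → Mem → Prop} (hf : BComp L f) (hg : BComp L g) :
    BComp L fun c h => f c h ∧ g c h := by
  intro d
  obtain ⟨P, p, hP⟩ := hf d
  obtain ⟨P', p', hP'⟩ := hg (d + 1)
  refine ⟨.seq P (.seq P' (.instr (.imul (tmp L d) (tmp L d) (tmp L (d + 1))))), p + (p' + 1),
    fun c h s he => ?_⟩
  simp only [Polynomial.eval_add, Polynomial.eval_one]
  refine ((hP c h s he).mono le_rfl ?_).seq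
  rintro s1 ⟨hf1, h1, h1'⟩
  refine ((hP' c h s1 (he.of_frame hf1)).mono le_rfl ?_).seq
  rintro s2 ⟨hf2, h2, h2'⟩
  have h3 := hf2.tmp_eq (Nat.lt_succ_self d)
  refine Runs.instr ⟨(hf1.trans hf2 (by omega)).setIdx le_rfl _, ?_, ?_⟩
  · rintro ⟨h4, h5⟩
    simp [Instr.apply, h3, h1 h4, h2 h5]
  · intro h4
    by_cases h5 : f c h
    · simp [Instr.apply, h2' fun h6 => h4 ⟨h5, h6⟩]
    · simp [Instr.apply, h3, h1' h5]

theorem BComp.or {f g : Ctx → Mem → Prop} (hf : BComp L f) (hg : BComp L g) :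
    BComp L fun c h => f c h ∨ g c h :=
  (hf.not.and hg.not).not.congr fun c m => by tauto

theorem BComp.imp {f g : Ctx → Mem → Prop} (hf : BComp L f) (hg : BComp L g) :
    BComp L fun c h => f c h → g c h :=
  (hf.and hg.not).not.congr fun c m => by tauto

theorem BComp.eq {f g : Ctx → Mem → ℕ} (hf : IComp L f) (hg : IComp L g) :
    BComp L fun c h => f c h = g c h :=
  ((BComp.le hf hg).and (BComp.le hg hf)).congr fun _ _ => le_antisymm_iff.symm

theorem BComp.forall_lt (n : ℕ) {f : ℕ → Ctx → Mem → Prop} (hf : ∀ l, BComp L (f l)) :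
    BComp L fun c h => ∀ l < n, f l c h := by
  induction n with
  | zero => exact (BComp.le (IComp.const 0) (IComp.const 0)).congr fun c h => by simp
  | succ n ih =>
    refine (ih.and (hf n)).congr fun c h => ?_
    simp only [Nat.lt_succ_iff_lt_or_eq, or_imp, forall_and, forall_eq]

/-- Functions of the number of columns that are polynomials. -/
def PolyBound (b : ℕ → ℕ) : Prop := ∃ p : Polynomial ℕ, ∀ T, p.eval T = b T

theorem PolyBound.const (n : ℕ) : PolyBound fun _ => n := ⟨Polynomial.C n, by simp⟩

theorem PolyBound.id : PolyBound fun T => T := ⟨Polynomial.X, by simp⟩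

theorem PolyBound.add {f g : ℕ → ℕ} (hf : PolyBound f) (hg : PolyBound g) :
    PolyBound fun T => f T + g T := by
  obtain ⟨p, hp⟩ := hf
  obtain ⟨q, hq⟩ := hg
  exact ⟨p + q, by simp [hp, hq]⟩

theorem PolyBound.mul {f g : ℕ → ℕ} (hf : PolyBound f) (hg : PolyBound g) :
    PolyBound fun T => f T * g T := by
  obtain ⟨p, hp⟩ := hf
  obtain ⟨q, hq⟩ := hg
  exact ⟨p * q, by simp [hp, hq]⟩

theorem PolyBound.pow {f : ℕ → ℕ} (hf : PolyBound f) (n : ℕ) : PolyBound fun T => f T ^ n := by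
  obtain ⟨p, hp⟩ := hf
  exact ⟨p ^ n, by simp [hp]⟩

/-- Loop bounds and radices of the algorithm are polynomials in `T` with fixed natural coefficients,
so a program can build them from `T` by additions and multiplications. -/
theorem IComp.of_polyBound {b : ℕ → ℕ} (hb : PolyBound b) : IComp L fun c _ => b c.T := by
  obtain ⟨p, hp⟩ := hb
  simp only [← hp]
  clear hp
  induction p using Polynomial.induction_on' with
  | add p q hp hq => simpa using hp.add hq
  | monomial n a => simpa using (IComp.const a).mul (IComp.par.pow n)

end

end RealRAM

/-! ### Division of indices, memory transformations and loops. -/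

namespace RealRAM

/-- The quotient of `x` by `y`, found by `n` rounds of counting upwards. -/
def divCount (x y : ℕ) : ℕ → ℕ
  | 0 => 0
  | n + 1 => if (divCount x y n + 1) * y ≤ x then divCount x y n + 1 else divCount x y n

/-- The counter grows by one in every round until it reaches the quotient. The machine cannot divide
indices; counting is affordable because all numbers to be divided are polynomially bounded. -/
theorem divCount_eq_min {x y : ℕ} (hy : 0 < y) (n : ℕ) : divCount x y n = min (x / y) n := by
  induction n with
  | zero => simp [divCount]
  | succ n ih =>
    rw [divCount, ih]
    simp only [← Nat.le_div_iff_mul_le hy]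
    split_ifs <;> omega

theorem divCount_eq {x y n : ℕ} (hy : 0 < y) (hn : x ≤ n) : divCount x y n = x / y := by
  rw [divCount_eq_min hy]
  have := Nat.div_le_self x y
  omega

/-- Run `G` for the values `0, …, n - 1` of variable `k`. -/
def loop (k n : ℕ) (G : Mem → Mem) (h : Mem) : Mem :=
  Nat.rec h (fun j h' => G (h'.setI 0 k j)) n

@[simp] theorem loop_zero (k : ℕ) (G : Mem → Mem) (h : Mem) : loop k 0 G h = h := rfl

theorem loop_succ (k n : ℕ) (G : Mem → Mem) (h : Mem) :
    loop k (n + 1) G h = G ((loop k n G h).setI 0 k n) := rfl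

theorem loop_induction {k n : ℕ} {G : Mem → Mem} {h : Mem} (inv : ℕ → Mem → Prop) (h0 : inv 0 h)
    (hstep : ∀ j < n, ∀ h', inv j h' → inv (j + 1) (G (h'.setI 0 k j))) :
    inv n (loop k n G h) := by
  induction n with
  | zero => exact h0
  | succ n ih => exact hstep n (Nat.lt_succ_self n) _ (ih fun j hj => hstep j (by omega))

section

variable {L : ℕ} [NeZero L]

theorem IComp.divCount {f g : Ctx → Mem → ℕ} {b : ℕ → ℕ} (hf : IComp L f) (hg : IComp L g)
    (hb : PolyBound b) : IComp L fun c h => divCount (f c h) (g c h) (b c.T) := by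
  intro d
  obtain ⟨P, p, hP⟩ := hf d
  obtain ⟨P', p', hP'⟩ := hg (d + 1)
  obtain ⟨P'', p'', hP''⟩ := IComp.of_polyBound (L := L) hb (d + 2)
  obtain ⟨q, hq⟩ := hb
  refine ⟨.seq P (.seq P' (.seq P'' (.seq (.instr (.iconst (tmp L (d + 3)) 0))
    (.seq (.instr (.iconst (tmp L (d + 4)) 1)) (.seq (.instr (.iconst (tmp L (d + 5)) 0))
    (.seq (.loop (.ilt (tmp L (d + 3)) (tmp L (d + 2)))
      (.seq (.instr (.iadd (tmp L (d + 6)) (tmp L (d + 5)) (tmp L (d + 4))))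
      (.seq (.instr (.imul (tmp L (d + 6)) (tmp L (d + 6)) (tmp L (d + 1))))
      (.seq (.ite (.ile (tmp L (d + 6)) (tmp L d))
        (.instr (.iadd (tmp L (d + 5)) (tmp L (d + 5)) (tmp L (d + 4))))
        (.instr (.icopy (tmp L (d + 5)) (tmp L (d + 5)))))
      (.instr (.iadd (tmp L (d + 3)) (tmp L (d + 3)) (tmp L (d + 4))))))))
    (.instr (.icopy (tmp L d) (tmp L (d + 5)))))))))),
    p + (p' + (p'' + (1 + (1 + (1 + ((q * 7 + 1) + 1)))))), fun c h s he => ?_⟩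
  simp only [Polynomial.eval_add, Polynomial.eval_one, Polynomial.eval_mul, Polynomial.eval_ofNat]
  refine ((hP c h s he).mono le_rfl ?_).seq
  rintro s1 ⟨hf1, h1⟩
  refine ((hP' c h s1 (he.of_frame hf1)).mono le_rfl ?_).seq
  rintro s2 ⟨hf2, h2⟩
  have hf12 := hf1.trans hf2 (by omega)
  refine ((hP'' c h s2 (he.of_frame hf12)).mono le_rfl ?_).seq
  rintro s3 ⟨hf3, h3⟩
  have hf13 := hf12.trans hf3 (by omega)
  refine Runs.seq (Runs.instr (Runs.seq (Runs.instr (Runs.seq (Runs.instr (Runs.seq ?_))))))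
  have e1 : s3.idx (tmp L d) = f c h := by
    rw [hf3.tmp_eq (by omega), hf2.tmp_eq (by omega), h1]
  have e2 : s3.idx (tmp L (d + 1)) = g c h := by rw [hf3.tmp_eq (by omega), h2]
  refine (Runs.loop (fun j s' => Frame L d s s' ∧ s'.idx (tmp L d) = f c h ∧
    s'.idx (tmp L (d + 1)) = g c h ∧ s'.idx (tmp L (d + 2)) = b c.T ∧ s'.idx (tmp L (d + 3)) = j ∧
    s'.idx (tmp L (d + 4)) = 1 ∧
    s'.idx (tmp L (d + 5)) = RealRAM.divCount (f c h) (g c h) j) (b c.T) ?_ ?_ ?_).mono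
    (b' := Polynomial.eval c.T q * 7 + 1) (b := b c.T * ((1 + (1 + ((1 + 1 + 1) + 1))) + 1) + 1)
    (by rw [hq]; omega) ?_
  · rintro j hj s4 ⟨hf4, g1, g2, g3, g4, g5, g6⟩
    refine ⟨by simpa [Test.Holds, g3, g4] using hj, ?_⟩
    refine Runs.seq (Runs.instr (Runs.seq (Runs.instr (Runs.seq
      (Runs.ite (fun hc => Runs.instr (Runs.instr ?_)) (fun hc => Runs.instr (Runs.instr ?_)))))))
    all_goals
      simp only [Test.Holds, Instr.apply, State.setIdx_idx, cell_inj] at hc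
      simp [g1, g2, g5, g6] at hc
      refine ⟨(((hf4.setIdx (by omega) _).setIdx (by omega) _).setIdx (by omega) _).setIdx
        (by omega) _, ?_⟩
      simp [Instr.apply, g1, g2, g3, g4, g5, g6, RealRAM.divCount, hc]
  · rintro s4 ⟨hf4, g1, g2, g3, g4, g5, g6⟩
    simp [Test.Holds, g3, g4]
  · refine ⟨((hf13.setIdx (by omega) _).setIdx (by omega) _).setIdx (by omega) _, ?_⟩
    simp [Instr.apply, e1, e2, h3, RealRAM.divCount]
  · rintro s4 ⟨hf4, g1, g2, g3, g4, g5, g6⟩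
    exact Runs.instr ⟨hf4.setIdx le_rfl _, by simp [Instr.apply, g6]⟩

theorem CComp.id : CComp L fun _ h => h := fun _ =>
  ⟨.instr (.icopy (tmp L 0) (tmp L 0)), 1, fun c h s he => by
    simpa using Runs.instr ⟨he.of_frame ((Frame.refl L 0 s).setIdx le_rfl _),
      fun k _ => by simp [Instr.apply]⟩⟩

theorem CComp.comp {F G : Ctx → Mem → Mem} (hG : CComp L G) (hF : CComp L F) :
    CComp L fun c h => G c (F c h) := by
  intro d
  obtain ⟨P, p, hP⟩ := hF d
  obtain ⟨P', p', hP'⟩ := hG d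
  refine ⟨.seq P P', p + p', fun c h s he => ?_⟩
  rw [Polynomial.eval_add]
  refine ((hP c h s he).mono le_rfl ?_).seq
  rintro s1 ⟨he1, h1⟩
  refine (hP' c _ s1 he1).mono le_rfl ?_
  rintro s2 ⟨he2, h2⟩
  exact ⟨he2, fun k hk => ⟨(h2 k hk).1.trans (h1 k hk).1, (h2 k hk).2.trans (h1 k hk).2⟩⟩

open Classical in
theorem CComp.ite {f : Ctx → Mem → Prop} {F G : Ctx → Mem → Mem} (hf : BComp L f)
    (hF : CComp L F) (hG : CComp L G) : CComp L fun c h => if f c h then F c h else G c h := by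
  intro d
  obtain ⟨P, p, hP⟩ := hf 0
  obtain ⟨P', p', hP'⟩ := hF d
  obtain ⟨P'', p'', hP''⟩ := hG d
  refine ⟨.seq P (.seq (.instr (.iconst (tmp L 1) 0)) (.ite (.ilt (tmp L 1) (tmp L 0)) P' P'')),
    p + (1 + (1 + p' + p'')), fun c h s he => ?_⟩
  simp only [Polynomial.eval_add, Polynomial.eval_one]
  refine ((hP c h s he).mono le_rfl ?_).seq
  rintro s1 ⟨hf1, h1, h1'⟩
  refine Runs.seq (Runs.instr ?_)
  have hf2 := hf1.setIdx (Nat.zero_le 1) 0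
  have hc (k : ℕ) : (s1.setIdx (tmp L 1) 0).idx (cnt L k) = s.idx (cnt L k) ∧
      (s1.setIdx (tmp L 1) 0).idx (bnd L k) = s.idx (bnd L k) :=
    ⟨hf2.cell_eq (by decide) k, hf2.cell_eq (by decide) k⟩
  by_cases hh : f c h
  · refine Runs.ite (fun _ => ?_) (fun h3 => absurd ?_ h3)
    · refine (hP' c h _ (he.of_frame hf2)).mono le_rfl ?_
      rintro s2 ⟨he2, h2⟩
      simp only [if_pos hh]
      exact ⟨he2, fun k hk => ⟨(h2 k hk).1.trans (hc k).1, (h2 k hk).2.trans (hc k).2⟩⟩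
    · simp [Test.Holds, Instr.apply, h1 hh]
  · refine Runs.ite (fun h3 => absurd h3 ?_) (fun _ => ?_)
    · simp [Test.Holds, Instr.apply, h1' hh]
    · refine (hP'' c h _ (he.of_frame hf2)).mono le_rfl ?_
      rintro s2 ⟨he2, h2⟩
      simp only [if_neg hh]
      exact ⟨he2, fun k hk => ⟨(h2 k hk).1.trans (hc k).1, (h2 k hk).2.trans (hc k).2⟩⟩

theorem Enc.setI {T : ℕ} {h : Mem} {s : State} (he : Enc L T h s) (a : Fin 8) (k v : ℕ) :
    Enc L T (h.setI a k v) (s.setIdx (cell L (arrayClass a) k) v) where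
  i b j := by
    simp only [State.setIdx_idx, cell_inj, arrayClass_inj, Mem.setI_i, he.i]
    by_cases hb : b = a
    · subst hb
      simp [Function.update_apply]
    · simp [hb]
  par := by simpa [(arrayClass_ne_par a).symm] using he.par
  base := by simpa [(arrayClass_ne_par a).symm] using he.base
  r := he.r

theorem Enc.setR {T : ℕ} {h : Mem} {s : State} (he : Enc L T h s) (a : Fin 8) (k : ℕ) (v : ℝ) :
    Enc L T (h.setR a k v) (s.setReal (rcell (3 * (L * T)) a k) v) where
  i := he.i
  par := he.par
  base := he.base
  r b j := by
    simp only [State.setReal_real, rcell_inj, Mem.setR_r, he.r]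
    by_cases hb : b = a
    · subst hb
      simp [Function.update_apply]
    · simp [hb]

theorem CComp.setI {f g : Ctx → Mem → ℕ} (a : Fin 8) (hf : IComp L f) (hg : IComp L g) :
    CComp L fun c h => h.setI a (f c h) (g c h) := by
  intro d
  obtain ⟨P, p, hP⟩ := ((hf.mul (.const (32 * L))).add (.const (2 * L * (16 + a)))) 0
  obtain ⟨P', p', hP'⟩ := hg 1
  refine ⟨.seq P (.seq P' (.instr (.istore (tmp L 0) (tmp L 1)))), p + (p' + 1),
    fun c h s he => ?_⟩
  simp only [Polynomial.eval_add, Polynomial.eval_one]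
  refine ((hP c h s he).mono le_rfl ?_).seq
  rintro s1 ⟨hf1, h1⟩
  refine ((hP' c h s1 (he.of_frame hf1)).mono le_rfl ?_).seq
  rintro s2 ⟨hf2, h2⟩
  have hf3 := hf1.trans hf2 (by omega)
  have h3 : s2.idx (tmp L 0) = cell L (arrayClass a) (f c h) := by
    rw [hf2.tmp_eq (by omega), h1, cell, arrayClass_val]
    ring
  refine Runs.instr ?_
  rw [Instr.apply, h3, h2]
  refine ⟨(he.of_frame hf3).setI a _ _, fun k _ => ?_⟩
  simp [(arrayClass_ne_cnt a).symm, (arrayClass_ne_bnd a).symm,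
    hf3.cell_eq (show (9 : Fin 16) ≠ 8 by decide), hf3.cell_eq (show (10 : Fin 16) ≠ 8 by decide)]

theorem CComp.setR {f : Ctx → Mem → ℕ} {g : Ctx → Mem → ℝ} (a : Fin 8) (hf : IComp L f)
    (hg : RComp L g) : CComp L fun c h => h.setR a (f c h) (g c h) := by
  intro d
  obtain ⟨P, p, hP⟩ := (((hf.add ((IComp.const (3 * L)).mul .par)).mul (.const 16)).add
    (.const (a + 1))) 0
  obtain ⟨P', p', hP'⟩ := hg 1
  refine ⟨.seq P (.seq P' (.instr (.rstore (tmp L 0) (rtmp 1)))), p + (p' + 1),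
    fun c h s he => ?_⟩
  simp only [Polynomial.eval_add, Polynomial.eval_one]
  refine ((hP c h s he).mono le_rfl ?_).seq
  rintro s1 ⟨hf1, h1⟩
  refine ((hP' c h s1 (he.of_frame hf1)).mono le_rfl ?_).seq
  rintro s2 ⟨hf2, h2⟩
  have hf3 := hf1.trans hf2 (by omega)
  have h3 : s2.idx (tmp L 0) = rcell (3 * (L * c.T)) a (f c h) := by
    rw [hf2.tmp_eq (by omega), h1, rcell]
    ring
  refine Runs.instr ?_
  rw [Instr.apply, h3, h2]
  refine ⟨(he.of_frame hf3).setR a _ _, fun k _ => ?_⟩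
  simp [hf3.cell_eq (show (9 : Fin 16) ≠ 8 by decide),
    hf3.cell_eq (show (10 : Fin 16) ≠ 8 by decide)]

/-- A loop at nesting depth `d` keeps its counter and its bound in `cnt d` and `bnd d`, and its body
is compiled for depth `d + 1` and so preserves both. The bound is copied out of the temporaries,
which the body may overwrite; likewise variable `k` is only a copy of the counter. -/
theorem CComp.loop {b : ℕ → ℕ} {G : Ctx → Mem → Mem} (k : ℕ) (hb : PolyBound b)
    (hG : CComp L G) : CComp L fun c h => loop k (b c.T) (G c) h := by
  intro d
  obtain ⟨P, p, hP⟩ := IComp.of_polyBound (L := L) hb 0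
  obtain ⟨P', p', hP'⟩ := hG (d + 1)
  obtain ⟨q, hq⟩ := hb
  refine ⟨.seq P (.seq (.instr (.icopy (bnd L d) (tmp L 0)))
    (.seq (.instr (.iconst (cnt L d) 0))
    (.loop (.ilt (cnt L d) (bnd L d))
      (.seq (.instr (.icopy (cell L (arrayClass 0) k) (cnt L d)))
      (.seq P'
      (.seq (.instr (.iconst (tmp L 0) 1))
      (.instr (.iadd (cnt L d) (cnt L d) (tmp L 0))))))))),
    p + (1 + (1 + (q * ((1 + (p' + (1 + 1))) + 1) + 1))), fun c h s he => ?_⟩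
  simp only [Polynomial.eval_add, Polynomial.eval_one, Polynomial.eval_mul, hq]
  refine ((hP c h s he).mono le_rfl ?_).seq
  rintro s1 ⟨hf1, h1⟩
  refine Runs.seq (Runs.instr (Runs.seq (Runs.instr ?_)))
  refine (Runs.loop (fun j s' => Enc L c.T (RealRAM.loop k j (G c) h) s' ∧
    s'.idx (cnt L d) = j ∧ s'.idx (bnd L d) = b c.T ∧
    ∀ k < d, s'.idx (cnt L k) = s.idx (cnt L k) ∧ s'.idx (bnd L k) = s.idx (bnd L k))
    (b c.T) ?_ ?_ ?_).mono le_rfl ?_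
  · rintro j hj s2 ⟨he2, g1, g2, g3⟩
    refine ⟨by simpa [Test.Holds, g1, g2] using hj, Runs.seq (Runs.instr (Runs.seq ?_))⟩
    have he3 := he2.setI 0 k j
    rw [Instr.apply, g1]
    refine (hP' c _ _ he3).mono le_rfl ?_
    rintro s4 ⟨he4, h4⟩
    refine Runs.seq (Runs.instr (Runs.instr ?_))
    have hfr := (Frame.refl L 0 s4).setIdx le_rfl 1
    have g4 := h4 d (Nat.lt_succ_self d)
    simp [g1, g2, (arrayClass_ne_cnt 0).symm, (arrayClass_ne_bnd 0).symm] at g4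
    refine ⟨⟨?_, ?_, ?_, ?_⟩, ?_, ?_, fun k hk => ?_⟩
    · intro a k
      simpa [Instr.apply, loop_succ] using he4.i a k
    · simpa [Instr.apply] using he4.par
    · simpa [Instr.apply] using he4.base
    · intro a k
      simpa [Instr.apply, loop_succ] using he4.r a k
    · simp [Instr.apply, g4.1]
    · simp [Instr.apply, g4.2]
    · have := h4 k (by omega)
      simp [(arrayClass_ne_cnt 0).symm, (arrayClass_ne_bnd 0).symm, g3 k hk] at this
      simp [Instr.apply, this, hk.ne]
  · rintro s2 ⟨he2, g1, g2, g3⟩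
    simp [Test.Holds, g1, g2]
  · have he1 := he.of_frame hf1
    have := h1
    refine ⟨⟨?_, ?_, ?_, ?_⟩, ?_, ?_, fun k hk => ?_⟩
    · intro a k
      simpa [Instr.apply] using he1.i a k
    · simpa [Instr.apply] using he1.par
    · simpa [Instr.apply] using he1.base
    · intro a k
      simpa [Instr.apply] using he1.r a k
    · simp [Instr.apply]
    · simpa [Instr.apply] using h1
    · simp [Instr.apply, hk.ne, hf1.cell_eq (show (9 : Fin 16) ≠ 8 by decide),
        hf1.cell_eq (show (10 : Fin 16) ≠ 8 by decide)]
  · rintro s2 ⟨he2, g1, g2, g3⟩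
    exact ⟨he2, g3⟩

end

end RealRAM

/-! ### Copying the input into the memory and the result out of it. -/

namespace RealRAM

/-- All working index registers are multiples of `2 * L`, while the flag of an existing arc never
sits at such a number (`not_dvd_two_add_arcNumber`). Hence the input flags survive until they are
copied. -/
theorem ne_cell_of_not_dvd {L r : ℕ} (h : ¬ 2 * L ∣ r) (c : Fin 16) (k : ℕ) : r ≠ cell L c k :=
  fun e => h (e ▸ Dvd.intro _ rfl)

/-- Run the instruction `i`, then the program `P`. -/
def Prog.cons (i : Instr) (P : Prog) : Prog := .seq (.instr i) P

theorem Runs.cons {O : ℕ → ℝ → ℝ} {s : State} {b : ℕ} {Q : State → Prop} {i : Instr} {P : Prog}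
    (h : Runs O P (i.apply O s) b Q) : Runs O (.cons i P) s (b + 1) Q :=
  (Runs.seq (Runs.instr h)).mono (Nat.add_comm 1 b).le fun _ => id

theorem Runs.cons_istore {O : ℕ → ℝ → ℝ} {s : State} {n : ℕ} {Q : State → Prop} {P : Prog}
    {a b r v : ℕ} (ha : s.idx a = r) (hb : s.idx b = v) (h : Runs O P (s.setIdx r v) n Q) :
    Runs O (.cons (.istore a b) P) s (n + 1) Q := by
  subst ha hb
  exact Runs.cons h

theorem Runs.cons_rstore {O : ℕ → ℝ → ℝ} {s : State} {n : ℕ} {Q : State → Prop} {P : Prog}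
    {a b r : ℕ} {v : ℝ} (ha : s.idx a = r) (hb : s.real b = v)
    (h : Runs O P (s.setReal r v) n Q) : Runs O (.cons (.rstore a b) P) s (n + 1) Q := by
  subst ha hb
  exact Runs.cons h

/-- Copy the input into the arrays `i 1` and `r 0` of the memory. -/
def initProg (L : ℕ) : Prog :=
  .cons (.icopy (cell L 11 0) 1) <|
  .cons (.iconst (tmp L 0) (3 * L)) <|
  .cons (.imul (cell L 11 1) (tmp L 0) (cell L 11 0)) <|
  .cons (.iconst (tmp L 1) 1) <|
  .cons (.iconst (tmp L 2) (2 * L)) <|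
  .cons (.imul (tmp L 2) (tmp L 2) (cell L 11 0)) <|
  .cons (.iconst (cnt L 0) 0) <|
  .seq (.loop (.ilt (cnt L 0) (tmp L 2)) <|
      .cons (.iconst (tmp L 3) 2) <|
      .cons (.iadd (tmp L 3) (tmp L 3) (cnt L 0)) <|
      .cons (.iload (tmp L 3) (tmp L 3)) <|
      .cons (.iconst (tmp L 4) (32 * L)) <|
      .cons (.imul (tmp L 4) (tmp L 4) (cnt L 0)) <|
      .cons (.iconst (tmp L 5) (34 * L)) <|
      .cons (.iadd (tmp L 4) (tmp L 4) (tmp L 5)) <|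
      .cons (.istore (tmp L 4) (tmp L 3)) <|
      .instr (.iadd (cnt L 0) (cnt L 0) (tmp L 1))) <|
  .cons (.iconst (cnt L 0) 0) <|
  .loop (.ilt (cnt L 0) (cell L 11 1)) <|
      .cons (.rload 0 (cnt L 0)) <|
      .cons (.iadd (tmp L 3) (cnt L 0) (cell L 11 1)) <|
      .cons (.iconst (tmp L 4) 16) <|
      .cons (.imul (tmp L 3) (tmp L 3) (tmp L 4)) <|
      .cons (.iadd (tmp L 3) (tmp L 3) (tmp L 1)) <|
      .cons (.rstore (tmp L 3) 0) <|
      .instr (.iadd (cnt L 0) (cnt L 0) (tmp L 1))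

theorem runs_initProg (L : ℕ) [NeZero L] : ∃ p : Polynomial ℕ, ∀ (O : ℕ → ℝ → ℝ) (T : ℕ)
    (s : State), s.idx 1 = T → Runs O (initProg L) s (p.eval T) fun s' => ∃ h, Enc L T h s' ∧
      (∀ e < 2 * L * T, ¬ 2 * L ∣ 2 + e → h.i 1 e = s.idx (2 + e)) ∧
      ∀ j < 3 * (L * T), h.r 0 j = s.real j := by
  refine ⟨7 + ((2 * L * .X * 10 + 1) + (1 + (3 * (L * .X) * 8 + 1))), fun O T s hT => ?_⟩
  have hnd {r : ℕ} (h : ¬ 2 * L ∣ r) (c : Fin 16) (k : ℕ) : r = cell L c k ↔ False :=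
    iff_false_intro (ne_cell_of_not_dvd h c k)
  refine Runs.mono (b := 2 * L * T * (9 + 1) + 1 + ((3 * (L * T)) * (7 + 1) + 1 + 1) + 7)
    (Q := fun s' => s'.idx (cell L 11 0) = T ∧ s'.idx (cell L 11 1) = 3 * (L * T) ∧
      (∀ e < 2 * L * T, ¬ 2 * L ∣ 2 + e → s'.idx (cell L (arrayClass 1) e) = s.idx (2 + e)) ∧
      ∀ j < 3 * (L * T), s'.real (rcell (3 * (L * T)) 0 j) = s.real j)
    ?_ (by simp; omega) ?_
  swap
  · rintro s' ⟨h1, h2, h3, h4⟩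
    exact ⟨⟨fun a k => s'.idx (cell L (arrayClass a) k),
      fun a k => s'.real (rcell (3 * (L * T)) a k)⟩,
      ⟨fun _ _ => rfl, h1, h2, fun _ _ => rfl⟩, h3, h4⟩
  iterate 7 refine Runs.cons ?_
  refine Runs.seq ((Runs.loop (fun j s' => (∀ r, ¬ 2 * L ∣ r → s'.idx r = s.idx r) ∧
    s'.idx (cell L 11 0) = T ∧ s'.idx (cell L 11 1) = 3 * (L * T) ∧ s'.idx (tmp L 1) = 1 ∧
    s'.idx (tmp L 2) = 2 * L * T ∧ s'.idx (cnt L 0) = j ∧ s'.real = s.real ∧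
    ∀ e < j, ¬ 2 * L ∣ 2 + e → s'.idx (cell L (arrayClass 1) e) = s.idx (2 + e))
    (2 * L * T) ?_ ?_ ?_).mono le_rfl ?_)
  · rintro j hj s1 ⟨g1, g2, g3, g4, g5, g6, g7, g8⟩
    refine ⟨by simpa [Test.Holds, g5, g6] using hj, ?_⟩
    have hc : 32 * L * j + 34 * L = cell L (arrayClass 1) j := by
      simp only [cell, arrayClass_val, show ((1 : Fin 8) : ℕ) = 1 from rfl]
      ring
    iterate 7 refine Runs.cons ?_
    refine Runs.cons_istore (r := cell L (arrayClass 1) j) (by simp [Instr.apply, g6, hc]) rfl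
      (Runs.instr ?_)
    refine ⟨fun r hr => ?_, ?_, ?_, ?_, ?_, ?_, ?_, ?_⟩
    · simp [Instr.apply, hnd hr, g1 r hr]
    · simp [Instr.apply, g2, (arrayClass_ne_par 1).symm]
    · simp [Instr.apply, g3, (arrayClass_ne_par 1).symm]
    · simp [Instr.apply, g4, (arrayClass_ne_tmp 1).symm]
    · simp [Instr.apply, g5, (arrayClass_ne_tmp 1).symm]
    · simp [Instr.apply, g4, g6, (arrayClass_ne_tmp 1).symm, (arrayClass_ne_cnt 1).symm]
    · simp [Instr.apply, g7]
    · intro e he hd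
      rcases Nat.lt_succ_iff_lt_or_eq.1 he with he | rfl
      · simp [Instr.apply, g8 e he hd, he.ne]
      · simp [Instr.apply, g6, hnd hd, g1 _ hd]
  · rintro s1 ⟨g1, g2, g3, g4, g5, g6, g7, g8⟩
    simp [Test.Holds, g5, g6]
  · refine ⟨fun r hr => ?_, ?_, ?_, ?_, ?_, ?_, rfl, by simp⟩
    · simp [Instr.apply, hnd hr]
    · simp [Instr.apply, hT]
    · simp [Instr.apply, hT, mul_assoc]
    · simp [Instr.apply]
    · simp [Instr.apply, hT]
    · simp [Instr.apply]
  rintro s1 ⟨g1, g2, g3, g4, g5, g6, g7, g8⟩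
  refine Runs.cons ?_
  refine (Runs.loop (fun j s' => s'.idx (cell L 11 0) = T ∧ s'.idx (cell L 11 1) = 3 * (L * T) ∧
    s'.idx (tmp L 1) = 1 ∧ s'.idx (cnt L 0) = j ∧
    (∀ e < 2 * L * T, ¬ 2 * L ∣ 2 + e → s'.idx (cell L (arrayClass 1) e) = s.idx (2 + e)) ∧
    -- Real register `0` is both an input register and the transfer register. It is overwritten from
    -- the first round on, but its own entry is the first to be copied, so only the entries not yet
    -- copied must be intact. The target registers lie above all input registers.
    (∀ i, j ≤ i → i < 3 * (L * T) → s'.real i = s.real i) ∧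
    ∀ i < j, s'.real (rcell (3 * (L * T)) 0 i) = s.real i) (3 * (L * T)) ?_ ?_ ?_).mono le_rfl ?_
  · rintro j hj s2 ⟨f2, f3, f4, f6, f8, f9, f10⟩
    refine ⟨by simpa [Test.Holds, f3, f6] using hj, ?_⟩
    iterate 5 refine Runs.cons ?_
    refine Runs.cons_rstore (r := rcell (3 * (L * T)) 0 j)
      (by simp [Instr.apply, f6, f3, f4, rcell]; ring) rfl (Runs.instr ?_)
    have hr0 (k : ℕ) : rcell (3 * (L * T)) 0 k ≠ 0 := by simp [rcell]
    refine ⟨?_, ?_, ?_, ?_, ?_, ?_, ?_⟩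
    · simp [Instr.apply, f2]
    · simp [Instr.apply, f3]
    · simp [Instr.apply, f4]
    · simp [Instr.apply, f4, f6]
    · intro e he hd
      simp [Instr.apply, f8 e he hd]
    · intro i hi hi'
      have : i ≠ rcell (3 * (L * T)) 0 j := by
        simp only [rcell]
        omega
      simp [Instr.apply, this, f9 i (by omega) hi', show i ≠ 0 by omega]
    · intro i hi
      rcases Nat.lt_succ_iff_lt_or_eq.1 hi with hi | rfl
      · simp [Instr.apply, f10 i hi, hi.ne, hr0]
      · simp [Instr.apply, f6, f9 i le_rfl hj]
  · rintro s2 ⟨f2, f3, f4, f6, f8, f9, f10⟩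
    simp [Test.Holds, f3, f6]
  · refine ⟨?_, ?_, ?_, ?_, ?_, ?_, by simp⟩
    · simp [Instr.apply, g2]
    · simp [Instr.apply, g3]
    · simp [Instr.apply, g4]
    · simp [Instr.apply]
    · intro e he hd
      simp [Instr.apply, g8 e he hd]
    · intro i _ _
      simp [Instr.apply, g7]
  · rintro s2 ⟨f2, f3, f4, f6, f8, f9, f10⟩
    exact ⟨f2, f3, f8, f10⟩

/-- Copy the array `r 4` and the first entry of the array `i 2` to the output registers. -/
def finalProg (L : ℕ) : Prog :=
  .cons (.iconst (tmp L 1) 1) <|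
  .cons (.iconst (tmp L 2) (2 * L)) <|
  .cons (.imul (tmp L 2) (tmp L 2) (cell L 11 0)) <|
  .cons (.iconst (tmp L 4) 16) <|
  .cons (.iconst (tmp L 5) 5) <|
  .cons (.iconst (cnt L 0) 0) <|
  .seq (.loop (.ilt (cnt L 0) (tmp L 2)) <|
      .cons (.iadd (tmp L 3) (cnt L 0) (cell L 11 1)) <|
      .cons (.imul (tmp L 3) (tmp L 3) (tmp L 4)) <|
      .cons (.iadd (tmp L 3) (tmp L 3) (tmp L 5)) <|
      .cons (.rload 0 (tmp L 3)) <|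
      .cons (.rstore (cnt L 0) 0) <|
      .instr (.iadd (cnt L 0) (cnt L 0) (tmp L 1))) <|
  .cons (.imul (tmp L 3) (cell L 11 1) (tmp L 4)) <|
  .cons (.iadd (tmp L 3) (tmp L 3) (tmp L 5)) <|
  .cons (.rload 0 (tmp L 3)) <|
  .instr (.icopy 0 (cell L (arrayClass 2) 0))

theorem runs_finalProg (L : ℕ) [NeZero L] : ∃ p : Polynomial ℕ, ∀ (O : ℕ → ℝ → ℝ) (T : ℕ)
    (h : Mem) (s : State), Enc L T h s → Runs O (finalProg L) s (p.eval T) fun s' =>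
      s'.idx 0 = h.i 2 0 ∧ ∀ j < 2 * L * T, s'.real j = h.r 4 j := by
  refine ⟨6 + ((2 * L * .X * 7 + 1) + 4), fun O T h s he => ?_⟩
  refine Runs.mono (b := 2 * L * T * (6 + 1) + 1 + 4 + 6)
    ?_ (by simp; omega) fun _ => id
  iterate 6 refine Runs.cons ?_
  refine Runs.seq (b := 2 * L * T * (6 + 1) + 1) (b' := 4) ?_
  have hrc (k j : ℕ) (hj : j < 2 * L * T) : rcell (3 * (L * T)) 4 k ≠ j := by
    rw [mul_assoc] at hj
    simp only [rcell]
    omega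
  have hr0 (k : ℕ) : rcell (3 * (L * T)) 4 k ≠ 0 := by simp [rcell]
  refine (Runs.loop (fun j s' => s'.idx (cell L 11 1) = 3 * (L * T) ∧
    s'.idx (tmp L 1) = 1 ∧ s'.idx (tmp L 2) = 2 * L * T ∧ s'.idx (tmp L 4) = 16 ∧
    s'.idx (tmp L 5) = 5 ∧ s'.idx (cnt L 0) = j ∧ s'.idx (cell L (arrayClass 2) 0) = h.i 2 0 ∧
    (∀ k, s'.real (rcell (3 * (L * T)) 4 k) = h.r 4 k) ∧
    -- Output register `0` is also the transfer register, so its final value is written only after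
    -- the loop.
    ∀ i < j, i ≠ 0 → s'.real i = h.r 4 i) (2 * L * T) ?_ ?_ ?_).mono le_rfl ?_
  · rintro j hj s1 ⟨g1, g2, g3, g4, g5, g6, g7, g8, g9⟩
    refine ⟨by simpa [Test.Holds, g3, g6] using hj, ?_⟩
    iterate 4 refine Runs.cons ?_
    have ha : (j + 3 * (L * T)) * 16 + 5 = rcell (3 * (L * T)) 4 j := by
      simp only [rcell, show ((4 : Fin 8) : ℕ) = 4 from rfl]
      ring
    refine Runs.cons_rstore (r := j) (v := h.r 4 j) (by simp [Instr.apply, g6])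
      (by simp [Instr.apply, g6, g1, g4, g5, ha, g8]) (Runs.instr ?_)
    refine ⟨?_, ?_, ?_, ?_, ?_, ?_, ?_, ?_, ?_⟩
    · simp [Instr.apply, g1]
    · simp [Instr.apply, g2]
    · simp [Instr.apply, g3]
    · simp [Instr.apply, g4]
    · simp [Instr.apply, g5]
    · simp [Instr.apply, g2, g6]
    · simp [Instr.apply, g7]
    · intro k
      simp [Instr.apply, g8, hrc k j hj, hr0]
    · intro i hi hi0
      rcases Nat.lt_succ_iff_lt_or_eq.1 hi with hi | rfl
      · simp [Instr.apply, g9 i hi hi0, hi.ne, hi0]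
      · simp [Instr.apply]
  · rintro s1 ⟨g1, g2, g3, g4, g5, g6, g7, g8, g9⟩
    simp [Test.Holds, g3, g6]
  · refine ⟨?_, ?_, ?_, ?_, ?_, ?_, ?_, fun k => ?_, by simp⟩
    · simp [Instr.apply, he.base]
    · simp [Instr.apply]
    · simp [Instr.apply, he.par]
    · simp [Instr.apply]
    · simp [Instr.apply]
    · simp [Instr.apply]
    · simp [Instr.apply, he.i]
    · simp [Instr.apply, he.r]
  rintro s1 ⟨g1, g2, g3, g4, g5, g6, g7, g8, g9⟩
  iterate 3 refine Runs.cons ?_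
  refine Runs.instr ⟨?_, ?_⟩
  · simp [Instr.apply, g7]
  · intro j hj
    rcases eq_or_ne j 0 with rfl | h0
    · have ha : 3 * (L * T) * 16 + 5 = rcell (3 * (L * T)) 4 0 := by
        simp only [rcell, show ((4 : Fin 8) : ℕ) = 4 from rfl]
        ring
      simp [Instr.apply, g1, g4, g5, ha, g8]
    · simp [Instr.apply, h0, g9 j hj h0]

end RealRAM

/-! ### Arcs, and sums over arcs, in terms of arc numbers. -/

namespace GridArc

variable {L T : ℕ}

def down (l t : ℕ) (hl : l + 1 < L) (ht : t < T) : GridArc L T :=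
  ⟨((⟨l, by omega⟩, ⟨t, ht⟩), (⟨l + 1, hl⟩, ⟨t, ht⟩)), .inl ⟨rfl, rfl⟩⟩

def fwd (l t : ℕ) (hl : l < L) (ht : t + 1 < T) : GridArc L T :=
  ⟨((⟨l, hl⟩, ⟨t, by omega⟩), (⟨l, hl⟩, ⟨t + 1, ht⟩)), .inr ⟨rfl, rfl⟩⟩

theorem eq_down_or_fwd (a : GridArc L T) :
    (∃ l t hl ht, a = down l t hl ht) ∨ ∃ l t hl ht, a = fwd l t hl ht := by
  obtain ⟨⟨⟨⟨l, hl⟩, ⟨t, ht⟩⟩, ⟨⟨l', hl'⟩, ⟨t', ht'⟩⟩⟩, h⟩ := a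
  simp only [Fin.ext_iff] at h
  rcases h with ⟨rfl, rfl⟩ | ⟨rfl, rfl⟩
  · exact .inl ⟨l, t, hl', ht, rfl⟩
  · exact .inr ⟨l, t, hl, ht', rfl⟩

theorem arcNumber_down (l t : ℕ) (hl : l + 1 < L) (ht : t < T) :
    arcNumber (down l t hl ht) = 2 * (L * t + l) := by
  simp [arcNumber, vertexNumber, down]

theorem arcNumber_fwd (l t : ℕ) (hl : l < L) (ht : t + 1 < T) :
    arcNumber (fwd l t hl ht) = 2 * (L * t + l) + 1 := by
  simp [arcNumber, vertexNumber, fwd]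

end GridArc

theorem mul_add_eq_mul_add_iff {L l l' t t' : ℕ} (hl : l < L) (hl' : l' < L) :
    L * t + l = L * t' + l' ↔ l = l' ∧ t = t' := by
  constructor
  · intro h
    have h1 : l = l' := by
      have := congrArg (· % L) h
      simpa [Nat.mul_add_mod, Nat.mod_eq_of_lt hl, Nat.mod_eq_of_lt hl'] using this
    subst h1
    exact ⟨rfl, Nat.eq_of_mul_eq_mul_left (by omega) (Nat.add_right_cancel h)⟩
  · rintro ⟨rfl, rfl⟩
    rfl

theorem mul_add_lt_mul {L T l t : ℕ} (hl : l < L) (ht : t < T) : L * t + l < L * T :=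
  calc L * t + l < L * (t + 1) := by rw [Nat.mul_succ]; omega
    _ ≤ L * T := Nat.mul_le_mul_left _ ht

section ByNumber

variable {L T : ℕ} (F : GridArc L T → ℝ)

/-- A function on the arcs as a function of the number of the arc. -/
noncomputable def byNumber (e : ℕ) : ℝ := Function.extend arcNumber F 0 e

theorem byNumber_arcNumber (a : GridArc L T) : byNumber F (arcNumber a) = F a :=
  (arcNumber_injective L T).extend_apply _ _ _

theorem arcNumber_ne_even {l t : ℕ} (hl : l + 1 = L) (a : GridArc L T) :
    arcNumber a ≠ 2 * (L * t + l) := by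
  rcases a.eq_down_or_fwd with ⟨l', t', hl', ht', rfl⟩ | ⟨l', t', hl', ht', rfl⟩
  · rw [GridArc.arcNumber_down]
    intro h
    have := (mul_add_eq_mul_add_iff (L := L) (by omega) (by omega)).1
      (Nat.eq_of_mul_eq_mul_left two_pos h)
    omega
  · rw [GridArc.arcNumber_fwd]
    omega

theorem arcNumber_ne_odd {l t : ℕ} (hl : l < L) (ht : t + 1 = T) (a : GridArc L T) :
    arcNumber a ≠ 2 * (L * t + l) + 1 := by
  rcases a.eq_down_or_fwd with ⟨l', t', hl', ht', rfl⟩ | ⟨l', t', hl', ht', rfl⟩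
  · rw [GridArc.arcNumber_down]
    omega
  · rw [GridArc.arcNumber_fwd]
    intro h
    have := (mul_add_eq_mul_add_iff (t := t') (t' := t) hl' hl).1 (by omega)
    omega

theorem byNumber_even_last {l t : ℕ} (hl : l + 1 = L) : byNumber F (2 * (L * t + l)) = 0 :=
  Function.extend_apply' _ _ _ fun ⟨a, ha⟩ => arcNumber_ne_even hl a ha

theorem byNumber_odd_last {l t : ℕ} (hl : l < L) (ht : t + 1 = T) :
    byNumber F (2 * (L * t + l) + 1) = 0 :=
  Function.extend_apply' _ _ _ fun ⟨a, ha⟩ => arcNumber_ne_odd hl ht a ha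

/-- The arcs that leave vertex number `i` have the numbers `2 * i` and `2 * i + 1`. In the last row
or column one of them is missing; there `byNumber` has the default value `0`, which keeps the
formula uniform. -/
theorem sum_tail_eq (v : GridVertex L T) : ∑ a with a.tail = v, F a =
    byNumber F (2 * (L * v.2 + v.1)) + byNumber F (2 * (L * v.2 + v.1) + 1) := by
  rw [← Finset.sum_pair (f := byNumber F) (by omega : 2 * (L * (v.2 : ℕ) + v.1) ≠ _)]
  simp_rw [← byNumber_arcNumber F]
  rw [← Finset.sum_image (f := byNumber F) (g := arcNumber)
    fun a _ b _ h => arcNumber_injective L T h]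
  refine Finset.sum_subset ?_ ?_
  · intro e he
    simp only [Finset.mem_image, Finset.mem_filter, Finset.mem_univ, true_and] at he
    obtain ⟨a, rfl, rfl⟩ := he
    simp only [arcNumber, vertexNumber, Finset.mem_insert, Finset.mem_singleton]
    split_ifs <;> simp
  · intro e he he'
    refine Function.extend_apply' _ _ _ fun ⟨a, ha⟩ => he' ?_
    simp only [Finset.mem_image, Finset.mem_filter, Finset.mem_univ, true_and]
    refine ⟨a, vertexNumber_injective L T ?_, ha⟩
    subst ha
    simp only [arcNumber, Finset.mem_insert, Finset.mem_singleton] at he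
    simp only [vertexNumber] at he ⊢
    split_ifs at he <;> omega

theorem sum_head_eq (v : GridVertex L T) : ∑ a with a.head = v, F a =
    (if (v.1 : ℕ) = 0 then 0 else byNumber F (2 * (L * v.2 + (v.1 - 1)))) +
      if (v.2 : ℕ) = 0 then 0 else byNumber F (2 * (L * (v.2 - 1) + v.1) + 1) := by
  obtain ⟨⟨l, hl⟩, ⟨t, ht⟩⟩ := v
  have key : (Finset.univ.filter fun a : GridArc L T => a.head = (⟨l, hl⟩, ⟨t, ht⟩)) =
      (if h : l = 0 then ∅ else {GridArc.down (l - 1) t (by omega) ht}) ∪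
      (if h : t = 0 then ∅ else {GridArc.fwd l (t - 1) hl (by omega)}) := by
    ext a
    simp only [Finset.mem_filter, Finset.mem_univ, true_and, Finset.mem_union]
    constructor
    · rcases a.eq_down_or_fwd with ⟨l', t', hl', ht', rfl⟩ | ⟨l', t', hl', ht', rfl⟩
      · intro h
        simp only [GridArc.down, GridArc.head, Prod.mk.injEq, Fin.mk.injEq] at h
        obtain ⟨rfl, rfl⟩ := h
        left
        simp
      · intro h
        simp only [GridArc.fwd, GridArc.head, Prod.mk.injEq, Fin.mk.injEq] at h
        obtain ⟨rfl, rfl⟩ := h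
        right
        simp
    · rintro (h | h)
      · split_ifs at h with h0
        · simp at h
        · obtain rfl := Finset.mem_singleton.1 h
          simp only [GridArc.down, GridArc.head, Prod.mk.injEq, Fin.mk.injEq, and_true]
          omega
      · split_ifs at h with h0
        · simp at h
        · obtain rfl := Finset.mem_singleton.1 h
          simp only [GridArc.fwd, GridArc.head, Prod.mk.injEq, Fin.mk.injEq, true_and]
          omega
  rw [key, Finset.sum_union]
  · congr 1
    · split_ifs with h
      · simp
      · rw [Finset.sum_singleton, ← byNumber_arcNumber F, GridArc.arcNumber_down]
    · split_ifs with h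
      · simp
      · rw [Finset.sum_singleton, ← byNumber_arcNumber F, GridArc.arcNumber_fwd]
  · split_ifs with h1 h2
    · simp
    · simp
    · simp
    · rw [Finset.disjoint_singleton]
      intro h
      have := congrArg arcNumber h
      rw [GridArc.arcNumber_down, GridArc.arcNumber_fwd] at this
      omega

theorem sum_arc_eq : ∑ a, F a = ∑ t ∈ Finset.range T, ∑ l ∈ Finset.range L,
    (byNumber F (2 * (L * t + l)) + byNumber F (2 * (L * t + l) + 1)) := by
  rw [← Finset.sum_fiberwise Finset.univ (fun a : GridArc L T => a.tail) F]
  simp_rw [sum_tail_eq]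
  rw [Fintype.sum_prod_type_right, Finset.sum_range]
  refine Finset.sum_congr rfl fun t _ => ?_
  rw [Finset.sum_range]

end ByNumber

/-! ### Flows as stream functions. -/

namespace MFG

variable {L T : ℕ} (I : MFG L T)

theorem oracle_byNumber (x : GridArc L T → ℝ) (e : ℕ) :
    I.oracle e (byNumber x e) = byNumber (fun a => I.cost a (x a)) e := by
  by_cases h : ∃ a : GridArc L T, arcNumber a = e
  · obtain ⟨a, rfl⟩ := h
    rw [byNumber_arcNumber, byNumber_arcNumber, oracle, (arcNumber_injective L T).extend_apply]
  · rw [oracle, Function.extend_apply' _ _ _ h]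
    exact (Function.extend_apply' _ _ _ h).symm

theorem totalCost_eq (x : GridArc L T → ℝ) : I.totalCost x =
    ∑ t ∈ Finset.range T, ∑ l ∈ Finset.range L,
      (I.oracle (2 * (L * t + l)) (byNumber x (2 * (L * t + l))) +
        I.oracle (2 * (L * t + l) + 1) (byNumber x (2 * (L * t + l) + 1))) := by
  simp only [totalCost, sum_arc_eq, oracle_byNumber]

/-- The supply of the vertex in row `l` and column `t`. -/
def supplyAt (l t : ℕ) : ℤ :=
  if h : l < L ∧ t < T then I.supply (⟨l, h.1⟩, ⟨t, h.2⟩) else 0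

/-- The total supply in the first `t` columns of row `l`. -/
def rowSum (l t : ℕ) : ℝ := ∑ j ∈ Finset.range t, (I.supplyAt l j : ℝ)

theorem rowSum_succ (v : GridVertex L T) :
    I.rowSum v.1 (v.2 + 1) = I.rowSum v.1 v.2 + I.supply v := by
  rw [rowSum, Finset.sum_range_succ, ← rowSum, supplyAt, dif_pos ⟨v.1.2, v.2.2⟩]

/-- The flow with stream function `φ`: here `φ l t` is the total flow on the first `t` of the arcs
that enter row `l` from above. -/
def streamFlow (φ : ℕ → ℕ → ℝ) (a : GridArc L T) : ℝ :=
  if a.tail.1 = a.head.1 then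
    φ a.head.1 a.head.2 - φ (a.head.1 + 1) a.head.2 + I.rowSum a.head.1 a.head.2
  else φ a.head.1 (a.head.2 + 1) - φ a.head.1 a.head.2

/-- The boundary conditions for the stream function of a flow that meets the supplies. -/
structure IsStream (φ : ℕ → ℕ → ℝ) : Prop where
  top : ∀ t, φ 0 t = 0
  bottom : ∀ t, φ L t = 0
  left : ∀ l, φ l 0 = 0
  right : ∀ l < L, φ l T - φ (l + 1) T + I.rowSum l T = 0

variable {I}

theorem streamFlow_down (φ : ℕ → ℕ → ℝ) (l t : ℕ) (hl : l + 1 < L) (ht : t < T) :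
    I.streamFlow φ (.down l t hl ht) = φ (l + 1) (t + 1) - φ (l + 1) t := by
  simp [streamFlow, GridArc.down]

theorem streamFlow_fwd (φ : ℕ → ℕ → ℝ) (l t : ℕ) (hl : l < L) (ht : t + 1 < T) :
    I.streamFlow φ (.fwd l t hl ht) =
      φ l (t + 1) - φ (l + 1) (t + 1) + I.rowSum l (t + 1) := by
  simp [streamFlow, GridArc.fwd]

namespace IsStream

variable {φ : ℕ → ℕ → ℝ}

theorem byNumber_even (h : I.IsStream φ) {l t : ℕ} (hl : l < L) (ht : t < T) :
    byNumber (I.streamFlow φ) (2 * (L * t + l)) = φ (l + 1) (t + 1) - φ (l + 1) t := by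
  by_cases hl' : l + 1 < L
  · rw [← GridArc.arcNumber_down l t hl' ht, byNumber_arcNumber, streamFlow_down]
  · obtain rfl : l + 1 = L := by omega
    rw [byNumber_even_last _ rfl, h.bottom, h.bottom, sub_zero]

theorem byNumber_odd (h : I.IsStream φ) {l t : ℕ} (hl : l < L) (ht : t < T) :
    byNumber (I.streamFlow φ) (2 * (L * t + l) + 1) =
      φ l (t + 1) - φ (l + 1) (t + 1) + I.rowSum l (t + 1) := by
  by_cases ht' : t + 1 < T
  · rw [← GridArc.arcNumber_fwd l t hl ht', byNumber_arcNumber, streamFlow_fwd]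
  · have ht2 : t + 1 = T := by omega
    rw [byNumber_odd_last _ hl ht2, ht2, h.right l hl]

/-- The values of `φ` at the four corners around the vertex cancel; what is left is the increment of
the row sum, which is the supply. -/
theorem conservation (h : I.IsStream φ) (v : GridVertex L T) :
    ∑ a with a.tail = v, I.streamFlow φ a - ∑ a with a.head = v, I.streamFlow φ a =
      (I.supply v : ℝ) := by
  rw [sum_tail_eq, sum_head_eq, h.byNumber_even v.1.2 v.2.2, h.byNumber_odd v.1.2 v.2.2,
    I.rowSum_succ v]
  have h1 : (if (v.1 : ℕ) = 0 then 0 else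
      byNumber (I.streamFlow φ) (2 * (L * v.2 + (v.1 - 1)))) = φ v.1 (v.2 + 1) - φ v.1 v.2 := by
    split_ifs with h0
    · rw [h0, h.top, h.top, sub_zero]
    · rw [h.byNumber_even (by omega) v.2.2, Nat.sub_add_cancel (by omega)]
  have h2 : (if (v.2 : ℕ) = 0 then 0 else
      byNumber (I.streamFlow φ) (2 * (L * (v.2 - 1) + v.1) + 1)) =
        φ v.1 v.2 - φ (v.1 + 1) v.2 + I.rowSum v.1 v.2 := by
    split_ifs with h0
    · simp [h0, h.left, rowSum]
    · rw [h.byNumber_odd v.1.2 (by omega), Nat.sub_add_cancel (by omega)]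
  rw [h1, h2]
  ring

theorem isFeasible_iff (h : I.IsStream φ) :
    I.IsFeasible (I.streamFlow φ) ↔ ∀ a, I.streamFlow φ a ∈ capInterval (I.cap a) :=
  ⟨fun h' => h'.2, fun h' => ⟨h.conservation, h'⟩⟩

end IsStream

/-- The stream function of a flow. -/
noncomputable def stream (x : GridArc L T → ℝ) : ℕ → ℕ → ℝ
  | 0, _ => 0
  | l + 1, t => ∑ j ∈ Finset.range t, byNumber x (2 * (L * j + l))

/-- This is the balance of the first `t` vertices of row `l`: what enters from above, minus what
leaves below, plus the supply, must use the one remaining exit, the forward arc into column `t`. The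
induction adds one vertex at a time. -/
theorem IsFeasible.stream_sub {x : GridArc L T → ℝ} (hx : I.IsFeasible x) {l : ℕ} (hl : l < L) :
    ∀ t ≤ T, stream x l t - stream x (l + 1) t + I.rowSum l t =
      if t = 0 then 0 else byNumber x (2 * (L * (t - 1) + l) + 1) := by
  intro t
  induction t with
  | zero =>
    intro _
    cases l <;> simp [stream, rowSum]
  | succ t ih =>
    intro ht
    have h1 := ih (by omega)
    have h2 := hx.1 (⟨l, hl⟩, ⟨t, ht⟩)
    have h3 := I.rowSum_succ (⟨l, hl⟩, ⟨t, ht⟩)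
    rw [sum_tail_eq, sum_head_eq] at h2
    simp only at h2 h3
    have h4 : stream x (l + 1) (t + 1) = stream x (l + 1) t + byNumber x (2 * (L * t + l)) := by
      simp [stream, Finset.sum_range_succ]
    have h5 : stream x l (t + 1) = stream x l t +
        if l = 0 then 0 else byNumber x (2 * (L * t + (l - 1))) := by
      cases l <;> simp [stream, Finset.sum_range_succ]
    rw [h3, h4, h5, if_neg (Nat.succ_ne_zero t), Nat.add_sub_cancel]
    linarith

theorem IsFeasible.isStream {x : GridArc L T → ℝ} (hx : I.IsFeasible x) (hL : 0 < L) (hT : 0 < T) :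
    I.IsStream (stream x) where
  top _ := rfl
  bottom t := by
    obtain ⟨l, rfl⟩ : ∃ l, L = l + 1 := ⟨L - 1, by omega⟩
    exact Finset.sum_eq_zero fun j _ => byNumber_even_last x rfl
  left l := by cases l <;> simp [stream]
  right l hl := by
    rw [hx.stream_sub hl T le_rfl, if_neg (by omega), byNumber_odd_last x hl (by omega)]

theorem IsFeasible.streamFlow_stream {x : GridArc L T → ℝ} (hx : I.IsFeasible x) :
    I.streamFlow (stream x) = x := by
  funext a
  rcases a.eq_down_or_fwd with ⟨l, t, hl, ht, rfl⟩ | ⟨l, t, hl, ht, rfl⟩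
  · rw [streamFlow_down, ← byNumber_arcNumber x, GridArc.arcNumber_down]
    simp [stream, Finset.sum_range_succ]
  · rw [streamFlow_fwd, ← byNumber_arcNumber x, GridArc.arcNumber_fwd,
      hx.stream_sub hl _ (by omega)]
    simp

end MFG

/-! ### Concave costs: reducing the number of free arcs. -/

namespace MFG

variable {L T : ℕ} {I : MFG L T}

/-- The flow value on `a` is strictly between its bounds. -/
def IsFree (I : MFG L T) (x : GridArc L T → ℝ) (a : GridArc L T) : Prop :=
  0 < x a ∧ ∀ k : ℕ, I.cap a = k → x a < k

theorem eq_zero_or_eq_cap_of_not_isFree {x : GridArc L T → ℝ} {a : GridArc L T}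
    (hx : x a ∈ capInterval (I.cap a)) (h : ¬ I.IsFree x a) :
    x a = 0 ∨ ∃ k : ℕ, I.cap a = k ∧ x a = k := by
  by_cases h0 : 0 < x a
  · right
    simp only [IsFree, not_and, not_forall, not_lt] at h
    obtain ⟨k, hk, hk'⟩ := h h0
    exact ⟨k, hk, le_antisymm (hx.2 k hk) hk'⟩
  · exact .inl (le_antisymm (not_lt.1 h0) hx.1)

/-- The number of arcs with flow strictly between the bounds. -/
noncomputable def freeCount (I : MFG L T) (x : GridArc L T → ℝ) : ℕ := {a | I.IsFree x a}.ncard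

/-- The flow is moved along `z` until the first free arc hits a bound. A negative entry of `z` makes
the step finite even if all capacities are infinite. Arcs that were not free keep their values, so
the number of free arcs drops. -/
theorem exists_maximal_step {x z : GridArc L T → ℝ} (hx : ∀ a, x a ∈ capInterval (I.cap a))
    (hz : ∀ a, z a ≠ 0 → I.IsFree x a) (hneg : ∃ a, z a < 0) :
    ∃ β : ℝ, 0 < β ∧ (∀ a, (x + β • z) a ∈ capInterval (I.cap a)) ∧
      I.freeCount (x + β • z) < I.freeCount x := by
  classical
  -- The arcs that limit the step: those with decreasing flow, and those with increasing flow and a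
  -- finite capacity.
  let S : Finset (GridArc L T) := Finset.univ.filter fun a => z a < 0 ∨ (0 < z a ∧ I.cap a ≠ ⊤)
  let slack (a : GridArc L T) : ℝ :=
    if z a < 0 then x a / (-z a) else (((I.cap a).toNat : ℝ) - x a) / z a
  have hcap {a : GridArc L T} (h : I.cap a ≠ ⊤) : I.cap a = ((I.cap a).toNat : ℕ∞) :=
    (ENat.natCast_toNat h).symm
  have hpos : ∀ a ∈ S, 0 < slack a := by
    intro a ha
    simp only [S, Finset.mem_filter, Finset.mem_univ, true_and] at ha
    by_cases h : z a < 0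
    · simp only [slack, if_pos h]
      exact div_pos (hz a h.ne).1 (by linarith)
    · obtain ⟨h1, h2⟩ := ha.resolve_left h
      simp only [slack, if_neg h]
      have := (hz a h1.ne').2 _ (hcap h2)
      exact div_pos (by linarith) h1
  have hS : S.Nonempty := by
    obtain ⟨a, ha⟩ := hneg
    exact ⟨a, by simp [S, ha]⟩
  obtain ⟨a₀, ha₀, hmin⟩ := S.exists_min_image slack hS
  have hβ := hpos a₀ ha₀
  refine ⟨slack a₀, hβ, fun a => ?_, ?_⟩
  · simp only [Pi.add_apply, Pi.smul_apply, smul_eq_mul]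
    rcases lt_trichotomy (z a) 0 with h | h | h
    · have h1 := hmin a (by simp [S, h])
      rw [show slack a = _ from if_pos h, le_div_iff₀ (by linarith)] at h1
      refine ⟨by linarith, fun k hk => ?_⟩
      have := (hz a h.ne).2 k hk
      nlinarith
    · simpa [h] using hx a
    · refine ⟨by have := (hx a).1; positivity, fun k hk => ?_⟩
      have h1 := hmin a (by simp [S, h, hk])
      rw [show slack a = _ from if_neg h.not_gt, hk, ENat.toNat_natCast, le_div_iff₀ h] at h1
      linarith
  · refine Set.ncard_lt_ncard ⟨fun a ha => ?_, fun h => ?_⟩ (Set.toFinite _)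
    · by_cases h : z a = 0
      · simpa [IsFree, h] using ha
      · exact hz a h
    · have hz0 : z a₀ ≠ 0 := by
        simp only [S, Finset.mem_filter, Finset.mem_univ, true_and] at ha₀
        rcases ha₀ with h | h
        · exact h.ne
        · exact h.1.ne'
      have hf : I.IsFree (x + slack a₀ • z) a₀ := h (hz a₀ hz0)
      simp only [IsFree, Pi.add_apply, Pi.smul_apply, smul_eq_mul] at hf
      simp only [S, Finset.mem_filter, Finset.mem_univ, true_and] at ha₀
      by_cases h : z a₀ < 0
      · have h1 := hf.1
        simp only [slack, if_pos h] at h1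
        rw [div_neg, neg_mul, div_mul_cancel₀ _ hz0] at h1
        linarith
      · have h1 := hf.2 _ (hcap (ha₀.resolve_left h).2)
        simp only [slack, if_neg h] at h1
        rw [div_mul_cancel₀ _ hz0] at h1
        linarith

/-- The point `x` is the convex combination of the two moved points with weights `α / (α + β)` and
`β / (α + β)`; by concavity both cannot be more expensive than `x`. -/
theorem totalCost_le_of_opposite {x z : GridArc L T → ℝ} {α β : ℝ} (hα : 0 < α) (hβ : 0 < β)
    (h₁ : ∀ a, (x + β • z) a ∈ capInterval (I.cap a))
    (h₂ : ∀ a, (x + α • (-z)) a ∈ capInterval (I.cap a)) :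
    I.totalCost (x + β • z) ≤ I.totalCost x ∨ I.totalCost (x + α • (-z)) ≤ I.totalCost x := by
  have hs : 0 < α + β := by positivity
  have key : α / (α + β) * I.totalCost (x + β • z) +
      β / (α + β) * I.totalCost (x + α • (-z)) ≤ I.totalCost x := by
    simp only [totalCost, Finset.mul_sum, ← Finset.sum_add_distrib]
    refine Finset.sum_le_sum fun a _ => ?_
    have := (I.concave a).2 (h₁ a) (h₂ a) (div_nonneg hα.le hs.le) (div_nonneg hβ.le hs.le)
      (by field_simp)
    simp only [smul_eq_mul] at this
    refine this.trans (le_of_eq ?_)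
    congr 1
    simp only [Pi.add_apply, Pi.smul_apply, Pi.neg_apply, smul_eq_mul]
    field_simp
    ring
  by_contra! h
  have h1 := mul_lt_mul_of_pos_left h.1 (div_pos hα hs)
  have h2 := mul_lt_mul_of_pos_left h.2 (div_pos hβ hs)
  have h3 : α / (α + β) * I.totalCost x + β / (α + β) * I.totalCost x = I.totalCost x := by
    field_simp
  linarith

theorem exists_improving_step {x z : GridArc L T → ℝ} (hx : ∀ a, x a ∈ capInterval (I.cap a))
    (hz : ∀ a, z a ≠ 0 → I.IsFree x a) (hneg : ∃ a, z a < 0) (hpos : ∃ a, 0 < z a) :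
    ∃ s : ℝ, (∀ a, (x + s • z) a ∈ capInterval (I.cap a)) ∧
      I.totalCost (x + s • z) ≤ I.totalCost x ∧ I.freeCount (x + s • z) < I.freeCount x := by
  obtain ⟨β, hβ, h1, h2⟩ := exists_maximal_step hx hz hneg
  obtain ⟨α, hα, h3, h4⟩ := exists_maximal_step (z := -z) hx (fun a ha => hz a (by simpa using ha))
    (by simpa using hpos)
  rcases totalCost_le_of_opposite hα hβ h1 h3 with h | h
  · exact ⟨β, h1, h, h2⟩
  · have e : x + α • (-z) = x + (-α) • z := by simp
    rw [e] at h3 h4 h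
    exact ⟨-α, h3, h, h4⟩

open Classical in
/-- Raising the stream function on a region of the corners that is bounded by free arcs only leads
to a flow of no larger cost with fewer free arcs. -/
theorem exists_stream_of_region {φ : ℕ → ℕ → ℝ} (hφ : I.IsStream φ)
    (hx : ∀ a, I.streamFlow φ a ∈ capInterval (I.cap a)) (Z : ℕ → ℕ → Prop)
    (hZ : ∀ l t, Z l t → 0 < l ∧ l < L ∧ 0 < t ∧ t < T) (hne : ∃ l t, Z l t)
    (hdown : ∀ l t hl ht, ¬ I.IsFree (I.streamFlow φ) (.down l t hl ht) →
      (Z (l + 1) (t + 1) ↔ Z (l + 1) t))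
    (hfwd : ∀ l t hl ht, ¬ I.IsFree (I.streamFlow φ) (.fwd l t hl ht) →
      (Z l (t + 1) ↔ Z (l + 1) (t + 1))) :
    ∃ φ', I.IsStream φ' ∧ (∀ a, I.streamFlow φ' a ∈ capInterval (I.cap a)) ∧
      I.totalCost (I.streamFlow φ') ≤ I.totalCost (I.streamFlow φ) ∧
      I.freeCount (I.streamFlow φ') < I.freeCount (I.streamFlow φ) := by
  let ind (l t : ℕ) : ℝ := if Z l t then 1 else 0
  have hind {l t : ℕ} (h : ¬ (0 < l ∧ l < L ∧ 0 < t ∧ t < T)) : ind l t = 0 :=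
    if_neg fun h' => h (hZ l t h')
  -- The flow with stream function `ind` and no supplies: a circulation around the region.
  let z (a : GridArc L T) : ℝ :=
    if a.tail.1 = a.head.1 then ind a.head.1 a.head.2 - ind (a.head.1 + 1) a.head.2
    else ind a.head.1 (a.head.2 + 1) - ind a.head.1 a.head.2
  have hzd (l t : ℕ) (hl : l + 1 < L) (ht : t < T) :
      z (.down l t hl ht) = ind (l + 1) (t + 1) - ind (l + 1) t := by
    simp [z, GridArc.down]
  have hzf (l t : ℕ) (hl : l < L) (ht : t + 1 < T) :
      z (.fwd l t hl ht) = ind l (t + 1) - ind (l + 1) (t + 1) := by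
    simp [z, GridArc.fwd]
  have hadd (s : ℝ) : I.streamFlow (fun l t => φ l t + s * ind l t) = I.streamFlow φ + s • z := by
    funext a
    simp only [streamFlow, z, Pi.add_apply, Pi.smul_apply, smul_eq_mul]
    split_ifs <;> ring
  have hfree : ∀ a, z a ≠ 0 → I.IsFree (I.streamFlow φ) a := by
    intro a ha
    by_contra hf
    rcases a.eq_down_or_fwd with ⟨l, t, hl, ht, rfl⟩ | ⟨l, t, hl, ht, rfl⟩
    · rw [hzd] at ha
      simp [ind, hdown l t hl ht hf] at ha
    · rw [hzf] at ha
      simp [ind, hfwd l t hl ht hf] at ha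
  obtain ⟨l, t, hlt⟩ := hne
  obtain ⟨hl0, hlL, ht0, htT⟩ := hZ l t hlt
  obtain ⟨t, rfl⟩ : ∃ t', t = t' + 1 := ⟨t - 1, by omega⟩
  -- In the column of a corner of the region, the forward arcs crossed when leaving the region
  -- downwards and upwards carry `z` with opposite signs. If one sign were absent, the region would
  -- extend to row `L` or to row `0`.
  have hpos : ∃ a, 0 < z a := by
    by_contra! h
    have : ∀ n, l + n ≤ L → Z (l + n) (t + 1) := by
      intro n
      induction n with
      | zero => exact fun _ => hlt
      | succ n ih =>
        intro hn
        have h1 := ih (by omega)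
        have h2 := h (.fwd (l + n) t (by omega) htT)
        rw [hzf] at h2
        by_contra h3
        rw [← add_assoc] at h3
        simp [ind, h1, h3] at h2
        linarith
    have := (hZ _ _ (this (L - l) (by omega))).2.1
    omega
  have hneg : ∃ a, z a < 0 := by
    by_contra! h
    have : ∀ n ≤ l, Z (l - n) (t + 1) := by
      intro n
      induction n with
      | zero => exact fun _ => hlt
      | succ n ih =>
        intro hn
        have h1 := ih (by omega)
        have h2 := h (.fwd (l - (n + 1)) t (by omega) htT)
        rw [hzf, show l - (n + 1) + 1 = l - n by omega] at h2
        by_contra h3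
        simp [ind, h1, h3] at h2
        linarith
    have := (hZ _ _ (this l le_rfl)).1
    omega
  obtain ⟨s, h1, h2, h3⟩ := exists_improving_step hx hfree hneg hpos
  refine ⟨fun l t => φ l t + s * ind l t, ⟨fun t => ?_, fun t => ?_, fun l => ?_, fun l hl => ?_⟩,
    by rwa [hadd], by rwa [hadd], by rwa [hadd]⟩
  · rw [hφ.top, hind (by omega)]
    simp
  · rw [hφ.bottom, hind (by omega)]
    simp
  · rw [hφ.left, hind (by omega)]
    simp
  · rw [hind (by omega), hind (by omega)]
    simpa using hφ.right l hl

/-- The corners are the arguments of stream functions. -/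
abbrev Corner (L T : ℕ) : Type := Fin (L + 1) × Fin (T + 1)

/-- Two corners are adjacent if they are separated by an arc that is not free. -/
def cornerGraph (I : MFG L T) (x : GridArc L T → ℝ) : SimpleGraph (Corner L T) :=
  SimpleGraph.fromRel fun c d =>
    (∃ l t hl ht, ¬ I.IsFree x (.down l t hl ht) ∧ (c.1 : ℕ) = l + 1 ∧ (c.2 : ℕ) = t ∧
      (d.1 : ℕ) = l + 1 ∧ (d.2 : ℕ) = t + 1) ∨
    ∃ l t hl ht, ¬ I.IsFree x (.fwd l t hl ht) ∧ (c.1 : ℕ) = l ∧ (c.2 : ℕ) = t + 1 ∧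
      (d.1 : ℕ) = l + 1 ∧ (d.2 : ℕ) = t + 1

/-- The corners outside the region between rows `r₁` and `r₂`, or at its left or right end. -/
def IsOuter (r₁ r₂ : ℕ) (c : Corner L T) : Prop :=
  (c.1 : ℕ) ≤ r₁ ∨ r₂ < c.1 ∨ (c.2 : ℕ) = 0 ∨ (c.2 : ℕ) = T

/-- The corners from which no outer corner can be reached form a union of components of
`cornerGraph`, so only free arcs separate them from the rest. While this set is nonempty,
`exists_stream_of_region` applies and lowers the number of free arcs. -/
theorem exists_stream_reachable {r₁ r₂ : ℕ} (hr₂ : r₂ < L) {φ : ℕ → ℕ → ℝ}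
    (hφ : I.IsStream φ) (hx : ∀ a, I.streamFlow φ a ∈ capInterval (I.cap a)) :
    ∃ φ', I.IsStream φ' ∧ (∀ a, I.streamFlow φ' a ∈ capInterval (I.cap a)) ∧
      I.totalCost (I.streamFlow φ') ≤ I.totalCost (I.streamFlow φ) ∧
      ∀ c, ∃ d, IsOuter r₁ r₂ d ∧ (I.cornerGraph (I.streamFlow φ')).Reachable c d := by
  induction hn : I.freeCount (I.streamFlow φ) using Nat.strong_induction_on generalizing φ with
  | _ n ih =>
    by_cases h : ∀ c, ∃ d, IsOuter r₁ r₂ d ∧ (I.cornerGraph (I.streamFlow φ)).Reachable c d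
    · exact ⟨φ, hφ, hx, le_rfl, h⟩
    push Not at h
    obtain ⟨c, hc⟩ := h
    let G := I.cornerGraph (I.streamFlow φ)
    have hG {c d : Corner L T} (hcd : G.Adj c d) :
        (∀ e, IsOuter r₁ r₂ e → ¬ G.Reachable c e) ↔ ∀ e, IsOuter r₁ r₂ e → ¬ G.Reachable d e :=
      forall₂_congr fun e _ => not_congr
        ⟨fun h' => hcd.symm.reachable.trans h', fun h' => hcd.reachable.trans h'⟩
    let Z (l t : ℕ) : Prop := ∃ (hl : l < L + 1) (ht : t < T + 1),
      ∀ e : Corner L T, IsOuter r₁ r₂ e → ¬ G.Reachable (⟨l, hl⟩, ⟨t, ht⟩) e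
    have hZ {l t : ℕ} (hl : l < L + 1) (ht : t < T + 1) : Z l t ↔
        ∀ e : Corner L T, IsOuter r₁ r₂ e → ¬ G.Reachable (⟨l, hl⟩, ⟨t, ht⟩) e :=
      ⟨fun ⟨_, _, h'⟩ => h', fun h' => ⟨hl, ht, h'⟩⟩
    have hin : ∀ l t, Z l t → 0 < l ∧ l < L ∧ 0 < t ∧ t < T := by
      rintro l t ⟨hl, ht, h'⟩
      by_contra hlt
      refine h' _ ?_ (SimpleGraph.Reachable.refl _)
      simp only [IsOuter]
      omega
    have hdown : ∀ l t hl ht, ¬ I.IsFree (I.streamFlow φ) (.down l t hl ht) →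
        (Z (l + 1) (t + 1) ↔ Z (l + 1) t) := by
      intro l t hl ht hf
      rw [hZ (by omega) (by omega), hZ (by omega) (by omega)]
      refine hG (SimpleGraph.Adj.symm ?_)
      refine (SimpleGraph.fromRel_adj _ _ _).2 ?_
      exact ⟨by simp, .inl (.inl ⟨l, t, hl, ht, hf, rfl, rfl, rfl, rfl⟩)⟩
    have hfwd : ∀ l t hl ht, ¬ I.IsFree (I.streamFlow φ) (.fwd l t hl ht) →
        (Z l (t + 1) ↔ Z (l + 1) (t + 1)) := by
      intro l t hl ht hf
      rw [hZ (by omega) (by omega), hZ (by omega) (by omega)]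
      refine hG ?_
      refine (SimpleGraph.fromRel_adj _ _ _).2 ?_
      exact ⟨by simp, .inl (.inr ⟨l, t, hl, ht, hf, rfl, rfl, rfl, rfl⟩)⟩
    obtain ⟨φ', h1, h2, h3, h4⟩ :=
      exists_stream_of_region hφ hx Z hin ⟨c.1, c.2, c.1.2, c.2.2, hc⟩ hdown hfwd
    obtain ⟨φ'', h5, h6, h7, h8⟩ := ih _ (hn ▸ h4) h1 h2 rfl
    exact ⟨φ'', h5, h6, h7.trans h3, h8⟩

/-! ### The possible values of the stream function. -/

/-- All terminals lie in the rows `r₁ ≤ r₂`. -/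
structure TerminalsIn (I : MFG L T) (r₁ r₂ : ℕ) : Prop where
  le : r₁ ≤ r₂
  lt : r₂ < L
  eq_or_eq : ∀ v : GridVertex L T, I.supply v ≠ 0 → (v.1 : ℕ) = r₁ ∨ (v.1 : ℕ) = r₂

section Values

variable {r₁ r₂ : ℕ} {φ : ℕ → ℕ → ℝ}

theorem TerminalsIn.rowSum_eq_zero (hr : I.TerminalsIn r₁ r₂) {l : ℕ} (h₁ : l ≠ r₁) (h₂ : l ≠ r₂)
    (t : ℕ) : I.rowSum l t = 0 := by
  refine Finset.sum_eq_zero fun j _ => ?_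
  rw [supplyAt]
  split_ifs with h
  · have := mt (hr.eq_or_eq (⟨l, h.1⟩, ⟨j, h.2⟩)) (by simp [h₁, h₂])
    simpa using this
  · simp

theorem IsStream.mono (hφ : I.IsStream φ) (hx : ∀ a, I.streamFlow φ a ∈ capInterval (I.cap a))
    {l t t' : ℕ} (hl : l ≤ L) (htt' : t ≤ t') (ht' : t' ≤ T) : φ l t ≤ φ l t' := by
  rcases Nat.eq_zero_or_pos l with rfl | hl0
  · simp [hφ.top]
  rcases hl.eq_or_lt with rfl | hl
  · simp [hφ.bottom]
  obtain ⟨l, rfl⟩ : ∃ m, l = m + 1 := ⟨l - 1, by omega⟩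
  induction htt' with
  | refl => exact le_rfl
  | @step m hm ih =>
    have h := (hx (.down l m hl (by omega))).1
    rw [streamFlow_down] at h
    exact (ih (by omega)).trans (by linarith)

/-- By monotonicity the value is squeezed between those at the left and the right end of its row.
With `right_top` and `right_bottom` this makes `φ` vanish outside the strip. -/
theorem IsStream.eq_zero_of_right (hφ : I.IsStream φ)
    (hx : ∀ a, I.streamFlow φ a ∈ capInterval (I.cap a)) {l t : ℕ} (hl : l ≤ L) (ht : t ≤ T)
    (h : φ l T = 0) : φ l t = 0 := by
  have h1 := hφ.mono hx hl (Nat.zero_le t) ht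
  have h2 := hφ.mono hx hl ht le_rfl
  rw [hφ.left] at h1
  linarith

theorem IsStream.right_top (hφ : I.IsStream φ) (hr : I.TerminalsIn r₁ r₂) {l : ℕ} (hl : l ≤ r₁) :
    φ l T = 0 := by
  have := hr.le
  have := hr.lt
  induction l with
  | zero => exact hφ.top T
  | succ l ih =>
    have h1 := hφ.right l (by omega)
    rw [ih (by omega), hr.rowSum_eq_zero (l := l) (by omega) (by omega)] at h1
    linarith

theorem IsStream.right_bottom (hφ : I.IsStream φ) (hr : I.TerminalsIn r₁ r₂) {l : ℕ} (hl : r₂ < l)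
    (hlL : l ≤ L) : φ l T = 0 := by
  have := hr.le
  have : ∀ n, l + n ≤ L → φ (l + n) T = φ l T := by
    intro n
    induction n with
    | zero => exact fun _ => rfl
    | succ n ih =>
      intro hn
      have h1 := hφ.right (l + n) (by omega)
      rw [ih (by omega), hr.rowSum_eq_zero (l := l + n) (by omega) (by omega)] at h1
      rw [← add_assoc]
      linarith
  have h := this (L - l) (by omega)
  rw [Nat.add_sub_cancel' hlL, hφ.bottom] at h
  exact h.symm

/-- Going down the right boundary, the value changes only by total row supplies; between the two
rows only row `r₁` has contributed. -/
theorem IsStream.right_middle (hφ : I.IsStream φ) (hr : I.TerminalsIn r₁ r₂) {l : ℕ} (hl : r₁ < l)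
    (hl₂ : l ≤ r₂) : φ l T = I.rowSum r₁ T := by
  have := hr.lt
  induction l with
  | zero => omega
  | succ l ih =>
    have h1 := hφ.right l (by omega)
    rcases (Nat.lt_succ_iff.1 hl).eq_or_lt with rfl | h2
    · rw [hφ.right_top hr le_rfl] at h1
      linarith
    · rw [ih h2 (by omega), hr.rowSum_eq_zero (l := l) (by omega) (by omega)] at h1
      linarith

/-- The distinct finite capacities. -/
noncomputable def capacities (I : MFG L T) : Finset ℕ :=
  -- `toNat` sends an infinite capacity to `0`; the filter discards this value unless `0` really is
  -- a capacity.
  (Set.toFinite (Set.range fun a => (I.cap a).toNat)).toFinset.filter fun u =>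
    ∃ a, I.cap a = u

theorem mem_capacities {u : ℕ} : u ∈ I.capacities ↔ ∃ a, I.cap a = u := by
  simp only [capacities, Finset.mem_filter, Set.Finite.mem_toFinset, Set.mem_range,
    and_iff_right_iff_imp]
  rintro ⟨a, ha⟩
  exact ⟨a, by simp [ha]⟩

theorem card_capacities : I.capacities.card = I.numCapacities := by
  rw [numCapacities, ← Set.ncard_coe_finset,
    ← Set.ncard_image_of_injective (f := fun u : ℕ => (u : ℕ∞)) _ Nat.cast_injective]
  congr 1
  ext u
  simp only [Set.mem_image, Finset.mem_coe, mem_capacities, Set.mem_ofPred_eq]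
  constructor
  · rintro ⟨k, hk, rfl⟩
    exact ⟨ENat.natCast_lt_top k, hk⟩
  · rintro ⟨hu, a, ha⟩
    lift u to ℕ using hu.ne
    exact ⟨u, ⟨a, ha⟩, rfl⟩

/-- The values that differ from zero or a partial row sum by an integer combination of the finite
capacities with coefficients at most `n`. -/
def IsNear (I : MFG L T) (n : ℕ) (v : ℝ) : Prop :=
  ∃ β : ℝ, (β = 0 ∨ ∃ r < L, ∃ t ≤ T, β = I.rowSum r t ∨ β = -I.rowSum r t) ∧
    ∃ m : ℕ → ℤ, (∀ u, |m u| ≤ n) ∧ v = β + ∑ u ∈ I.capacities, (m u : ℝ) * u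

/-- Crossing one arc at a bound changes at most one coefficient, and this by at most one. -/
theorem IsNear.add {n : ℕ} {v w : ℝ} (h : I.IsNear n v) (ε : ℤ) (hε : |ε| ≤ 1)
    (hw : w = 0 ∨ ∃ a, ∃ k : ℕ, I.cap a = k ∧ w = k) : I.IsNear (n + 1) (v + ε * w) := by
  classical
  obtain ⟨β, hβ, m, hm, rfl⟩ := h
  rcases hw with rfl | ⟨a, k, hk, rfl⟩
  · exact ⟨β, hβ, m, fun u => (hm u).trans (by simp), by simp⟩
  · refine ⟨β, hβ, fun u => m u + if u = k then ε else 0, fun u => ?_, ?_⟩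
    · push_cast
      refine (abs_add_le _ _).trans (add_le_add (hm u) ?_)
      split_ifs <;> simp [hε]
    · have hk' : k ∈ I.capacities := mem_capacities.2 ⟨a, hk⟩
      simp [add_mul, Finset.sum_add_distrib, ite_mul, hk', add_assoc]

theorem IsNear.mono {n n' : ℕ} (hn : n ≤ n') {v : ℝ} (h : I.IsNear n v) : I.IsNear n' v := by
  obtain ⟨β, hβ, m, hm, rfl⟩ := h
  exact ⟨β, hβ, m, fun u => (hm u).trans (by exact_mod_cast hn), rfl⟩

theorem isNear_of_base {β : ℝ}
    (hβ : β = 0 ∨ ∃ r < L, ∃ t ≤ T, β = I.rowSum r t ∨ β = -I.rowSum r t) : I.IsNear 0 β :=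
  ⟨β, hβ, 0, by simp, by simp⟩

/-- The stream function, changed above row `r₁` and below row `r₂` so that all flows between the
two rows are differences of its values. -/
noncomputable def innerStream (I : MFG L T) (r₁ r₂ : ℕ) (φ : ℕ → ℕ → ℝ) (l t : ℕ) : ℝ :=
  if l ≤ r₁ then I.rowSum r₁ t else if l ≤ r₂ then φ l t else -I.rowSum r₂ t

theorem isNear_innerStream_of_isOuter (hr : I.TerminalsIn r₁ r₂) (hφ : I.IsStream φ)
    {c : Corner L T} (hc : IsOuter r₁ r₂ c) : I.IsNear 0 (I.innerStream r₁ r₂ φ c.1 c.2) := by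
  have := hr.le
  have := hr.lt
  have hT := Nat.lt_succ_iff.1 c.2.2
  refine isNear_of_base ?_
  rw [innerStream]
  split_ifs with h1 h2
  · exact .inr ⟨r₁, by omega, c.2, hT, .inl rfl⟩
  · simp only [IsOuter] at hc
    rcases (by omega : (c.2 : ℕ) = 0 ∨ (c.2 : ℕ) = T) with h | h
    · rw [h, hφ.left]
      exact .inl rfl
    · rw [h, hφ.right_middle hr (by omega) h2]
      exact .inr ⟨r₁, by omega, T, le_rfl, .inl rfl⟩
  · exact .inr ⟨r₂, by omega, c.2, hT, .inr rfl⟩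

/-- At `l = r₁` and at `l = r₂` the unmodified `φ` vanishes on the outer side, and the row sum in
the flow formula is exactly the value substituted there; strictly between, the row sum is zero. -/
theorem innerStream_sub_of_fwd (hr : I.TerminalsIn r₁ r₂) (hφ : I.IsStream φ)
    (hx : ∀ a, I.streamFlow φ a ∈ capInterval (I.cap a)) (hlt : r₁ < r₂) {l t : ℕ} (hl : r₁ ≤ l)
    (hl₂ : l ≤ r₂) (ht : t + 1 < T) :
    I.innerStream r₁ r₂ φ l (t + 1) - I.innerStream r₁ r₂ φ (l + 1) (t + 1) =
      I.streamFlow φ (.fwd l t (hl₂.trans_lt hr.lt) ht) := by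
  have := hr.lt
  rw [streamFlow_fwd]
  rcases hl.eq_or_lt with rfl | hl
  · rw [innerStream, if_pos le_rfl, innerStream, if_neg (by omega), if_pos (by omega),
      hφ.eq_zero_of_right hx (l := r₁) (by omega) ht.le (hφ.right_top hr le_rfl)]
    ring
  rcases hl₂.eq_or_lt with rfl | hl₂
  · rw [innerStream, if_neg (by omega), if_pos le_rfl, innerStream, if_neg (by omega),
      if_neg (by omega), hφ.eq_zero_of_right hx (l := l + 1) (by omega) ht.le
        (hφ.right_bottom hr (by omega) (by omega))]
    ring
  · rw [innerStream, if_neg (by omega), if_pos (by omega), innerStream, if_neg (by omega),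
      if_pos (by omega), hr.rowSum_eq_zero (l := l) (by omega) (by omega)]
    ring

/-- The walk is followed backwards from its outer end. Each edge crosses an arc that is not free,
whose flow, `0` or a capacity, is the difference of `innerStream` at the two corners. If the current
corner is itself outer, the walk is not needed. -/
theorem isNear_innerStream_of_walk (hr : I.TerminalsIn r₁ r₂) (hφ : I.IsStream φ)
    (hx : ∀ a, I.streamFlow φ a ∈ capInterval (I.cap a)) {c d : Corner L T}
    (p : (I.cornerGraph (I.streamFlow φ)).Walk c d) (hd : IsOuter r₁ r₂ d) :
    I.IsNear p.length (I.innerStream r₁ r₂ φ c.1 c.2) := by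
  induction p with
  | nil => exact isNear_innerStream_of_isOuter hr hφ hd
  | @cons c e d hce p ih =>
    have ih := ih hd
    rw [SimpleGraph.Walk.length_cons]
    by_cases hc : IsOuter r₁ r₂ c
    · exact (isNear_innerStream_of_isOuter hr hφ hc).mono (Nat.zero_le _)
    simp only [IsOuter, not_or, not_le, not_lt] at hc
    obtain ⟨hc1, hc2, hc3, hc4⟩ := hc
    have hval (a) (ha : ¬ I.IsFree (I.streamFlow φ) a) : I.streamFlow φ a = 0 ∨
        ∃ a', ∃ k : ℕ, I.cap a' = k ∧ I.streamFlow φ a = k :=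
      (eq_zero_or_eq_cap_of_not_isFree (hx a) ha).imp_right fun h => ⟨a, h⟩
    rw [cornerGraph, SimpleGraph.fromRel_adj] at hce
    obtain ⟨-, (⟨l, t, hl, ht, hf, e1, e2, e3, e4⟩ | ⟨l, t, hl, ht, hf, e1, e2, e3, e4⟩) |
      (⟨l, t, hl, ht, hf, e1, e2, e3, e4⟩ | ⟨l, t, hl, ht, hf, e1, e2, e3, e4⟩)⟩ := hce
    · have h := ih.add (-1) (by simp) (hval _ hf)
      rw [streamFlow_down, e3, e4] at h
      rw [e1] at hc1 hc2
      rw [innerStream, if_neg (by omega), if_pos hc2] at h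
      rw [e1, e2, innerStream, if_neg (by omega), if_pos hc2]
      convert h using 1
      push_cast
      ring
    · have h := ih.add 1 (by simp) (hval _ hf)
      rw [← innerStream_sub_of_fwd hr hφ hx (by omega) (by omega) (by omega), e3, e4] at h
      rw [e1, e2]
      convert h using 1
      push_cast
      ring
    · have h := ih.add 1 (by simp) (hval _ hf)
      rw [streamFlow_down, e1, e2] at h
      rw [e3] at hc1 hc2
      rw [innerStream, if_neg (by omega), if_pos hc2] at h
      rw [e3, e4, innerStream, if_neg (by omega), if_pos hc2]
      convert h using 1
      push_cast
      ring
    · have h := ih.add (-1) (by simp) (hval _ hf)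
      rw [← innerStream_sub_of_fwd hr hφ hx (by omega) (by omega) (by omega), e1, e2] at h
      rw [e3, e4]
      convert h using 1
      push_cast
      ring

/-- Every feasible flow is at least as expensive as one whose stream function takes only values
from a small set. -/
theorem IsFeasible.exists_isNear (hr : I.TerminalsIn r₁ r₂) (hT : 0 < T) {x : GridArc L T → ℝ}
    (hx : I.IsFeasible x) :
    ∃ φ, I.IsStream φ ∧ (∀ a, I.streamFlow φ a ∈ capInterval (I.cap a)) ∧
      I.totalCost (I.streamFlow φ) ≤ I.totalCost x ∧
      ∀ l ≤ L, ∀ t ≤ T, I.IsNear ((L + 1) * (T + 1)) (φ l t) := by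
  have hL := hr.lt
  obtain ⟨φ, h1, h2, h3, h4⟩ := exists_stream_reachable (r₁ := r₁) hr.lt
    (hx.isStream (by omega) hT) (by rw [hx.streamFlow_stream]; exact hx.2)
  rw [hx.streamFlow_stream] at h3
  refine ⟨φ, h1, h2, h3, fun l hl t ht => ?_⟩
  by_cases hl1 : l ≤ r₁
  · rw [h1.eq_zero_of_right h2 hl ht (h1.right_top hr hl1)]
    exact (isNear_of_base (.inl rfl)).mono (Nat.zero_le _)
  by_cases hl2 : r₂ < l
  · rw [h1.eq_zero_of_right h2 hl ht (h1.right_bottom hr hl2 hl)]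
    exact (isNear_of_base (.inl rfl)).mono (Nat.zero_le _)
  obtain ⟨d, hd, hcd⟩ := h4 (⟨l, by omega⟩, ⟨t, by omega⟩)
  obtain ⟨p, hp⟩ := hcd.exists_isPath
  have h5 := isNear_innerStream_of_walk hr h1 h2 p hd
  simp only [innerStream, if_neg hl1, if_pos (not_lt.1 hl2)] at h5
  refine h5.mono ?_
  -- A path visits no corner twice, so its length is below the number of corners; this is where the
  -- bound on the coefficients comes from.
  have := hp.length_lt
  simp only [Fintype.card_prod, Fintype.card_fin] at this
  exact this.le

end Values

end MFG

/-! ### The dynamic program. -/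

namespace RealRAM

/-- The digit number `j` of `x` in base `b`, computed by divisions with quotients at most `n`. -/
def digit (b n j x : ℕ) : ℕ :=
  divCount x (b ^ j) n - divCount (divCount x (b ^ j) n) b n * b

theorem digit_eq {b n j x : ℕ} (hb : 0 < b) (hx : x ≤ n) : digit b n j x = x / b ^ j % b := by
  rw [digit, divCount_eq (Nat.pow_pos hb) hx,
    divCount_eq hb ((Nat.div_le_self _ _).trans hx), Nat.mod_eq_sub_div_mul]

/-- Positional notation: the numbers below `b ^ k` enumerate all `k`-tuples of digits, so one index
loop can range over all tuples. -/
theorem exists_digit_eq {b k : ℕ} (d : ℕ → ℕ) (hd : ∀ j < k, d j < b) (hb : 0 < b) :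
    ∃ x < b ^ k, ∀ j < k, digit b (b ^ k) j x = d j := by
  let f : Fin k → Fin b := fun j => ⟨d j, hd j j.2⟩
  refine ⟨finFunctionFinEquiv f, (finFunctionFinEquiv f).2, fun j hj => ?_⟩
  rw [digit_eq hb (finFunctionFinEquiv f).2.le]
  have := congrArg Fin.val (congrFun (finFunctionFinEquiv.symm_apply_apply f) ⟨j, hj⟩)
  rwa [finFunctionFinEquiv_symm_apply_val] at this

theorem digit_zero {b n : ℕ} (hb : 0 < b) (j : ℕ) : digit b n j 0 = 0 := by
  simp [digit_eq hb (Nat.zero_le n)]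

section Algorithm

variable (L K : ℕ)

/-- One base serves for all digits of a candidate: coefficients up to `(L + 1) * (T + 1)`, positions
of row sums, and arc numbers below `2 * (L * T)`. -/
def radix (T : ℕ) : ℕ := 4 * ((L + 1) * (T + 1))

/-- There are `K + 1` terms, the base value and `K` capacities. Each takes three digits: the
positive and the negative part of the coefficient, and an address. -/
def numCand (T : ℕ) : ℕ := radix L T ^ (3 * (K + 1))

def numStates (T : ℕ) : ℕ := numCand L K T ^ (L + 1)

def candDigit (T j i : ℕ) : ℕ := digit (radix L T) (numCand L K T) j i

/-- The candidate number `i` for the values of the stream function. -/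
noncomputable def candValue (T : ℕ) (h : Mem) (i : ℕ) : ℝ :=
  ∑ k ∈ Finset.range (K + 1),
    ((candDigit L K T (3 * k) i : ℝ) - candDigit L K T (3 * k + 1) i) *
      if k = 0 then h.r 1 (candDigit L K T (3 * k + 2) i)
      else h.r 0 (L * T + candDigit L K T (3 * k + 2) i)

/-- The value of the stream function in row `l` of a column in state `s`. -/
noncomputable def level (T : ℕ) (h : Mem) (s l : ℕ) : ℝ :=
  if l = 0 ∨ l = L then 0 else h.r 2 (digit (numCand L K T) (numStates L K T) l s)

noncomputable def downValue (T : ℕ) (h : Mem) (s s' l : ℕ) : ℝ :=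
  level L K T h s' (l + 1) - level L K T h s (l + 1)

noncomputable def fwdValue (T : ℕ) (h : Mem) (t s' l : ℕ) : ℝ :=
  level L K T h s' l - level L K T h s' (l + 1) + h.r 1 (L * (t + 1) + l)

/-- The states `s` and `s'` of columns `t` and `t + 1` are compatible. -/
def StepOk (T : ℕ) (h : Mem) (t s s' : ℕ) : Prop :=
  ∀ l < L, 0 ≤ downValue L K T h s s' l ∧ 0 ≤ fwdValue L K T h t s' l ∧
    (h.i 1 (2 * (L * t + l)) = 1 →
      downValue L K T h s s' l ≤ h.r 0 (L * T + 2 * (L * t + l))) ∧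
    (h.i 1 (2 * (L * t + l) + 1) = 1 →
      fwdValue L K T h t s' l ≤ h.r 0 (L * T + (2 * (L * t + l) + 1))) ∧
    -- No forward arc leaves the last column. Together with nonnegativity this forces the right
    -- boundary condition.
    (t + 1 = T → fwdValue L K T h t s' l ≤ 0)

noncomputable def stepCost (c : Ctx) (h : Mem) (t s s' : ℕ) : ℝ :=
  ∑ l ∈ Finset.range L, (c.oracle (2 * (L * t + l)) (downValue L K c.T h s s' l) +
    c.oracle (2 * (L * t + l) + 1) (fwdValue L K c.T h t s' l))

/-- Use of the arrays: `i 1` capacity flags, `r 0` the input reals, `r 1` row sums, `r 2` candidate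
values; in the table, `i 2` validity, `i 3` best successor, `r 3` cost to go; `r 4` the resulting
flow. Variables `0`, `1`, `2` are loop counters, and `3`, `4` are the states met in the final trace.
-/
noncomputable def fillRowSums (c : Ctx) (h : Mem) : Mem :=
  loop 0 (L * (c.T + 1)) (fun h => if h.i 0 0 + 1 ≤ L then h.setR 1 (h.i 0 0) 0
    else h.setR 1 (h.i 0 0) (h.r 1 (h.i 0 0 - L) + h.r 0 (h.i 0 0 - L))) h

noncomputable def fillCandidates (c : Ctx) (h : Mem) : Mem :=
  loop 0 (numCand L K c.T) (fun h => h.setR 2 (h.i 0 0) (candValue L K c.T h (h.i 0 0))) h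

/-- Every state is admitted at the right end, since the boundary condition there is tested by the
last `StepOk`. -/
noncomputable def fillLast (c : Ctx) (h : Mem) : Mem :=
  loop 0 (numStates L K c.T) (fun h =>
    (h.setR 3 (c.T * numStates L K c.T + h.i 0 0) 0).setI 2
      (c.T * numStates L K c.T + h.i 0 0) 1) h

def curCol (c : Ctx) (h : Mem) : ℕ := c.T - 1 - h.i 0 0

def curCell (c : Ctx) (h : Mem) : ℕ := curCol c h * numStates L K c.T + h.i 0 1

def nextCell (c : Ctx) (h : Mem) : ℕ := (curCol c h + 1) * numStates L K c.T + h.i 0 2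

noncomputable def newValue (c : Ctx) (h : Mem) : ℝ :=
  stepCost L K c h (curCol c h) (h.i 0 1) (h.i 0 2) + h.r 3 (nextCell L K c h)

def Improves (c : Ctx) (h : Mem) : Prop :=
  StepOk L K c.T h (curCol c h) (h.i 0 1) (h.i 0 2) ∧ h.i 2 (nextCell L K c h) = 1 ∧
    -- Validity `0` stands for an infinite cost to go; the stored real is then meaningless and is
    -- not compared.
    (h.i 2 (curCell L K c h) = 0 ∨ ¬ h.r 3 (curCell L K c h) ≤ newValue L K c h)

noncomputable def storeValue (c : Ctx) (h : Mem) : Mem :=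
  h.setR 3 (curCell L K c h) (newValue L K c h)

noncomputable def storeValid (v : ℕ) (c : Ctx) (h : Mem) : Mem := h.setI 2 (curCell L K c h) v

noncomputable def storeNext (c : Ctx) (h : Mem) : Mem := h.setI 3 (curCell L K c h) (h.i 0 2)

open Classical in
noncomputable def relax (c : Ctx) (h : Mem) : Mem :=
  if Improves L K c h then storeNext L K c (storeValid L K 1 c (storeValue L K c h)) else h

noncomputable def relaxAll (c : Ctx) (h : Mem) : Mem :=
  loop 2 (numStates L K c.T) (relax L K c) (storeValid L K 0 c h)

noncomputable def fillTable (c : Ctx) (h : Mem) : Mem :=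
  loop 0 c.T (fun h => loop 1 (numStates L K c.T) (relaxAll L K c) h) h

noncomputable def storeDown (l : ℕ) (c : Ctx) (h : Mem) : Mem :=
  h.setR 4 (2 * (L * h.i 0 0 + l)) (downValue L K c.T h (h.i 0 3) (h.i 0 4) l)

noncomputable def storeFwd (l : ℕ) (c : Ctx) (h : Mem) : Mem :=
  h.setR 4 (2 * (L * h.i 0 0 + l) + 1) (fwdValue L K c.T h (h.i 0 0) (h.i 0 4) l)

/-- The recursion over rows is not a loop of the machine: `L` is fixed, so it is unrolled in the
program text. -/
noncomputable def storeColumn (c : Ctx) (h : Mem) : ℕ → Mem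
  | 0 => h
  | n + 1 => storeFwd L K n c (storeDown L K n c (storeColumn c h n))

def lookupNext (c : Ctx) (h : Mem) : Mem :=
  h.setI 0 4 (h.i 3 (h.i 0 0 * numStates L K c.T + h.i 0 3))

def advance (h : Mem) : Mem := h.setI 0 3 (h.i 0 4)

noncomputable def trace (c : Ctx) (h : Mem) : Mem :=
  loop 0 c.T (fun h => advance (storeColumn L K c (lookupNext L K c h) L)) (h.setI 0 3 0)

noncomputable def algorithm (c : Ctx) (h : Mem) : Mem :=
  trace L K c (fillTable L K c (fillLast L K c (fillCandidates L K c (fillRowSums L c h))))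

end Algorithm

/-! ### The dynamic program runs in polynomial time. -/

section Computability

variable (L K : ℕ)

theorem polyBound_radix : PolyBound (radix L) :=
  (PolyBound.const 4).mul ((PolyBound.const (L + 1)).mul (PolyBound.id.add (.const 1)))

theorem polyBound_numCand : PolyBound (numCand L K) := (polyBound_radix L).pow _

theorem polyBound_numStates : PolyBound (numStates L K) := (polyBound_numCand L K).pow _

variable {L K}
variable [NeZero L]

theorem IComp.var (k : ℕ) : IComp L fun _ h => h.i 0 k := IComp.load 0 (.const k)

theorem IComp.digit {b n : ℕ → ℕ} (hb : PolyBound b) (hn : PolyBound n) (j : ℕ)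
    {f : Ctx → Mem → ℕ} (hf : IComp L f) : IComp L fun c h => digit (b c.T) (n c.T) j (f c h) :=
  have hq := hf.divCount ((IComp.of_polyBound hb).pow j) hn
  hq.sub ((hq.divCount (.of_polyBound hb) hn).mul (.of_polyBound hb))

theorem RComp.candValue {f : Ctx → Mem → ℕ} (hf : IComp L f) :
    RComp L fun c h => candValue L K c.T h (f c h) := by
  have hd (j : ℕ) : IComp L fun c h => candDigit L K c.T j (f c h) :=
    IComp.digit (polyBound_radix L) (polyBound_numCand L K) j hf
  refine RComp.sum (K + 1) fun k => ((RComp.cast (hd _)).sub (RComp.cast (hd _))).mul ?_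
  by_cases hk : k = 0
  · simp only [if_pos hk]
    exact RComp.load 1 (hd _)
  · simp only [if_neg hk]
    exact RComp.load 0 (((IComp.const L).mul .par).add (hd _))

theorem RComp.level {s : Ctx → Mem → ℕ} (hs : IComp L s) (l : ℕ) :
    RComp L fun c h => level L K c.T h (s c h) l := by
  by_cases hl : l = 0 ∨ l = L
  · simp only [RealRAM.level, if_pos hl]
    exact RComp.zero
  · simp only [RealRAM.level, if_neg hl]
    exact RComp.load 2 (IComp.digit (polyBound_numCand L K) (polyBound_numStates L K) l hs)

variable {t s s' : Ctx → Mem → ℕ}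

theorem RComp.downValue (hs : IComp L s) (hs' : IComp L s') (l : ℕ) :
    RComp L fun c h => downValue L K c.T h (s c h) (s' c h) l :=
  (RComp.level hs' _).sub (RComp.level hs _)

theorem RComp.fwdValue (ht : IComp L t) (hs' : IComp L s') (l : ℕ) :
    RComp L fun c h => fwdValue L K c.T h (t c h) (s' c h) l :=
  ((RComp.level hs' _).sub (RComp.level hs' _)).add
    (RComp.load 1 (((IComp.const L).mul (ht.add (.const 1))).add (.const l)))

theorem IComp.arcIndex (ht : IComp L t) (l : ℕ) : IComp L fun c h => 2 * (L * t c h + l) :=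
  (IComp.const 2).mul (((IComp.const L).mul ht).add (.const l))

theorem BComp.stepOk (ht : IComp L t) (hs : IComp L s) (hs' : IComp L s') :
    BComp L fun c h => StepOk L K c.T h (t c h) (s c h) (s' c h) := by
  refine BComp.forall_lt L fun l => ?_
  have hd := RComp.downValue (K := K) hs hs' l
  have hf := RComp.fwdValue (K := K) ht hs' l
  have he := IComp.arcIndex ht l
  have hLT := (IComp.const (L := L) L).mul .par
  exact (BComp.rle .zero hd).and <| (BComp.rle .zero hf).and <|
    ((BComp.eq (he.load 1) (.const 1)).imp (BComp.rle hd (RComp.load 0 (hLT.add he)))).and <|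
    ((BComp.eq ((he.add (.const 1)).load 1) (.const 1)).imp
      (BComp.rle hf (RComp.load 0 (hLT.add (he.add (.const 1)))))).and <|
    (BComp.eq (ht.add (.const 1)) .par).imp (BComp.rle hf .zero)

theorem RComp.stepCost (ht : IComp L t) (hs : IComp L s) (hs' : IComp L s') :
    RComp L fun c h => stepCost L K c h (t c h) (s c h) (s' c h) :=
  RComp.sum L fun l => (RComp.query (.arcIndex ht l) (.downValue hs hs' l)).add
    (RComp.query ((IComp.arcIndex ht l).add (.const 1)) (.fwdValue ht hs' l))

theorem CComp.fillRowSums : CComp L (fillRowSums L) := by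
  refine CComp.loop 0 ((PolyBound.const L).mul (PolyBound.id.add (.const 1))) ?_
  have hi := (IComp.var (L := L) 0).sub (.const L)
  have := CComp.ite (L := L) (BComp.le ((IComp.var 0).add (.const 1)) (.const L))
    (.setR 1 (.var 0) .zero) (.setR 1 (.var 0) ((RComp.load 1 hi).add (RComp.load 0 hi)))
  convert this

theorem CComp.fillCandidates : CComp L (fillCandidates L K) :=
  CComp.loop 0 (polyBound_numCand L K) (.setR 2 (.var 0) (.candValue (.var 0)))

theorem CComp.fillLast : CComp L (fillLast L K) := by
  have hi := (IComp.par (L := L).mul (.of_polyBound (polyBound_numStates L K))).add (.var 0)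
  exact CComp.loop 0 (polyBound_numStates L K)
    ((CComp.setI 2 hi (.const 1)).comp (.setR 3 hi .zero))

theorem IComp.curCol : IComp L curCol := (IComp.par.sub (.const 1)).sub (.var 0)

theorem IComp.curCell : IComp L (curCell L K) :=
  (IComp.curCol.mul (.of_polyBound (polyBound_numStates L K))).add (.var 1)

theorem IComp.nextCell : IComp L (nextCell L K) :=
  ((IComp.curCol.add (.const 1)).mul (.of_polyBound (polyBound_numStates L K))).add (.var 2)

theorem RComp.newValue : RComp L (newValue L K) :=
  (RComp.stepCost .curCol (.var 1) (.var 2)).add (RComp.load 3 .nextCell)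

theorem BComp.improves : BComp L (Improves L K) :=
  (BComp.stepOk .curCol (.var 1) (.var 2)).and <|
    (BComp.eq (IComp.nextCell.load 2) (.const 1)).and <|
    (BComp.eq (IComp.curCell.load 2) (.const 0)).or
      (BComp.rle (RComp.load 3 .curCell) .newValue).not

theorem CComp.storeValid (v : ℕ) : CComp L (storeValid L K v) :=
  CComp.setI 2 .curCell (.const v)

theorem CComp.relax : CComp L (relax L K) :=
  CComp.ite .improves
    ((CComp.setI 3 .curCell (.var 2)).comp
      ((CComp.storeValid 1).comp (.setR 3 .curCell .newValue))) .id

theorem CComp.fillTable : CComp L (fillTable L K) :=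
  CComp.loop 0 .id <| CComp.loop 1 (polyBound_numStates L K) <|
    (CComp.loop 2 (polyBound_numStates L K) .relax).comp (.storeValid 0)

theorem CComp.storeColumn (n : ℕ) : CComp L fun c h => storeColumn L K c h n := by
  induction n with
  | zero => exact CComp.id
  | succ n ih =>
    exact (CComp.setR 4 ((IComp.arcIndex (.var 0) n).add (.const 1)) (.fwdValue (.var 0) (.var 4) n)
      ).comp ((CComp.setR 4 (.arcIndex (.var 0) n) (.downValue (.var 3) (.var 4) n)).comp ih)

theorem CComp.trace : CComp L (trace L K) := by
  refine (CComp.loop 0 .id ?_).comp (CComp.setI 0 (.const 3) (.const 0))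
  exact (CComp.setI 0 (.const 3) (.var 4)).comp <| (CComp.storeColumn L).comp <|
    CComp.setI 0 (.const 4) (IComp.load 3
      (((IComp.var 0).mul (.of_polyBound (polyBound_numStates L K))).add (.var 3)))

theorem CComp.algorithm : CComp L (algorithm L K) :=
  CComp.trace.comp <| CComp.fillTable.comp <| CComp.fillLast.comp <|
    CComp.fillCandidates.comp .fillRowSums

end Computability

end RealRAM

/-! ### Correctness of the table and of the trace. -/

namespace RealRAM

variable {L K : ℕ}

/-- The arrays that are inputs of the dynamic program have not changed. -/
structure SameData (h h' : Mem) : Prop where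
  i1 : h'.i 1 = h.i 1
  r0 : h'.r 0 = h.r 0
  r1 : h'.r 1 = h.r 1
  r2 : h'.r 2 = h.r 2

theorem SameData.refl (h : Mem) : SameData h h := ⟨rfl, rfl, rfl, rfl⟩

theorem SameData.trans {h h' h'' : Mem} (h₁ : SameData h h') (h₂ : SameData h' h'') :
    SameData h h'' :=
  ⟨h₂.i1.trans h₁.i1, h₂.r0.trans h₁.r0, h₂.r1.trans h₁.r1, h₂.r2.trans h₁.r2⟩

section

variable {h h' : Mem}

theorem SameData.level (hs : SameData h h') (T : ℕ) : level L K T h' = level L K T h := by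
  funext s l
  simp only [RealRAM.level, hs.r2]

theorem SameData.downValue (hs : SameData h h') (T : ℕ) :
    downValue L K T h' = downValue L K T h := by
  funext s s' l
  simp only [RealRAM.downValue, hs.level]

theorem SameData.fwdValue (hs : SameData h h') (T : ℕ) :
    fwdValue L K T h' = fwdValue L K T h := by
  funext t s' l
  simp only [RealRAM.fwdValue, hs.level, hs.r1]

theorem SameData.stepOk (hs : SameData h h') (T : ℕ) : StepOk L K T h' = StepOk L K T h := by
  funext t s s'
  simp only [StepOk, hs.downValue, hs.fwdValue, hs.i1, hs.r0]

theorem SameData.stepCost (hs : SameData h h') (c : Ctx) :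
    stepCost L K c h' = stepCost L K c h := by
  funext t s s'
  simp only [RealRAM.stepCost, hs.downValue, hs.fwdValue]

end

theorem fillRowSums_spec (c : Ctx) (h : Mem) :
    (fillRowSums L c h).i 1 = h.i 1 ∧ (fillRowSums L c h).r 0 = h.r 0 ∧
      ∀ l < L, ∀ t ≤ c.T, (fillRowSums L c h).r 1 (L * t + l) =
        ∑ j ∈ Finset.range t, h.r 0 (L * j + l) := by
  suffices H : (fillRowSums L c h).i 1 = h.i 1 ∧ (fillRowSums L c h).r 0 = h.r 0 ∧
      ∀ l < L, ∀ t, L * t + l < L * (c.T + 1) → (fillRowSums L c h).r 1 (L * t + l) =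
        ∑ j ∈ Finset.range t, h.r 0 (L * j + l) from
    ⟨H.1, H.2.1, fun l hl t ht => H.2.2 l hl t (mul_add_lt_mul hl (Nat.lt_succ_of_le ht))⟩
  refine loop_induction (fun j h' => h'.i 1 = h.i 1 ∧ h'.r 0 = h.r 0 ∧
    ∀ l < L, ∀ t, L * t + l < j → h'.r 1 (L * t + l) = ∑ j ∈ Finset.range t, h.r 0 (L * j + l))
    ⟨rfl, rfl, by simp⟩ ?_
  rintro j hj h' ⟨h1, h2, h3⟩
  have hv : (h'.setI 0 0 j).i 0 0 = j := by simp [Mem.setI_i]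
  simp only [hv]
  split_ifs with hjL
  · refine ⟨by simp [Mem.setI_i, h1], by simp [Mem.setR_r, h2], fun l hl t ht => ?_⟩
    rcases Nat.lt_succ_iff_lt_or_eq.1 ht with ht | rfl
    · simp [Mem.setR_r, ht.ne, h3 l hl t ht]
    · have : t = 0 := by
        by_contra h0
        have := Nat.le_mul_of_pos_right L (Nat.pos_of_ne_zero h0)
        omega
      simp [Mem.setR_r, this]
  · refine ⟨by simp [Mem.setI_i, h1], by simp [Mem.setR_r, h2], fun l hl t ht => ?_⟩
    rcases Nat.lt_succ_iff_lt_or_eq.1 ht with ht | rfl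
    · simp [Mem.setR_r, ht.ne, h3 l hl t ht]
    · obtain _ | t := t
      · omega
      · have e : L * (t + 1) + l - L = L * t + l := by
          rw [Nat.mul_succ]
          omega
        have h4 := h3 l hl t (by rw [Nat.mul_succ]; omega)
        simp [Mem.setR_r, e, h4, h2, Finset.sum_range_succ]

theorem fillCandidates_spec (c : Ctx) (h : Mem) :
    (fillCandidates L K c h).i 1 = h.i 1 ∧ (fillCandidates L K c h).r 0 = h.r 0 ∧
      (fillCandidates L K c h).r 1 = h.r 1 ∧
      ∀ i < numCand L K c.T, (fillCandidates L K c h).r 2 i = candValue L K c.T h i := by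
  refine loop_induction (fun j h' => h'.i 1 = h.i 1 ∧ h'.r 0 = h.r 0 ∧ h'.r 1 = h.r 1 ∧
    ∀ i < j, h'.r 2 i = candValue L K c.T h i) ⟨rfl, rfl, rfl, by simp⟩ ?_
  rintro j hj h' ⟨h1, h2, h3, h4⟩
  refine ⟨by simp [Mem.setI_i, h1], by simp [Mem.setR_r, h2], by simp [Mem.setR_r, h3],
    fun i hi => ?_⟩
  rcases Nat.lt_succ_iff_lt_or_eq.1 hi with hi | rfl
  · simp [Mem.setR_r, Mem.setI_i, hi.ne, h4 i hi]
  · simp [Mem.setR_r, Mem.setI_i, candValue, h2, h3]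

theorem fillLast_spec (c : Ctx) (h : Mem) : SameData h (fillLast L K c h) ∧
    ∀ s < numStates L K c.T, (fillLast L K c h).i 2 (c.T * numStates L K c.T + s) = 1 ∧
      (fillLast L K c h).r 3 (c.T * numStates L K c.T + s) = 0 := by
  refine loop_induction (fun j h' => SameData h h' ∧
    ∀ s < j, h'.i 2 (c.T * numStates L K c.T + s) = 1 ∧
      h'.r 3 (c.T * numStates L K c.T + s) = 0) ⟨.refl h, by simp⟩ ?_
  rintro j hj h' ⟨h1, h2⟩
  refine ⟨h1.trans ⟨?_, ?_, ?_, ?_⟩, fun s hs => ?_⟩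
  · simp [Mem.setI_i]
  · simp [Mem.setR_r]
  · simp [Mem.setR_r]
  · simp [Mem.setR_r]
  rcases Nat.lt_succ_iff_lt_or_eq.1 hs with hs | rfl
  · simp [Mem.setR_r, Mem.setI_i, hs.ne, h2 s hs]
  · simp [Mem.setR_r, Mem.setI_i]

variable (L K) in
/-- Among the first `m` states of column `t + 1`, the table has a best successor of the state `s` of
column `t`. -/
def Best (c : Ctx) (h : Mem) (m t s : ℕ) : Prop :=
  let Q := numStates L K c.T
  (h.i 2 (t * Q + s) = 0 ∧ ∀ s' < m, StepOk L K c.T h t s s' → h.i 2 ((t + 1) * Q + s') ≠ 1) ∨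
  (h.i 2 (t * Q + s) = 1 ∧ h.i 3 (t * Q + s) < m ∧
    StepOk L K c.T h t s (h.i 3 (t * Q + s)) ∧ h.i 2 ((t + 1) * Q + h.i 3 (t * Q + s)) = 1 ∧
    h.r 3 (t * Q + s) = stepCost L K c h t s (h.i 3 (t * Q + s)) +
      h.r 3 ((t + 1) * Q + h.i 3 (t * Q + s)) ∧
    ∀ s' < m, StepOk L K c.T h t s s' → h.i 2 ((t + 1) * Q + s') = 1 →
      h.r 3 (t * Q + s) ≤ stepCost L K c h t s s' + h.r 3 ((t + 1) * Q + s'))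

theorem Best.congr {c : Ctx} {h h' : Mem} {m t s : ℕ} (hb : Best L K c h m t s)
    (hs : SameData h h')
    (hc : ∀ s', h'.i 2 ((t + 1) * numStates L K c.T + s') =
        h.i 2 ((t + 1) * numStates L K c.T + s') ∨ m ≤ s')
    (hc' : ∀ s', h'.r 3 ((t + 1) * numStates L K c.T + s') =
        h.r 3 ((t + 1) * numStates L K c.T + s') ∨ m ≤ s')
    (h1 : h'.i 2 (t * numStates L K c.T + s) = h.i 2 (t * numStates L K c.T + s))
    (h2 : h'.i 3 (t * numStates L K c.T + s) = h.i 3 (t * numStates L K c.T + s))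
    (h3 : h'.r 3 (t * numStates L K c.T + s) = h.r 3 (t * numStates L K c.T + s)) :
    Best L K c h' m t s := by
  rcases hb with ⟨g1, g2⟩ | ⟨g1, g2, g3, g4, g5, g6⟩
  · left
    refine ⟨h1.trans g1, fun s' hs' => ?_⟩
    rw [hs.stepOk, (hc s').resolve_right (by omega)]
    exact g2 s' hs'
  · right
    rw [h1, h2, h3, hs.stepOk, hs.stepCost, (hc _).resolve_right (by omega),
      (hc' _).resolve_right (by omega)]
    refine ⟨g1, g2, g3, g4, g5, fun s' hs' => ?_⟩
    rw [(hc s').resolve_right (by omega), (hc' s').resolve_right (by omega)]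
    exact g6 s' hs'

theorem row_cell_inj {Q t t' s s' : ℕ} (hs : s < Q) (hs' : s' < Q) :
    t * Q + s = t' * Q + s' ↔ t = t' ∧ s = s' := by
  rw [mul_comm t, mul_comm t', mul_add_eq_mul_add_iff hs hs', and_comm]

/-- The changes made between `h` and `h'` are confined to cell `p` of the table and to variables
with numbers at least `k`. -/
structure OnlyCell (k p : ℕ) (h h' : Mem) : Prop where
  data : SameData h h'
  var : ∀ j < k, h'.i 0 j = h.i 0 j
  i2 : ∀ q, q ≠ p → h'.i 2 q = h.i 2 q
  i3 : ∀ q, q ≠ p → h'.i 3 q = h.i 3 q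
  r3 : ∀ q, q ≠ p → h'.r 3 q = h.r 3 q

/-- The loop invariant is `Best` for the successors tried so far. Column `t + 1` is only read, so
the entries already compared stay valid. Variable `2` is the counter, hence only variables below `2`
are preserved. -/
theorem relaxAll_spec {c : Ctx} {h : Mem} {t s : ℕ} (ht : curCol c h = t) (hs : h.i 0 1 = s)
    (hsQ : s < numStates L K c.T) :
    OnlyCell 2 (t * numStates L K c.T + s) h (relaxAll L K c h) ∧
      Best L K c (relaxAll L K c h) (numStates L K c.T) t s := by
  set Q := numStates L K c.T with hQ
  refine loop_induction (fun m h' => OnlyCell 2 (t * Q + s) h h' ∧ Best L K c h' m t s) ?_ ?_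
  · have hp : curCell L K c h = t * Q + s := by rw [curCell, ht, hs]
    refine ⟨⟨⟨?_, ?_, ?_, ?_⟩, ?_, ?_, ?_, ?_⟩, ?_⟩
    · simp [storeValid, Mem.setI_i]
    · simp [storeValid]
    · simp [storeValid]
    · simp [storeValid]
    · simp [storeValid, Mem.setI_i]
    · intro q hq
      simp [storeValid, Mem.setI_i, hp, hq]
    · simp [storeValid, Mem.setI_i]
    · simp [storeValid]
    · left
      refine ⟨?_, by simp⟩
      rw [storeValid, hp]
      simp [Mem.setI_i, hQ]
  · rintro m hm g ⟨hg, hb⟩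
    have hv0 := hg.var 0 (by norm_num)
    have hv1 := hg.var 1 (by norm_num)
    set g1 := g.setI 0 2 m with hg1
    have hs1 : SameData g g1 :=
      ⟨by simp [hg1, Mem.setI_i], by simp [hg1], by simp [hg1], by simp [hg1]⟩
    have e1 : curCol c g1 = t := by
      rw [← ht, curCol, curCol, ← hv0, hg1]
      simp [Mem.setI_i]
    have e2 : g1.i 0 1 = s := by
      rw [← hs, ← hv1, hg1]
      simp [Mem.setI_i]
    have e3 : g1.i 0 2 = m := by simp [hg1, Mem.setI_i]
    have e4 : curCell L K c g1 = t * Q + s := by rw [curCell, e1, e2]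
    have e5 : nextCell L K c g1 = (t + 1) * Q + m := by rw [nextCell, e1, e3]
    have e6 : g1.i 2 = g.i 2 := by simp [hg1, Mem.setI_i]
    have e7 : g1.i 3 = g.i 3 := by simp [hg1, Mem.setI_i]
    have e8 : g1.r = g.r := by simp [hg1]
    have e9 : newValue L K c g1 = stepCost L K c g t s m + g.r 3 ((t + 1) * Q + m) := by
      rw [newValue, hs1.stepCost, e1, e2, e3, e5, e8]
    have hi : Improves L K c g1 ↔ StepOk L K c.T g t s m ∧ g.i 2 ((t + 1) * Q + m) = 1 ∧
        (g.i 2 (t * Q + s) = 0 ∨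
          ¬ g.r 3 (t * Q + s) ≤ stepCost L K c g t s m + g.r 3 ((t + 1) * Q + m)) := by
      rw [Improves, hs1.stepOk, e1, e2, e3, e4, e5, e6, e8, e9]
    have hne (x : ℕ) (hx : x < Q) : (t + 1) * Q + x ≠ t * Q + s := by
      rw [ne_eq, row_cell_inj hx hsQ]
      omega
    rw [relax]
    split_ifs with himp
    · obtain ⟨hi1, hi2, hi3⟩ := hi.1 himp
      set g2 := storeNext L K c (storeValid L K 1 c (storeValue L K c g1)) with hg2
      have f1 : g2 = ((g1.setR 3 (t * Q + s) (stepCost L K c g t s m + g.r 3 ((t + 1) * Q + m))).setI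
          2 (t * Q + s) 1).setI 3 (t * Q + s) m := by
        rw [hg2, storeNext, storeValid, storeValue, e9, e4]
        simp only [curCell, curCol, Mem.setR_i, Mem.setI_i]
        simp only [curCol] at e1
        simp [e1, e2, e3, hQ]
      have hs2 : SameData g g2 := hs1.trans
        ⟨by simp [f1, Mem.setI_i], by simp [f1, Mem.setR_r], by simp [f1, Mem.setR_r],
          by simp [f1, Mem.setR_r]⟩
      have k2 (q : ℕ) : g2.i 2 q = if q = t * Q + s then 1 else g.i 2 q := by
        rw [f1]
        simp [Mem.setI_i, Function.update_apply, e6]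
      have k3 (q : ℕ) : g2.i 3 q = if q = t * Q + s then m else g.i 3 q := by
        rw [f1]
        simp [Mem.setI_i, Function.update_apply, e7]
      have kr (q : ℕ) : g2.r 3 q = if q = t * Q + s then
          stepCost L K c g t s m + g.r 3 ((t + 1) * Q + m) else g.r 3 q := by
        rw [f1]
        simp [Mem.setR_r, Function.update_apply, e8]
      have kv (j : ℕ) (hj : j < 2) : g2.i 0 j = g.i 0 j := by
        rw [f1]
        simp [Mem.setI_i, hg1, show j ≠ 2 by omega]
      refine ⟨⟨hg.data.trans hs2, fun j hj => (kv j hj).trans (hg.var j hj), ?_, ?_, ?_⟩, ?_⟩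
      · intro q hq
        rw [k2, if_neg hq, hg.i2 q hq]
      · intro q hq
        rw [k3, if_neg hq, hg.i3 q hq]
      · intro q hq
        rw [kr, if_neg hq, hg.r3 q hq]
      · right
        simp only [← hQ]
        rw [k3 (t * Q + s), if_pos rfl, k2 (t * Q + s), if_pos rfl, hs2.stepOk, hs2.stepCost,
          k2 _, if_neg (hne m hm), kr (t * Q + s), if_pos rfl, kr _, if_neg (hne m hm)]
        refine ⟨rfl, Nat.lt_succ_self m, hi1, hi2, rfl, fun s' hs' => ?_⟩
        rw [k2, if_neg (hne s' (by omega)), kr, if_neg (hne s' (by omega))]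
        intro j1 j2
        -- An earlier admissible successor cannot exist if the cell was invalid; otherwise its cost
        -- is at least the old value, which the new one undercuts.
        rcases Nat.lt_succ_iff_lt_or_eq.1 hs' with hs' | rfl
        · rcases hb with ⟨-, b2⟩ | ⟨b1, -, -, -, -, b6⟩
          · exact absurd j2 (b2 s' hs' j1)
          · have b7 := hi3.resolve_left (by simp only [← hQ] at b1; omega)
            exact (not_le.1 b7).le.trans (b6 s' hs' j1 j2)
        · exact le_rfl
    · rw [hi] at himp
      refine ⟨⟨hg.data.trans hs1, fun j hj => ?_, by rw [e6]; exact hg.i2, by rw [e7]; exact hg.i3,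
        by rw [e8]; exact hg.r3⟩, ?_⟩
      · rw [← hg.var j hj, hg1]
        simp [Mem.setI_i, show j ≠ 2 by omega]
      · have hb' : Best L K c g (m + 1) t s := by
          rcases hb with ⟨b1, b2⟩ | ⟨b1, b2, b3, b4, b5, b6⟩
          · refine .inl ⟨b1, fun s' hs' j1 j2 => ?_⟩
            rcases Nat.lt_succ_iff_lt_or_eq.1 hs' with hs' | rfl
            · exact b2 s' hs' j1 j2
            · exact himp ⟨j1, j2, .inl b1⟩
          · refine .inr ⟨b1, by omega, b3, b4, b5, fun s' hs' j1 j2 => ?_⟩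
            rcases Nat.lt_succ_iff_lt_or_eq.1 hs' with hs' | rfl
            · exact b6 s' hs' j1 j2
            · by_contra h9
              exact himp ⟨j1, j2, .inr h9⟩
        refine hb'.congr hs1 ?_ ?_ ?_ ?_ ?_ <;> simp [e6, e7, e8]

variable (L K) in
/-- The columns from `t₀` on are tabulated correctly. -/
structure TableFrom (c : Ctx) (h : Mem) (t₀ : ℕ) : Prop where
  best : ∀ t, t₀ ≤ t → t < c.T → ∀ s < numStates L K c.T, Best L K c h (numStates L K c.T) t s
  valid_last : ∀ s < numStates L K c.T, h.i 2 (c.T * numStates L K c.T + s) = 1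
  value_last : ∀ s < numStates L K c.T, h.r 3 (c.T * numStates L K c.T + s) = 0

theorem TableFrom.of_onlyCell {c : Ctx} {h h' : Mem} {t₀ t s k : ℕ} (hT : TableFrom L K c h t₀)
    (ht : t < t₀) (ht₀ : t₀ ≤ c.T) (hs : s < numStates L K c.T)
    (ho : OnlyCell k (t * numStates L K c.T + s) h h') : TableFrom L K c h' t₀ := by
  have hne {t' s' : ℕ} (ht' : t₀ ≤ t') (hs' : s' < numStates L K c.T) :
      t' * numStates L K c.T + s' ≠ t * numStates L K c.T + s := by
    rw [ne_eq, row_cell_inj hs' hs]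
    omega
  refine ⟨fun t' h1 h2 s' hs' => ?_, fun s' hs' => ?_, fun s' hs' => ?_⟩
  · refine (hT.best t' h1 h2 s' hs').congr ho.data (fun x => ?_) (fun x => ?_)
      (ho.i2 _ (hne h1 hs')) (ho.i3 _ (hne h1 hs')) (ho.r3 _ (hne h1 hs'))
    · exact (lt_or_ge x _).imp_left fun hx => ho.i2 _ (hne (by omega) hx)
    · exact (lt_or_ge x _).imp_left fun hx => ho.r3 _ (hne (by omega) hx)
  · rw [ho.i2 _ (hne ht₀ hs'), hT.valid_last s' hs']
  · rw [ho.r3 _ (hne ht₀ hs'), hT.value_last s' hs']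

theorem TableFrom.of_vars {c : Ctx} {h : Mem} {t₀ : ℕ} (hT : TableFrom L K c h t₀) (k v : ℕ) :
    TableFrom L K c (h.setI 0 k v) t₀ := by
  have hs : SameData h (h.setI 0 k v) := ⟨by simp [Mem.setI_i], rfl, rfl, rfl⟩
  have e2 : (h.setI 0 k v).i 2 = h.i 2 := by simp [Mem.setI_i]
  have e3 : (h.setI 0 k v).i 3 = h.i 3 := by simp [Mem.setI_i]
  refine ⟨fun t h1 h2 s hs' => ?_, by rw [e2]; exact hT.valid_last, hT.value_last⟩
  refine (hT.best t h1 h2 s hs').congr hs ?_ ?_ ?_ ?_ ?_ <;> simp [e2, e3]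

theorem fillTable_spec {c : Ctx} {h : Mem} (hT : TableFrom L K c h c.T) :
    SameData h (fillTable L K c h) ∧ TableFrom L K c (fillTable L K c h) 0 := by
  -- The columns are processed from right to left; writing `0` as `c.T - c.T` matches the invariant
  -- after `j` rounds.
  suffices H : SameData h (fillTable L K c h) ∧
      TableFrom L K c (fillTable L K c h) (c.T - c.T) by simpa using H
  refine loop_induction (fun j h' => SameData h h' ∧ TableFrom L K c h' (c.T - j)) ⟨.refl h, hT⟩ ?_
  rintro j hj g ⟨hg, hgT⟩
  have hvar (k v : ℕ) (g : Mem) : SameData g (g.setI 0 k v) := ⟨by simp [Mem.setI_i], rfl, rfl, rfl⟩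
  obtain ⟨-, h1, h2, h3⟩ := loop_induction (k := 1) (n := numStates L K c.T) (G := relaxAll L K c)
    (h := g.setI 0 0 j) (fun m h' => h'.i 0 0 = j ∧ SameData h h' ∧ TableFrom L K c h' (c.T - j) ∧
      ∀ s < m, Best L K c h' (numStates L K c.T) (c.T - 1 - j) s)
    ⟨by simp [Mem.setI_i], hg.trans (hvar _ _ _), hgT.of_vars _ _, by simp⟩ (by
      rintro m hm g' ⟨k1, k2, k3, k4⟩
      obtain ⟨ho, hb⟩ := relaxAll_spec (L := L) (K := K) (c := c) (h := g'.setI 0 1 m)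
        (t := c.T - 1 - j) (s := m) (by simp [curCol, Mem.setI_i, k1]) (by simp [Mem.setI_i]) hm
      refine ⟨?_, k2.trans ((hvar _ _ _).trans ho.data),
        (k3.of_vars _ _).of_onlyCell (by omega) (by omega) hm ho, fun s hs => ?_⟩
      · rw [ho.var 0 (by norm_num)]
        simp [Mem.setI_i, k1]
      · rcases Nat.lt_succ_iff_lt_or_eq.1 hs with hs | rfl
        · have hne (t' s' : ℕ) (hs' : s' < numStates L K c.T) (hn : t' ≠ c.T - 1 - j ∨ s' ≠ m) :
              t' * numStates L K c.T + s' ≠ (c.T - 1 - j) * numStates L K c.T + m := by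
            rw [ne_eq, row_cell_inj hs' hm]
            omega
          have e2 : (g'.setI 0 1 m).i 2 = g'.i 2 := by simp [Mem.setI_i]
          have e3 : (g'.setI 0 1 m).i 3 = g'.i 3 := by simp [Mem.setI_i]
          refine (k4 s hs).congr ((hvar _ _ _).trans ho.data) (fun x => ?_) (fun x => ?_) ?_ ?_ ?_
          · exact (lt_or_ge x _).imp_left fun hx => by
              rw [ho.i2 _ (hne _ _ hx (by omega)), e2]
          · exact (lt_or_ge x _).imp_left fun hx => by
              rw [ho.r3 _ (hne _ _ hx (by omega)), Mem.setI_r]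
          · rw [ho.i2 _ (hne _ _ (by omega) (by omega)), e2]
          · rw [ho.i3 _ (hne _ _ (by omega) (by omega)), e3]
          · rw [ho.r3 _ (hne _ _ (by omega) (by omega)), Mem.setI_r]
        · exact hb)
  refine ⟨h1, fun t ht htT s hs => ?_, h2.valid_last, h2.value_last⟩
  rcases (by omega : t = c.T - 1 - j ∨ c.T - j ≤ t) with rfl | ht'
  · exact h3 s hs
  · exact h2.best t ht' htT s hs

variable (L K) in
/-- The states visited by following the stored successors. -/
def path (c : Ctx) (h : Mem) : ℕ → ℕ
  | 0 => 0
  | t + 1 => h.i 3 (t * numStates L K c.T + path c h t)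

theorem storeColumn_spec (c : Ctx) (h : Mem) (n : ℕ) (hn : n ≤ L) :
    (storeColumn L K c h n).i = h.i ∧ SameData h (storeColumn L K c h n) ∧
    (∀ l < n, (storeColumn L K c h n).r 4 (2 * (L * h.i 0 0 + l)) =
        downValue L K c.T h (h.i 0 3) (h.i 0 4) l ∧
      (storeColumn L K c h n).r 4 (2 * (L * h.i 0 0 + l) + 1) =
        fwdValue L K c.T h (h.i 0 0) (h.i 0 4) l) ∧
    ∀ t < h.i 0 0, ∀ l < L,
      (storeColumn L K c h n).r 4 (2 * (L * t + l)) = h.r 4 (2 * (L * t + l)) ∧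
      (storeColumn L K c h n).r 4 (2 * (L * t + l) + 1) = h.r 4 (2 * (L * t + l) + 1) := by
  induction n with
  | zero => exact ⟨rfl, .refl h, by simp, by simp [storeColumn]⟩
  | succ n ih =>
    obtain ⟨h1, h2, h3, h4⟩ := ih (by omega)
    set g := storeColumn L K c h n with hg
    have e1 : SameData g (storeDown L K n c g) :=
      ⟨by simp [storeDown], by simp [storeDown, Mem.setR_r], by simp [storeDown, Mem.setR_r],
        by simp [storeDown, Mem.setR_r]⟩
    have e2 : SameData (storeDown L K n c g) (storeFwd L K n c (storeDown L K n c g)) :=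
      ⟨by simp [storeFwd], by simp [storeFwd, Mem.setR_r], by simp [storeFwd, Mem.setR_r],
        by simp [storeFwd, Mem.setR_r]⟩
    have key (e : ℕ) : (storeColumn L K c h (n + 1)).r 4 e =
        if e = 2 * (L * h.i 0 0 + n) + 1 then fwdValue L K c.T h (h.i 0 0) (h.i 0 4) n
        else if e = 2 * (L * h.i 0 0 + n) then downValue L K c.T h (h.i 0 3) (h.i 0 4) n
        else g.r 4 e := by
      rw [storeColumn, ← hg, storeFwd, e1.fwdValue, h2.fwdValue, storeDown, h2.downValue]
      simp only [Mem.setR_i, h1, Mem.setR_r, if_true, Function.update_apply]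
    refine ⟨by rw [storeColumn, ← hg, storeFwd, storeDown]; simpa using h1,
      h2.trans (e1.trans e2), fun l hl => ?_, fun t ht l hl => ?_⟩
    · rcases Nat.lt_succ_iff_lt_or_eq.1 hl with hl | rfl
      · rw [key, key, if_neg (by omega), if_neg (by omega), if_neg (by omega), if_neg (by omega)]
        exact h3 l hl
      · rw [key, key, if_neg (by omega), if_pos rfl, if_pos rfl]
        exact ⟨rfl, rfl⟩
    · have hne : L * t + l ≠ L * h.i 0 0 + n := by
        rw [ne_eq, mul_add_eq_mul_add_iff hl (by omega)]
        omega
      rw [key, key, if_neg (by omega), if_neg (by omega), if_neg (by omega), if_neg (by omega)]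
      exact h4 t ht l hl

theorem trace_spec (c : Ctx) (h : Mem) : (trace L K c h).i 2 = h.i 2 ∧
    ∀ t < c.T, ∀ l < L,
      (trace L K c h).r 4 (2 * (L * t + l)) =
        downValue L K c.T h (path L K c h t) (path L K c h (t + 1)) l ∧
      (trace L K c h).r 4 (2 * (L * t + l) + 1) =
        fwdValue L K c.T h t (path L K c h (t + 1)) l := by
  suffices H : (trace L K c h).i 2 = h.i 2 ∧ (trace L K c h).i 3 = h.i 3 ∧
      SameData h (trace L K c h) ∧ (trace L K c h).i 0 3 = path L K c h c.T ∧
      ∀ t < c.T, ∀ l < L,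
      (trace L K c h).r 4 (2 * (L * t + l)) =
        downValue L K c.T h (path L K c h t) (path L K c h (t + 1)) l ∧
      (trace L K c h).r 4 (2 * (L * t + l) + 1) =
        fwdValue L K c.T h t (path L K c h (t + 1)) l from ⟨H.1, H.2.2.2.2⟩
  refine loop_induction (fun j h' => h'.i 2 = h.i 2 ∧ h'.i 3 = h.i 3 ∧ SameData h h' ∧
    h'.i 0 3 = path L K c h j ∧ ∀ t < j, ∀ l < L,
      h'.r 4 (2 * (L * t + l)) =
        downValue L K c.T h (path L K c h t) (path L K c h (t + 1)) l ∧
      h'.r 4 (2 * (L * t + l) + 1) = fwdValue L K c.T h t (path L K c h (t + 1)) l) ?_ ?_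
  · exact ⟨by simp [Mem.setI_i], by simp [Mem.setI_i], ⟨by simp [Mem.setI_i], rfl, rfl, rfl⟩,
      by simp [Mem.setI_i, path], by simp⟩
  · rintro j hj g ⟨h1, h2, h3, h4, h5⟩
    set g1 := lookupNext L K c (g.setI 0 0 j) with hg1
    have a0 : g1.i 0 0 = j := by simp [hg1, lookupNext, Mem.setI_i]
    have a3 : g1.i 0 3 = path L K c h j := by simp [hg1, lookupNext, Mem.setI_i, h4]
    have a4 : g1.i 0 4 = path L K c h (j + 1) := by
      simp [hg1, lookupNext, Mem.setI_i, h4, h2, path]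
    have ai (a : Fin 8) (ha : a ≠ 0) : g1.i a = g.i a := by
      simp [hg1, lookupNext, Mem.setI_i, ha]
    have ar : g1.r = g.r := by simp [hg1, lookupNext]
    have as : SameData h g1 := h3.trans ⟨ai 1 (by decide), by rw [ar], by rw [ar], by rw [ar]⟩
    obtain ⟨b1, b2, b3, b4⟩ := storeColumn_spec (K := K) c g1 L le_rfl
    rw [a0, a3, a4, as.downValue, as.fwdValue] at b3
    rw [a0, ar] at b4
    refine ⟨?_, ?_, (as.trans b2).trans ⟨by simp [advance, Mem.setI_i], rfl, rfl, rfl⟩, ?_, ?_⟩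
    · simp [advance, Mem.setI_i, b1, ai 2 (by decide), h1]
    · simp [advance, Mem.setI_i, b1, ai 3 (by decide), h2]
    · simp [advance, Mem.setI_i, b1, a4]
    · intro t ht l hl
      simp only [advance, Mem.setI_r]
      rcases Nat.lt_succ_iff_lt_or_eq.1 ht with ht | rfl
      · rw [(b4 t ht l hl).1, (b4 t ht l hl).2]
        exact h5 t ht l hl
      · exact b3 l hl

section Path

variable {c : Ctx} {h : Mem}

theorem numStates_pos (T : ℕ) : 0 < numStates L K T := by
  unfold numStates numCand radix
  positivity

/-- Validity passes from a state to its stored successor, and the equation for the cost to go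
telescopes along the path. -/
theorem TableFrom.path_spec (hT : TableFrom L K c h 0) (hv : h.i 2 0 = 1) {t : ℕ} (ht : t ≤ c.T) :
    path L K c h t < numStates L K c.T ∧ h.i 2 (t * numStates L K c.T + path L K c h t) = 1 ∧
      (∀ j < t, StepOk L K c.T h j (path L K c h j) (path L K c h (j + 1))) ∧
      h.r 3 0 = ∑ j ∈ Finset.range t, stepCost L K c h j (path L K c h j) (path L K c h (j + 1)) +
        h.r 3 (t * numStates L K c.T + path L K c h t) := by
  induction t with
  | zero => exact ⟨numStates_pos _, by simpa [path] using hv, by simp, by simp [path]⟩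
  | succ t ih =>
    obtain ⟨h1, h2, h3, h4⟩ := ih (by omega)
    rcases hT.best t (Nat.zero_le t) (by omega) _ h1 with ⟨b1, -⟩ | ⟨-, b2, b3, b4, b5, -⟩
    · omega
    · refine ⟨b2, b4, fun j hj => ?_, ?_⟩
      · rcases Nat.lt_succ_iff_lt_or_eq.1 hj with hj | rfl
        · exact h3 j hj
        · exact b3
      · rw [h4, Finset.sum_range_succ, add_assoc]
        exact congrArg _ b5

/-- Backward induction along `σ`: at each column the table entry is no worse than the choice made by
`σ`, and validity propagates to the left. -/
theorem TableFrom.le_of_sequence (hT : TableFrom L K c h 0) {σ : ℕ → ℕ}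
    (hσ : ∀ t ≤ c.T, σ t < numStates L K c.T)
    (hok : ∀ t < c.T, StepOk L K c.T h t (σ t) (σ (t + 1))) (h0 : σ 0 = 0) :
    h.i 2 0 = 1 ∧ h.r 3 0 ≤ ∑ j ∈ Finset.range c.T, stepCost L K c h j (σ j) (σ (j + 1)) := by
  have key : ∀ n ≤ c.T, h.i 2 ((c.T - n) * numStates L K c.T + σ (c.T - n)) = 1 ∧
      ∑ j ∈ Finset.range (c.T - n), stepCost L K c h j (σ j) (σ (j + 1)) +
        h.r 3 ((c.T - n) * numStates L K c.T + σ (c.T - n)) ≤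
      ∑ j ∈ Finset.range c.T, stepCost L K c h j (σ j) (σ (j + 1)) := by
    intro n
    induction n with
    | zero =>
      intro _
      rw [Nat.sub_zero, hT.valid_last _ (hσ _ le_rfl), hT.value_last _ (hσ _ le_rfl)]
      simp
    | succ n ih =>
      intro hn
      obtain ⟨h1, h2⟩ := ih (by omega)
      have e : c.T - n = c.T - (n + 1) + 1 := by omega
      rw [e] at h1 h2
      have hok' := hok (c.T - (n + 1)) (by omega)
      have hlt := hσ (c.T - (n + 1) + 1) (by omega)
      rcases hT.best (c.T - (n + 1)) (Nat.zero_le _) (by omega) _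
        (hσ (c.T - (n + 1)) (by omega)) with
        ⟨-, b2⟩ | ⟨b1, -, -, -, -, b6⟩
      · exact absurd h1 (b2 _ hlt hok')
      · have b7 := b6 _ hlt hok' h1
        rw [Finset.sum_range_succ] at h2
        refine ⟨b1, ?_⟩
        linarith
  obtain ⟨h1, h2⟩ := key c.T le_rfl
  rw [Nat.sub_self, h0] at h1 h2
  exact ⟨by simpa using h1, by simpa using h2⟩

end Path

end RealRAM

/-! ### The dynamic program solves the instance. -/

namespace MFG

open RealRAM

variable {L T K : ℕ} {I : MFG L T}

theorem arcNumber_lt (a : GridArc L T) : arcNumber a < 2 * (L * T) := by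
  have := mul_add_lt_mul a.tail.1.2 a.tail.2.2
  simp only [arcNumber, vertexNumber]
  split_ifs <;> omega

theorem input_idx_arcNumber (a : GridArc L T) :
    I.input.idx (2 + arcNumber a) = if I.cap a < ⊤ then 1 else 0 := by
  simp only [input]
  rw [if_neg (by omega), if_neg (by omega), Nat.add_sub_cancel_left,
    (arcNumber_injective L T).extend_apply]

theorem input_real_supply {l t : ℕ} (hl : l < L) (ht : t < T) :
    I.input.real (L * t + l) = (I.supplyAt l t : ℝ) := by
  have h : L * t + l = vertexNumber ((⟨l, hl⟩, ⟨t, ht⟩) : GridVertex L T) := rfl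
  simp only [input]
  rw [if_pos (mul_add_lt_mul hl ht), h, (vertexNumber_injective L T).extend_apply, supplyAt,
    dif_pos ⟨hl, ht⟩]

theorem input_real_arcNumber (a : GridArc L T) :
    I.input.real (L * T + arcNumber a) = ((I.cap a).toNat : ℝ) := by
  simp only [input]
  rw [if_neg (by omega), Nat.add_sub_cancel_left, (arcNumber_injective L T).extend_apply]

theorem input_real_of_ne {e : ℕ} (he : ∀ a : GridArc L T, arcNumber a ≠ e) :
    I.input.real (L * T + e) = 0 := by
  simp only [input]
  rw [if_neg (by omega), Nat.add_sub_cancel_left,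
    Function.extend_apply' _ _ _ fun ⟨a, ha⟩ => he a ha]
  rfl

/-- Register `2 + e` is odd for a forward arc. For a downward arc it is `2 * (L * t + (l + 1))` with
`0 < l + 1 < L`. -/
theorem not_dvd_two_add_arcNumber (a : GridArc L T) : ¬ 2 * L ∣ 2 + arcNumber a := by
  rcases a.eq_down_or_fwd with ⟨l, t, hl, ht, rfl⟩ | ⟨l, t, hl, ht, rfl⟩
  · rw [GridArc.arcNumber_down, show 2 + 2 * (L * t + l) = 2 * (L * t + (l + 1)) by ring,
      Nat.mul_dvd_mul_iff_left two_pos, Nat.dvd_add_right (Nat.dvd_mul_right L t)]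
    exact Nat.not_dvd_of_pos_of_lt (Nat.succ_pos l) hl
  · rw [GridArc.arcNumber_fwd]
    intro h
    have := (Nat.dvd_mul_right 2 L).trans h
    omega

variable (K) in
/-- The memory holds the data of the instance, the row sums and the candidate values. -/
structure Represents (I : MFG L T) (h : Mem) : Prop where
  flag : ∀ a, h.i 1 (arcNumber a) = if I.cap a < ⊤ then 1 else 0
  cap : ∀ a, h.r 0 (L * T + arcNumber a) = ((I.cap a).toNat : ℝ)
  noArc : ∀ e < 2 * (L * T), (∀ a : GridArc L T, arcNumber a ≠ e) → h.r 0 (L * T + e) = 0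
  rowSum : ∀ l < L, ∀ t ≤ T, h.r 1 (L * t + l) = I.rowSum l t
  cand : ∀ i < numCand L K T, h.r 2 i = candValue L K T h i

namespace Represents

variable {h : Mem}

theorem of_sameData {h' : Mem} (hI : I.Represents K h) (hs : SameData h h') :
    I.Represents K h' where
  flag := by rw [hs.i1]; exact hI.flag
  cap := by rw [hs.r0]; exact hI.cap
  noArc := by rw [hs.r0]; exact hI.noArc
  rowSum := by rw [hs.r1]; exact hI.rowSum
  cand i hi := by
    rw [hs.r2, hI.cand i hi]
    simp only [candValue, hs.r0, hs.r1]

theorem flag_iff (hI : I.Represents K h) (a : GridArc L T) :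
    h.i 1 (arcNumber a) = 1 ↔ I.cap a ≠ ⊤ := by
  rw [hI.flag a, ← lt_top_iff_ne_top]
  split_ifs with h1 <;> simp [h1]

theorem le_cap_iff (hI : I.Represents K h) (a : GridArc L T) (x : ℝ) :
    (h.i 1 (arcNumber a) = 1 → x ≤ h.r 0 (L * T + arcNumber a)) ↔
      ∀ k : ℕ, I.cap a = k → x ≤ k := by
  rw [hI.flag_iff, hI.cap]
  constructor
  · intro h1 k hk
    simpa [hk] using h1 (by simp [hk])
  · intro h1 h2
    exact h1 _ (ENat.natCast_toNat h2).symm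

/-- In state `0` every digit is zero, so every row uses candidate `0`, whose coefficients are all `0
- 0`. Thus state `0` encodes the left boundary, from which the path starts. -/
theorem level_zero (hI : I.Represents K h) (l : ℕ) : level L K T h 0 l = 0 := by
  have hR : 0 < radix L T := by
    unfold radix
    positivity
  have hM : 0 < numCand L K T := Nat.pow_pos hR
  rw [level]
  split_ifs
  · rfl
  · rw [digit_zero hM, hI.cand 0 hM]
    simp [candValue, candDigit, digit_zero hR]

theorem stepCost_eq (hI : I.Represents K h) {φ : ℕ → ℕ → ℝ} (hφ : I.IsStream φ) {σ : ℕ → ℕ}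
    (hσ : ∀ l ≤ L, ∀ t ≤ T, level L K T h (σ t) l = φ l t) :
    ∑ t ∈ Finset.range T, stepCost L K ⟨T, I.oracle⟩ h t (σ t) (σ (t + 1)) =
      I.totalCost (I.streamFlow φ) := by
  rw [totalCost_eq]
  refine Finset.sum_congr rfl fun t ht => Finset.sum_congr rfl fun l hl => ?_
  rw [Finset.mem_range] at ht hl
  rw [hφ.byNumber_even hl ht, hφ.byNumber_odd hl ht]
  simp only [downValue, fwdValue]
  rw [hσ _ (by omega) _ (by omega), hσ _ (by omega) _ (by omega), hσ _ (by omega) _ (by omega),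
    hI.rowSum l hl _ (by omega)]

theorem isStream_of_stepOk (hI : I.Represents K h) (hT : 0 < T) {σ : ℕ → ℕ} (h0 : σ 0 = 0)
    (hok : ∀ t < T, StepOk L K T h t (σ t) (σ (t + 1))) :
    I.IsStream (fun l t => level L K T h (σ t) l) where
  top t := by simp [level]
  bottom t := by simp [level]
  left l := by rw [h0, hI.level_zero]
  right l hl := by
    obtain ⟨t, rfl⟩ : ∃ t, T = t + 1 := ⟨T - 1, by omega⟩
    obtain ⟨-, h1, -, -, h2⟩ := hok t (Nat.lt_succ_self t) l hl
    rw [fwdValue, hI.rowSum l hl _ le_rfl] at h1 h2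
    exact le_antisymm (h2 rfl) h1

theorem mem_capInterval_of_stepOk (hI : I.Represents K h) {σ : ℕ → ℕ}
    (hok : ∀ t < T, StepOk L K T h t (σ t) (σ (t + 1))) (a : GridArc L T) :
    I.streamFlow (fun l t => level L K T h (σ t) l) a ∈ capInterval (I.cap a) := by
  rcases a.eq_down_or_fwd with ⟨l, t, hl, ht, rfl⟩ | ⟨l, t, hl, ht, rfl⟩
  · obtain ⟨h1, -, h2, -, -⟩ := hok t ht l (by omega)
    rw [← GridArc.arcNumber_down l t hl ht, hI.le_cap_iff] at h2
    rw [streamFlow_down]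
    exact ⟨h1, h2⟩
  · obtain ⟨-, h1, -, h2, -⟩ := hok t (by omega) l hl
    rw [← GridArc.arcNumber_fwd l t hl ht, hI.le_cap_iff] at h2
    rw [fwdValue, hI.rowSum l hl _ ht.le] at h1 h2
    rw [streamFlow_fwd]
    exact ⟨h1, h2⟩

theorem stepOk_of_isStream (hI : I.Represents K h) {φ : ℕ → ℕ → ℝ} (hφ : I.IsStream φ)
    (hx : ∀ a, I.streamFlow φ a ∈ capInterval (I.cap a)) {σ : ℕ → ℕ}
    (hσ : ∀ l ≤ L, ∀ t ≤ T, level L K T h (σ t) l = φ l t) {t : ℕ} (ht : t < T) :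
    StepOk L K T h t (σ t) (σ (t + 1)) := by
  intro l hl
  have hlt := mul_add_lt_mul hl ht
  have e1 : downValue L K T h (σ t) (σ (t + 1)) l = φ (l + 1) (t + 1) - φ (l + 1) t := by
    rw [downValue, hσ _ (by omega) _ (by omega), hσ _ (by omega) _ (by omega)]
  have e2 : fwdValue L K T h t (σ (t + 1)) l =
      φ l (t + 1) - φ (l + 1) (t + 1) + I.rowSum l (t + 1) := by
    rw [fwdValue, hσ _ (by omega) _ (by omega), hσ _ (by omega) _ (by omega),
      hI.rowSum l hl _ (by omega)]
  have h1 : 0 ≤ downValue L K T h (σ t) (σ (t + 1)) l ∧ (h.i 1 (2 * (L * t + l)) = 1 →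
      downValue L K T h (σ t) (σ (t + 1)) l ≤ h.r 0 (L * T + 2 * (L * t + l))) := by
    rw [e1]
    by_cases hl' : l + 1 < L
    · rw [← GridArc.arcNumber_down l t hl' ht, hI.le_cap_iff, ← streamFlow_down φ l t hl' ht]
      exact hx _
    -- No arc leaves the last row downwards, and its flag is unspecified. The test still succeeds,
    -- because the value and the stored capacity are both `0`.
    · rw [show l + 1 = L by omega, hφ.bottom, hφ.bottom, sub_zero,
        hI.noArc _ (by omega) (arcNumber_ne_even (by omega))]
      simp
  have h2 : 0 ≤ fwdValue L K T h t (σ (t + 1)) l ∧ (h.i 1 (2 * (L * t + l) + 1) = 1 →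
      fwdValue L K T h t (σ (t + 1)) l ≤ h.r 0 (L * T + (2 * (L * t + l) + 1))) ∧
      (t + 1 = T → fwdValue L K T h t (σ (t + 1)) l ≤ 0) := by
    rw [e2]
    by_cases ht' : t + 1 < T
    · rw [← GridArc.arcNumber_fwd l t hl ht', hI.le_cap_iff, ← streamFlow_fwd φ l t hl ht']
      exact ⟨(hx _).1, (hx _).2, by omega⟩
    · have ht2 : t + 1 = T := by omega
      rw [ht2, hφ.right l hl, hI.noArc _ (by omega) (arcNumber_ne_odd hl ht2)]
      simp
  exact ⟨h1.1, h2.1, h1.2, h2.2⟩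

/-- Each capacity is found at some address `e`, and an integer coefficient is split into its
positive and negative parts. Unused terms are padded with the coefficient `0 - 0`. -/
theorem exists_coefficients {f : ℕ → ℝ} {R N : ℕ} (hN : N < R) (m : ℕ → ℤ) (hm : ∀ u, |m u| ≤ N)
    (S : Finset ℕ) (hS : ∀ u ∈ S, ∃ e < R, f e = u) (K : ℕ) (hK : S.card ≤ K) :
    ∃ p q e : ℕ → ℕ, (∀ k, p k < R ∧ q k < R ∧ e k < R) ∧
      ∑ u ∈ S, (m u : ℝ) * u = ∑ k ∈ Finset.range K, ((p k : ℝ) - q k) * f (e k) := by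
  induction S using Finset.induction_on generalizing K with
  | empty => exact ⟨0, 0, 0, fun k => by simp; omega, by simp⟩
  | insert u S hu ih =>
    rw [Finset.card_insert_of_notMem hu] at hK
    obtain ⟨K, rfl⟩ : ∃ K', K = K' + 1 := ⟨K - 1, by omega⟩
    obtain ⟨p, q, e, h1, h2⟩ := ih (fun u hu => hS u (Finset.mem_insert_of_mem hu)) K (by omega)
    obtain ⟨e', he', hfe⟩ := hS u (Finset.mem_insert_self u S)
    have hmu := abs_le.1 (hm u)
    refine ⟨Function.update p K (m u).toNat, Function.update q K (-m u).toNat,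
      Function.update e K e', fun k => ?_, ?_⟩
    · rcases eq_or_ne k K with rfl | hk
      · simp only [Function.update_self]
        omega
      · simpa [hk] using h1 k
    · rw [Finset.sum_insert hu, Finset.sum_range_succ, h2, add_comm]
      congr 1
      · refine Finset.sum_congr rfl fun k hk => ?_
        simp [(Finset.mem_range.1 hk).ne]
      · simp only [Function.update_self, hfe]
        congr 1
        exact_mod_cast (Int.toNat_sub_toNat_neg (m u)).symm

theorem exists_cand (hI : I.Represents K h) (hK : I.numCapacities ≤ K) (hL : 0 < L) {v : ℝ}
    (hv : I.IsNear ((L + 1) * (T + 1)) v) : ∃ i < numCand L K T, h.r 2 i = v := by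
  obtain ⟨β, hβ, m, hm, rfl⟩ := hv
  have hR : (L + 1) * (T + 1) < radix L T := by
    have : 0 < (L + 1) * (T + 1) := by positivity
    rw [radix]
    omega
  have hR2 : L * T + T + L < radix L T := by
    rw [radix]
    nlinarith
  have hR3 : 2 * (L * T) < radix L T := by
    rw [radix]
    nlinarith
  have h1R : 1 < radix L T := by
    have : 0 < (L + 1) * (T + 1) := by positivity
    omega
  obtain ⟨p, q, e, h1, h2⟩ := exists_coefficients (f := fun e => h.r 0 (L * T + e)) hR m hm
    I.capacities (fun u hu => by
      obtain ⟨a, ha⟩ := mem_capacities.1 hu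
      exact ⟨arcNumber a, (arcNumber_lt a).trans hR3, by rw [hI.cap, ha, ENat.toNat_natCast]⟩)
    K (card_capacities.trans_le hK)
  obtain ⟨p₀, q₀, e₀, hp₀, hq₀, he₀, hβ'⟩ : ∃ p₀ q₀ e₀ : ℕ, p₀ < radix L T ∧ q₀ < radix L T ∧
      e₀ < radix L T ∧ β = ((p₀ : ℝ) - q₀) * h.r 1 e₀ := by
    rcases hβ with rfl | ⟨r, hr, t, ht, h3⟩
    · exact ⟨0, 0, 0, by omega, by omega, by omega, by simp⟩
    · have hlt : L * t + r < radix L T := by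
        have := mul_add_lt_mul hr (Nat.lt_succ_of_le ht)
        rw [Nat.mul_succ] at this
        omega
      rcases h3 with rfl | rfl
      · exact ⟨1, 0, L * t + r, h1R, by omega, hlt, by rw [hI.rowSum r hr t ht]; simp⟩
      · exact ⟨0, 1, L * t + r, by omega, h1R, hlt, by rw [hI.rowSum r hr t ht]; simp⟩
  -- Digits `3 * k`, `3 * k + 1`, `3 * k + 2` hold positive part, negative part and address of term
  -- `k`; term `0` is the base value.
  let d (j : ℕ) : ℕ := if j % 3 = 0 then (if j / 3 = 0 then p₀ else p (j / 3 - 1))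
    else if j % 3 = 1 then (if j / 3 = 0 then q₀ else q (j / 3 - 1))
    else if j / 3 = 0 then e₀ else e (j / 3 - 1)
  have hd (j : ℕ) : d j < radix L T := by
    have := h1 (j / 3 - 1)
    simp only [d]
    split_ifs <;> omega
  have d0 (k : ℕ) : d (3 * k) = if k = 0 then p₀ else p (k - 1) := by
    simp [d]
  have d1 (k : ℕ) : d (3 * k + 1) = if k = 0 then q₀ else q (k - 1) := by
    simp only [d, show (3 * k + 1) / 3 = k by omega, show (3 * k + 1) % 3 = 1 by omega]
    rfl
  have d2 (k : ℕ) : d (3 * k + 2) = if k = 0 then e₀ else e (k - 1) := by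
    simp only [d, show (3 * k + 2) / 3 = k by omega, show (3 * k + 2) % 3 = 2 by omega]
    rfl
  obtain ⟨i, hi, hdi⟩ := exists_digit_eq (k := 3 * (K + 1)) d (fun j _ => hd j) (by omega)
  refine ⟨i, hi, ?_⟩
  have hterm : ∀ k ∈ Finset.range (K + 1),
      ((candDigit L K T (3 * k) i : ℝ) - candDigit L K T (3 * k + 1) i) *
        (if k = 0 then h.r 1 (candDigit L K T (3 * k + 2) i)
          else h.r 0 (L * T + candDigit L K T (3 * k + 2) i)) =
      ((d (3 * k) : ℝ) - d (3 * k + 1)) * (if k = 0 then h.r 1 (d (3 * k + 2))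
          else h.r 0 (L * T + d (3 * k + 2))) := by
    intro k hk
    rw [Finset.mem_range] at hk
    simp only [candDigit, numCand]
    rw [hdi _ (by omega), hdi _ (by omega), hdi _ (by omega)]
  rw [hI.cand i hi, candValue, Finset.sum_congr rfl hterm, Finset.sum_range_succ', h2, hβ',
    add_comm]
  simp only [d0, d1, d2]
  simp

theorem exists_states (hI : I.Represents K h) (hK : I.numCapacities ≤ K) (hL : 0 < L)
    {φ : ℕ → ℕ → ℝ} (hφ : I.IsStream φ)
    (hnear : ∀ l ≤ L, ∀ t ≤ T, I.IsNear ((L + 1) * (T + 1)) (φ l t)) :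
    ∃ σ : ℕ → ℕ, σ 0 = 0 ∧ (∀ t ≤ T, σ t < numStates L K T) ∧
      ∀ l ≤ L, ∀ t ≤ T, level L K T h (σ t) l = φ l t := by
  have hM : 0 < numCand L K T := Nat.pow_pos (by unfold radix; positivity)
  have hex (t : ℕ) (ht : t ≤ T) : ∃ s < numStates L K T,
      ∀ l ≤ L, level L K T h s l = φ l t := by
    choose! i hi hi' using fun l (hl : l ≤ L) => hI.exists_cand hK hL (hnear l hl t ht)
    obtain ⟨s, hs, hds⟩ := exists_digit_eq (k := L + 1) i
      (fun l hl => hi l (Nat.lt_succ_iff.1 hl)) hM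
    refine ⟨s, hs, fun l hl => ?_⟩
    rw [level]
    split_ifs with h0
    · rcases h0 with rfl | rfl
      · rw [hφ.top]
      · rw [hφ.bottom]
    · rw [numStates, hds l (Nat.lt_succ_of_le hl), hi' l hl]
  choose! σ hσ hσ' using hex
  refine ⟨fun t => if t = 0 then 0 else σ t, rfl, fun t ht => ?_, fun l hl t ht => ?_⟩
  · simp only
    split_ifs
    · exact numStates_pos T
    · exact hσ t ht
  · simp only
    split_ifs with h0
    · rw [h0, hφ.left, hI.level_zero]
    · exact hσ' t ht l hl

/-- The table and the trace solve the instance. -/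
theorem isSolvedBy (hI : I.Represents K h) (hK : I.numCapacities ≤ K) (hL : 0 < L) (hT : 0 < T)
    {r₁ r₂ : ℕ} (hr : I.TerminalsIn r₁ r₂) (htab : TableFrom L K ⟨T, I.oracle⟩ h 0) {s : State}
    (hs0 : s.idx 0 = (trace L K ⟨T, I.oracle⟩ h).i 2 0)
    (hs : ∀ e < 2 * (L * T), s.real e = (trace L K ⟨T, I.oracle⟩ h).r 4 e) : I.IsSolvedBy s := by
  obtain ⟨ht1, ht2⟩ := trace_spec (L := L) (K := K) ⟨T, I.oracle⟩ h
  rw [ht1] at hs0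
  -- A feasible flow is replaced by one with near values that costs no more; its columns are states,
  -- and they form an admissible sequence whose cost bounds the table entry.
  have hlower : ∀ y, I.IsFeasible y → h.i 2 0 = 1 ∧ h.r 3 0 ≤ I.totalCost y := by
    intro y hy
    obtain ⟨φ, h1, h2, h3, h4⟩ := hy.exists_isNear hr hT
    obtain ⟨σ, g1, g2, g3⟩ := hI.exists_states hK hL h1 h4
    have h5 := htab.le_of_sequence g2 (fun t ht => hI.stepOk_of_isStream h1 h2 g3 ht) g1
    refine ⟨h5.1, h5.2.trans ?_⟩
    simp only
    rwa [hI.stepCost_eq h1 g3]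
  by_cases hv : h.i 2 0 = 1
  · left
    refine ⟨hs0.trans hv, ?_⟩
    obtain ⟨h1, -, h3, h4⟩ := htab.path_spec hv (le_refl T)
    have h5 := hI.isStream_of_stepOk hT (σ := path L K ⟨T, I.oracle⟩ h) rfl h3
    have h6 := hI.mem_capInterval_of_stepOk h3
    have h7 : (fun a => s.real (arcNumber a)) =
        I.streamFlow (fun l t => level L K T h (path L K ⟨T, I.oracle⟩ h t) l) := by
      funext a
      rw [hs _ (arcNumber_lt a)]
      rcases a.eq_down_or_fwd with ⟨l, t, hl, ht, rfl⟩ | ⟨l, t, hl, ht, rfl⟩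
      · rw [GridArc.arcNumber_down, streamFlow_down, (ht2 t ht l (by omega)).1, downValue]
      · rw [GridArc.arcNumber_fwd, streamFlow_fwd, (ht2 t (by simp only; omega) l hl).2, fwdValue,
          hI.rowSum l hl _ ht.le]
    rw [h7]
    refine ⟨h5.isFeasible_iff.2 h6, fun y hy => ?_⟩
    rw [← hI.stepCost_eq h5 fun _ _ _ _ => rfl]
    have h8 := htab.value_last _ h1
    simp only at h4 h8
    rw [h8, add_zero] at h4
    rw [← h4]
    exact (hlower y hy).2
  · right
    refine ⟨?_, fun x hx => hv (hlower x hx).1⟩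
    rcases htab.best 0 le_rfl hT 0 (numStates_pos T) with ⟨h1, -⟩ | ⟨h1, -⟩
    · simpa [hs0] using h1
    · exact absurd (by simpa using h1) hv

end Represents

theorem represents_fillCandidates {h : Mem}
    (h1 : ∀ e < 2 * L * T, ¬ 2 * L ∣ 2 + e → h.i 1 e = I.input.idx (2 + e))
    (h2 : ∀ j < 3 * (L * T), h.r 0 j = I.input.real j) (c : Ctx) (hc : c.T = T) :
    I.Represents K (fillCandidates L K c (fillRowSums L c h)) := by
  subst hc
  obtain ⟨f1, f2, f3⟩ := fillRowSums_spec (L := L) c h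
  obtain ⟨g1, g2, g3, g4⟩ := fillCandidates_spec (L := L) (K := K) c (fillRowSums L c h)
  refine ⟨fun a => ?_, fun a => ?_, fun e he he' => ?_, fun l hl t ht => ?_, fun i hi => ?_⟩
  · have := arcNumber_lt a
    rw [g1, f1, h1 _ (by rwa [mul_assoc]) (not_dvd_two_add_arcNumber a), input_idx_arcNumber]
  · have := arcNumber_lt a
    rw [g2, f2, h2 _ (by omega), input_real_arcNumber]
  · rw [g2, f2, h2 _ (by omega), input_real_of_ne he']
  · rw [g3, f3 l hl t ht, rowSum]
    refine Finset.sum_congr rfl fun j hj => ?_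
    rw [Finset.mem_range] at hj
    have := mul_add_lt_mul hl (show j < c.T by omega)
    rw [h2 _ (by omega), input_real_supply hl (by omega)]
  · rw [g4 i hi]
    simp only [candValue, g2, g3]

theorem TerminalsInTwoRows.exists_terminalsIn (h : I.TerminalsInTwoRows) :
    ∃ r₁ r₂, I.TerminalsIn r₁ r₂ := by
  obtain ⟨r₁, r₂, hr⟩ := h
  rcases le_total r₁ r₂ with h | h
  · exact ⟨r₁, r₂, h, r₂.2, fun v hv => by simpa [Fin.ext_iff] using hr v hv⟩
  · exact ⟨r₂, r₁, h, r₁.2, fun v hv => by simpa [Fin.ext_iff] using (hr v hv).symm⟩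

end MFG

open RealRAM

theorem mainTheorem6 (L K : ℕ) :
    ∃ (P : RealRAM.Prog) (p : Polynomial ℕ),
      ∀ (T : ℕ) (I : MFG L T),
        I.IsCapacitated → I.numCapacities ≤ K → I.TerminalsInTwoRows →
          ∃ (n : ℕ) (s : RealRAM.State),
            RealRAM.Exec I.oracle P I.input n s ∧ n ≤ p.eval T ∧ I.IsSolvedBy s := by
  rcases Nat.eq_zero_or_pos L with rfl | hL
  -- Without rows there is no arc, hence no capacitated instance.
  · exact ⟨.instr (.iconst 0 0), 0, fun T I ⟨a, _⟩ => a.tail.1.elim0⟩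
  have : NeZero L := ⟨hL.ne'⟩
  obtain ⟨p₁, hp₁⟩ := runs_initProg L
  obtain ⟨P, p₂, hp₂⟩ := CComp.algorithm (L := L) (K := K) 0
  obtain ⟨p₃, hp₃⟩ := runs_finalProg L
  refine ⟨.seq (initProg L) (.seq P (finalProg L)), p₁ + (p₂ + p₃), fun T I ⟨a, _⟩ hK hrows => ?_⟩
  have hT : 0 < T := a.tail.2.pos
  obtain ⟨r₁, r₂, hr⟩ := hrows.exists_terminalsIn
  simp only [Polynomial.eval_add]
  refine Runs.seq ((hp₁ I.oracle T I.input (by simp [MFG.input])).mono le_rfl ?_)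
  rintro s₁ ⟨h, he, h1, h2⟩
  refine Runs.seq ((hp₂ ⟨T, I.oracle⟩ h s₁ he).mono le_rfl ?_)
  rintro s₂ ⟨he₂, -⟩
  refine (hp₃ I.oracle T _ s₂ he₂).mono le_rfl ?_
  rintro s₃ ⟨h3, h4⟩
  have hI := MFG.represents_fillCandidates (K := K) h1 h2 ⟨T, I.oracle⟩ rfl
  obtain ⟨f1, f2⟩ := fillLast_spec (L := L) (K := K) ⟨T, I.oracle⟩
    (fillCandidates L K ⟨T, I.oracle⟩ (fillRowSums L ⟨T, I.oracle⟩ h))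
  obtain ⟨g1, g2⟩ := fillTable_spec (L := L) (K := K) (c := ⟨T, I.oracle⟩)
    (h := fillLast L K ⟨T, I.oracle⟩ (fillCandidates L K ⟨T, I.oracle⟩
      (fillRowSums L ⟨T, I.oracle⟩ h)))
    -- Before the first round only the last column is tabulated, so the condition on earlier columns
    -- is vacuous.
    ⟨fun t h5 h6 => absurd h6 (by omega), fun s hs => (f2 s hs).1, fun s hs => (f2 s hs).2⟩
  exact (hI.of_sameData (f1.trans g1)).isSolvedBy hK hL hT hr g2 h3
    fun e he => h4 e (by rwa [mul_assoc])
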